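/- Let $d\ge 1$, $s\ge 0$ and $0<q\le\infty$. Use the Fourier transform $\hat f(\xi)=\int_{\mathbb R^d} f(x)e^{-2\pi i x\cdot\xi}\,dx$ and write $\langle x\rangle=(1+|x|^2)^{1/2}$. Let $\beta>0$ and let $\chi\in\mathcal S(\mathbb R^d)$ satisfy $\operatorname{supp}\hat\chi\subset\{|\xi|\le 1\}$ and $\sum_{k\in\mathbb Z^d}\hat\chi(\xi-\beta k)=1$ for all $\xi\in\mathbb R^d$. For $0<p\le\infty$ let $\mathcal M^{p,q}_{0,s}(\mathbb R^d)$ be the space of all tempered distributions $f$ on $\mathbb R^d$ with $$\|f\|_{\mathcal M^{p,q}_{0,s}}=\Big(\sum_{k\in\mathbb Z^d}\Big(\int_{\mathbb R^d}|f*(M_{\beta k}\chi)(x)|^p\,dx\Big)^{q/p}\langle\beta k\rangle^{sq}\Big)^{1/q}<\infty ,\qquad M_{\omega}\chi(y)=e^{2\pi i\omega\cdot y}\chi(y),$$ with the usual modifications (essential supremum, supremum) if $p=\infty$ or $q=\infty$. For $\alpha\ge 0$ put $m_\alpha(\xi)=e^{i|\xi|^\alpha}$ (with $|\xi|^0=1$),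 and for $\varphi\in\mathcal S(\mathbb R^d)$ let $$H_{m_\alpha}\varphi(x)=\int_{\mathbb R^d}m_\alpha(\xi)\,\hat\varphi(\xi)\,e^{2\pi i\xi\cdot x}\,d\xi .$$ 1. If $1\le p\le\infty$ and $\alpha\in[0,2]$, then $H_{m_\alpha}$ extends from $\mathcal S(\mathbb R^d)$ to a bounded linear operator on $\mathcal M^{p,q}_{0,s}(\mathbb R^d)$. 2. If $\alpha\in\{1,2\}$ and $\frac{d}{d+1}<p\le\infty$, then $H_{m_\alpha}$ extends from $\mathcal S(\mathbb R^d)$ to a bounded linear operator on $\mathcal M^{p,q}_{0,s}(\mathbb R^d)$. Here "extends to a bounded linear operator" means: $\mathcal S(\mathbb R^d)\subset\mathcal M^{p,q}_{0,s}(\mathbb R^d)$, and there are a linear map $T:\mathcal M^{p,q}_{0,s}(\mathbb R^d)\to\mathcal M^{p,q}_{0,s}(\mathbb R^d)$ and a finite constant $C$ with $\|Tf\|_{\mathcal M^{p,q}_{0,s}}\le C\|f\|_{\mathcal M^{p,q}_{0,s}}$ for all $f\in\mathcal M^{p,q}_{0,s}(\mathbb R^d)$ and $T\varphi=H_{m_\alpha}\varphi$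 for all $\varphi\in\mathcal S(\mathbb R^d)$. -/

import Mathlib

open MeasureTheory FourierTransform Filter Topology
open scoped SchwartzMap ENNReal NNReal

noncomputable section

namespace ModulationSpace

variable {d : ℕ}

/-- The character `y ↦ exp (2 π i ω · y)` of `ℝ^d`. -/
def character (ω y : EuclideanSpace ℝ (Fin d)) : ℂ :=
  Complex.exp ((2 * Real.pi * inner ℝ ω y : ℝ) * Complex.I)

/-- The exponential `t ↦ exp (i t)` has temperate growth. -/
theorem hasTemperateGrowth_exp_mul_I :
    (fun t : ℝ ↦ Complex.exp ((t : ℂ) * Complex.I)).HasTemperateGrowth := by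
  have hder : ∀ t : ℝ, HasDerivAt (fun t : ℝ ↦ Complex.exp ((t : ℂ) * Complex.I))
      (Complex.exp ((t : ℂ) * Complex.I) * Complex.I) t := by
    intro t
    have h := ((Complex.ofRealCLM.hasDerivAt (x := t)).mul_const Complex.I).cexp
    simpa using h
  have hit : ∀ n : ℕ, iteratedDeriv n (fun t : ℝ ↦ Complex.exp ((t : ℂ) * Complex.I)) =
      fun t : ℝ ↦ Complex.exp ((t : ℂ) * Complex.I) * Complex.I ^ n := by
    intro n
    induction n with
    | zero => simp
    | succ n ih =>
      rw [iteratedDeriv_succ, ih]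
      ext t
      rw [((hder t).mul_const (Complex.I ^ n)).deriv, pow_succ]
      ring
  refine ⟨(Complex.ofRealCLM.contDiff.mul contDiff_const).cexp, fun n ↦ ⟨0, 1, fun t ↦ ?_⟩⟩
  rw [norm_iteratedFDeriv_eq_norm_iteratedDeriv, hit]
  simp [Complex.norm_exp_ofReal_mul_I]

theorem hasTemperateGrowth_character (ω : EuclideanSpace ℝ (Fin d)) :
    (character ω).HasTemperateGrowth := by
  have h : (fun y : EuclideanSpace ℝ (Fin d) ↦
      2 * Real.pi * inner ℝ ω y).HasTemperateGrowth := by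
    fun_prop
  exact hasTemperateGrowth_exp_mul_I.comp h

/-- The modulation `M_ω χ (y) = exp (2 π i ω · y) χ (y)` of a Schwartz function. -/
def modulation (ω : EuclideanSpace ℝ (Fin d)) (χ : 𝓢(EuclideanSpace ℝ (Fin d), ℂ)) :
    𝓢(EuclideanSpace ℝ (Fin d), ℂ) :=
  SchwartzMap.smulLeftCLM ℂ (character ω) χ

theorem modulation_apply (ω : EuclideanSpace ℝ (Fin d)) (χ : 𝓢(EuclideanSpace ℝ (Fin d), ℂ))
    (y : EuclideanSpace ℝ (Fin d)) : modulation ω χ y = character ω y * χ y := by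
  simp [modulation, SchwartzMap.smulLeftCLM_apply_apply (hasTemperateGrowth_character ω)]

/-- The reflected translate `y ↦ ψ (x - y)` of a Schwartz function. -/
def reflTranslate (x : EuclideanSpace ℝ (Fin d)) (ψ : 𝓢(EuclideanSpace ℝ (Fin d), ℂ)) :
    𝓢(EuclideanSpace ℝ (Fin d), ℂ) :=
  SchwartzMap.compSubConstCLM ℂ x
    (SchwartzMap.compCLMOfContinuousLinearEquiv ℂ (ContinuousLinearEquiv.neg ℝ) ψ)

theorem reflTranslate_apply (x y : EuclideanSpace ℝ (Fin d))
    (ψ : 𝓢(EuclideanSpace ℝ (Fin d), ℂ)) : reflTranslate x ψ y = ψ (x - y) := by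
  simp [reflTranslate]

/-- The convolution `(f * ψ) (x) = f (ψ (x - ·))` of a tempered distribution with a Schwartz
function, as a function on `ℝ^d`. -/
def conv (f : 𝓢'(EuclideanSpace ℝ (Fin d), ℂ)) (ψ : 𝓢(EuclideanSpace ℝ (Fin d), ℂ))
    (x : EuclideanSpace ℝ (Fin d)) : ℂ :=
  f (reflTranslate x ψ)

/-- Translation is continuous on the Schwartz space. -/
theorem continuous_compSubConst (ψ : 𝓢(EuclideanSpace ℝ (Fin d), ℂ)) :
    Continuous fun a : EuclideanSpace ℝ (Fin d) ↦ SchwartzMap.compSubConstCLM ℂ a ψ := by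
  have key : ∀ φ : 𝓢(EuclideanSpace ℝ (Fin d), ℂ),
      Tendsto (fun a : EuclideanSpace ℝ (Fin d) ↦ SchwartzMap.compSubConstCLM ℂ a φ)
        (𝓝 0) (𝓝 φ) := by
    intro φ
    rw [(schwartz_withSeminorms ℂ (EuclideanSpace ℝ (Fin d)) ℂ).tendsto_nhds]
    rintro ⟨k, n⟩ ε hε
    set A : ℝ := 2 ^ k * (SchwartzMap.seminorm ℂ k (n + 1) φ + SchwartzMap.seminorm ℂ 0 (n + 1) φ)
      with hA
    have hA0 : 0 ≤ A := by positivity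
    have hbound : ∀ a : EuclideanSpace ℝ (Fin d), ‖a‖ ≤ 1 →
        SchwartzMap.seminorm ℂ k n (SchwartzMap.compSubConstCLM ℂ a φ - φ) ≤ A * ‖a‖ := by
      intro a ha
      refine SchwartzMap.seminorm_le_bound ℂ k n _ (by positivity) fun x ↦ ?_
      have h1 : iteratedFDeriv ℝ n (⇑(SchwartzMap.compSubConstCLM ℂ a φ - φ)) x =
          iteratedFDeriv ℝ n φ (x - a) - iteratedFDeriv ℝ n φ x := by
        have he : (⇑(SchwartzMap.compSubConstCLM ℂ a φ - φ)) =
            (fun y ↦ φ (y - a)) - ⇑φ := by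
          ext y; simp
        have hs : ContDiff ℝ n (⇑φ) := φ.smooth n
        have hs' : ContDiff ℝ n fun y ↦ φ (y - a) := hs.comp (contDiff_id.sub contDiff_const)
        rw [he, iteratedFDeriv_sub_apply hs'.contDiffAt hs.contDiffAt,
          iteratedFDeriv_comp_sub]
      rw [h1]
      have h2 : ‖x‖ ^ k * ‖iteratedFDeriv ℝ n φ (x - a) - iteratedFDeriv ℝ n φ x‖ =
          ‖(‖x‖ ^ k) • iteratedFDeriv ℝ n φ (x - a) - (‖x‖ ^ k) • iteratedFDeriv ℝ n φ x‖ := by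
        rw [← smul_sub, norm_smul, norm_pow, norm_norm]
      have hdiff : Differentiable ℝ (iteratedFDeriv ℝ n φ) :=
        (φ.smooth (n + 1 : ℕ)).differentiable_iteratedFDeriv (by exact_mod_cast Nat.lt_succ_self n)
      have h3 := (convex_segment x (x - a)).norm_image_sub_le_of_norm_fderiv_le
        (𝕜 := ℝ) (f := fun y ↦ (‖x‖ ^ k) • iteratedFDeriv ℝ n φ y) (C := A)
        (fun y _ ↦ (hdiff y).fun_const_smul _) ?_ (left_mem_segment ℝ _ _) (right_mem_segment ℝ _ _)
      · rw [h2]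
        simpa using h3
      · intro y hy
        rw [segment_eq_image'] at hy
        obtain ⟨t, ⟨ht0, ht1⟩, rfl⟩ := hy
        rw [fderiv_fun_const_smul (hdiff _), norm_smul, norm_pow, norm_norm,
          norm_fderiv_iteratedFDeriv]
        set y := x + t • (x - a - x) with hy
        have hxy : ‖x‖ ≤ ‖y‖ + 1 := by
          have : x = y + t • a := by rw [hy]; module
          calc ‖x‖ = ‖y + t • a‖ := by rw [← this]
            _ ≤ ‖y‖ + ‖t • a‖ := norm_add_le _ _
            _ ≤ ‖y‖ + 1 := by
              rw [norm_smul, Real.norm_of_nonneg ht0]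
              nlinarith [norm_nonneg a]
        have hpow : ‖x‖ ^ k ≤ 2 ^ k * (‖y‖ ^ k + 1) := by
          rcases le_total ‖y‖ 1 with h | h
          · calc ‖x‖ ^ k ≤ 2 ^ k := by gcongr; linarith
              _ ≤ 2 ^ k * (‖y‖ ^ k + 1) :=
                le_mul_of_one_le_right (by positivity) (by linarith [pow_nonneg (norm_nonneg y) k])
          · calc ‖x‖ ^ k ≤ (2 * ‖y‖) ^ k := by gcongr; linarith
              _ = 2 ^ k * ‖y‖ ^ k := mul_pow _ _ _
              _ ≤ 2 ^ k * (‖y‖ ^ k + 1) := by gcongr; linarith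
        have e1 := SchwartzMap.le_seminorm ℂ k (n + 1) φ y
        have e2 := SchwartzMap.le_seminorm ℂ 0 (n + 1) φ y
        rw [pow_zero, one_mul] at e2
        calc ‖x‖ ^ k * ‖iteratedFDeriv ℝ (n + 1) φ y‖
            ≤ 2 ^ k * (‖y‖ ^ k + 1) * ‖iteratedFDeriv ℝ (n + 1) φ y‖ := by gcongr
          _ = 2 ^ k * (‖y‖ ^ k * ‖iteratedFDeriv ℝ (n + 1) φ y‖ +
              ‖iteratedFDeriv ℝ (n + 1) φ y‖) := by ring
          _ ≤ A := by rw [hA]; gcongr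
    have hlim : Tendsto (fun a : EuclideanSpace ℝ (Fin d) ↦ A * ‖a‖) (𝓝 0) (𝓝 0) := by
      have : Continuous fun a : EuclideanSpace ℝ (Fin d) ↦ A * ‖a‖ := by fun_prop
      simpa using this.tendsto 0
    filter_upwards [hlim.eventually (gt_mem_nhds hε), Metric.closedBall_mem_nhds 0 one_pos]
      with a h1 h2
    rw [SchwartzMap.schwartzSeminormFamily_apply]
    exact (hbound a (by simpa using h2)).trans_lt h1
  rw [continuous_iff_continuousAt]
  intro a₀
  have h := (key (SchwartzMap.compSubConstCLM ℂ a₀ ψ)).comp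
    (show Tendsto (fun a : EuclideanSpace ℝ (Fin d) ↦ a - a₀) (𝓝 a₀) (𝓝 0) by
      have : Continuous fun a : EuclideanSpace ℝ (Fin d) ↦ a - a₀ := by fun_prop
      simpa using this.tendsto a₀)
  refine h.congr fun a ↦ ?_
  simp

theorem continuous_conv (f : 𝓢'(EuclideanSpace ℝ (Fin d), ℂ))
    (ψ : 𝓢(EuclideanSpace ℝ (Fin d), ℂ)) : Continuous (conv f ψ) :=
  f.continuous.comp (continuous_compSubConst _)

/-- The point of `ℝ^d` with the integer coordinates `k`. -/
def latticePoint (k : Fin d → ℤ) : EuclideanSpace ℝ (Fin d) :=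
  WithLp.toLp 2 fun i ↦ (k i : ℝ)

/-- The Japanese bracket `⟨x⟩ = (1 + |x|²)^{1/2}`. -/
def bracket (x : EuclideanSpace ℝ (Fin d)) : ℝ :=
  Real.sqrt (1 + ‖x‖ ^ 2)

/-- `χ` and `β` generate a uniform frequency decomposition: `β > 0`, the Fourier transform of
the Schwartz function `χ` is supported in the closed unit ball, and its translates by `β ℤ^d`
form a partition of unity. -/
structure IsFrequencyPartition (β : ℝ) (χ : 𝓢(EuclideanSpace ℝ (Fin d), ℂ)) : Prop where
  pos : 0 < β
  support_subset : tsupport (𝓕 χ : 𝓢(EuclideanSpace ℝ (Fin d), ℂ)) ⊆ Metric.closedBall 0 1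
  hasSum_one : ∀ ξ : EuclideanSpace ℝ (Fin d),
    HasSum (fun k : Fin d → ℤ ↦
      (𝓕 χ : 𝓢(EuclideanSpace ℝ (Fin d), ℂ)) (ξ - β • latticePoint k)) 1

/-- The (quasi-)norm of `M^{p,q}_{0,s}`, with values in `[0, ∞]`: the weighted `ℓ^q` norm
`(∑_k ‖f * M_{βk} χ‖_{L^p}^q ⟨βk⟩^{sq})^{1/q}`, a supremum over `k` if `q = ∞`. -/
def modNorm (β : ℝ) (χ : 𝓢(EuclideanSpace ℝ (Fin d), ℂ)) (p q : ℝ≥0∞) (s : ℝ)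
    (f : 𝓢'(EuclideanSpace ℝ (Fin d), ℂ)) : ℝ≥0∞ :=
  eLpNorm (fun k : Fin d → ℤ ↦
    ENNReal.ofReal (bracket (β • latticePoint k) ^ s) *
      eLpNorm (conv f (modulation (β • latticePoint k) χ)) p volume) q Measure.count

/-- The modulation space `M^{p,q}_{0,s}`: the tempered distributions of finite (quasi-)norm. -/
def modSpace (β : ℝ) (χ : 𝓢(EuclideanSpace ℝ (Fin d), ℂ)) (p q : ℝ≥0∞) (s : ℝ) :
    Submodule ℂ 𝓢'(EuclideanSpace ℝ (Fin d), ℂ) where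
  carrier := {f | modNorm β χ p q s f < ∞}
  zero_mem' := by
    have h : ∀ ψ : 𝓢(EuclideanSpace ℝ (Fin d), ℂ),
        conv (0 : 𝓢'(EuclideanSpace ℝ (Fin d), ℂ)) ψ = 0 := by
      intro ψ; ext x; rfl
    simp [modNorm, h]
  add_mem' := by
    intro f g hf hg
    have hadd : ∀ ψ : 𝓢(EuclideanSpace ℝ (Fin d), ℂ), conv (f + g) ψ = conv f ψ + conv g ψ := by
      intro ψ; ext x; rfl
    have hlt := eLpNorm_add_lt_top (μ := (Measure.count : Measure (Fin d → ℤ)))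
      (p := q) (ε := ℝ≥0∞)
      ⟨(measurable_of_countable _).aestronglyMeasurable, hf⟩
      ⟨(measurable_of_countable _).aestronglyMeasurable, hg⟩
    refine (eLpNorm_le_nnreal_smul_eLpNorm_of_ae_le_mul' (c := (ENNReal.LpAddConst p).toNNReal)
      (Eventually.of_forall fun k ↦ ?_) q).trans_lt
      (ENNReal.mul_lt_top ENNReal.coe_lt_top hlt)
    rw [ENNReal.coe_toNNReal (ENNReal.LpAddConst_lt_top p).ne]
    simp only [enorm_eq_self, Pi.add_apply]
    rw [← mul_add, mul_left_comm]
    gcongr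
    rw [hadd]
    exact eLpNorm_add_le' (continuous_conv f _).aestronglyMeasurable
      (continuous_conv g _).aestronglyMeasurable p
  smul_mem' := by
    intro c f hf
    have hsmul : ∀ ψ : 𝓢(EuclideanSpace ℝ (Fin d), ℂ), conv (c • f) ψ = c • conv f ψ := by
      intro ψ; ext x; rfl
    refine (eLpNorm_le_nnreal_smul_eLpNorm_of_ae_le_mul' (c := ‖c‖₊)
      (Eventually.of_forall fun k ↦ ?_) q).trans_lt
      (ENNReal.mul_lt_top ENNReal.coe_lt_top hf)
    simp only [enorm_eq_self]
    rw [hsmul, eLpNorm_const_smul, mul_left_comm]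
    rfl

/-- The Fourier multiplier operator with symbol `σ` on a Schwartz function `φ`:
`H_σ φ (x) = ∫ σ(ξ) φ^(ξ) exp (2 π i ξ · x) dξ`. -/
def multiplier (σ : EuclideanSpace ℝ (Fin d) → ℂ) (φ : 𝓢(EuclideanSpace ℝ (Fin d), ℂ))
    (x : EuclideanSpace ℝ (Fin d)) : ℂ :=
  ∫ ξ, σ ξ * (𝓕 φ : 𝓢(EuclideanSpace ℝ (Fin d), ℂ)) ξ * character ξ x

/-- The Fourier multiplier operator `H_σ`, defined on Schwartz functions, extends to a bounded
linear operator on `M^{p,q}_{0,s}`. In particular every Schwartz function, regarded as a tempered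
distribution, lies in `M^{p,q}_{0,s}`, and the operator sends it to the tempered distribution
given by the function `H_σ φ`. -/
def MultiplierExtends (σ : EuclideanSpace ℝ (Fin d) → ℂ) (β : ℝ)
    (χ : 𝓢(EuclideanSpace ℝ (Fin d), ℂ)) (p q : ℝ≥0∞) (s : ℝ) : Prop :=
  ∃ T : modSpace β χ p q s →ₗ[ℂ] modSpace β χ p q s,
    (∃ C : ℝ≥0, ∀ f : modSpace β χ p q s,
      modNorm β χ p q s (T f) ≤ C * modNorm β χ p q s f) ∧
    ∀ φ : 𝓢(EuclideanSpace ℝ (Fin d), ℂ),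
      ∃ hφ : SchwartzMap.toTemperedDistributionCLM (EuclideanSpace ℝ (Fin d)) ℂ volume φ ∈
          modSpace β χ p q s,
        ∀ ψ : 𝓢(EuclideanSpace ℝ (Fin d), ℂ),
          (T ⟨_, hφ⟩ : 𝓢'(EuclideanSpace ℝ (Fin d), ℂ)) ψ = ∫ x, multiplier σ φ x * ψ x

/-- The symbol `m_α(ξ) = exp (i |ξ|^α)`. -/
def symbol (α : ℝ) (ξ : EuclideanSpace ℝ (Fin d)) : ℂ :=
  Complex.exp (Complex.I * (‖ξ‖ ^ α : ℝ))

end ModulationSpace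

end

open MeasureTheory FourierTransform Filter Topology
open scoped SchwartzMap ENNReal NNReal
noncomputable section
namespace ModulationSpace

variable {d : ℕ}

/-! The norm of `modSpace` sees `f` only through the pieces `f * M_{βk} χ`, whose spectra lie in
unit balls, and a Fourier multiplier acts on each piece separately. It therefore suffices to bound
the multiplier on `L^p` functions with spectrum in a ball, with a constant independent of the
centre; the weight and the `ℓ^q` norm are then carried along. The tool is Fourier series: on a ball
of fixed radius a symbol is a sum of characters, so multiplication by it is a superposition of
translations weighted by Fourier coefficients (`hasSum_samp`). This is bounded on `L^p` as soon as
the coefficients lie in `ℓ^r`, `r = min(1, p)` (`eLpNorm_le_of_hasSum_translates`).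

For `α > 0` the symbol is split as `exp(i|ξ|^α) = exp(iP) + m`, where `P = phase α` is smooth and
equals `|ξ|^α` away from the origin, and `m = singularPart α` is continuous, compactly supported and
smooth off the origin. Since `α ≤ 2`, all derivatives of `P` of order at least two are bounded, so
near any `ω` it is affine up to a remainder controlled uniformly in `ω`. The affine phase is a
translation times a unimodular constant, an isometry of `L^p`; the exponential of the remainder has
rapidly decaying Fourier coefficients, uniformly in `ω` (`exists_eLpNorm_samp_cexp_le`).

The function `m` is singular like `|ξ|^α` at the origin, so its Fourier transform is `O(|y|^{-d-α})`
(`exists_norm_fourier_comp_smul_le`), and its samples are in `ℓ^r` if `d < (d + α) r`. For `p ≥ 1`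
this says `α > 0`; for `α ≥ 1` it follows from `p > d/(d+1)`.

Schwartz functions need not be dense when `p` or `q` is infinite, so the operator is defined
directly on the whole space. The symbol `exp(iP)` has temperate growth and acts on all tempered
distributions. The part `m` is a series of translates of the low-frequency part of `f`, which
converges because that part is bounded (`exists_norm_samp_le`). -/

/-! ### Characters and Fourier integrals. -/

theorem norm_character (ω y : EuclideanSpace ℝ (Fin d)) : ‖character ω y‖ = 1 := by
  rw [character, Complex.norm_exp_ofReal_mul_I]

theorem character_add_left (a b y : EuclideanSpace ℝ (Fin d)) :
    character (a + b) y = character a y * character b y := by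
  rw [character, character, character, ← Complex.exp_add, inner_add_left]
  congr 1; push_cast; ring

theorem character_add_right (a y z : EuclideanSpace ℝ (Fin d)) :
    character a (y + z) = character a y * character a z := by
  rw [character, character, character, ← Complex.exp_add, inner_add_right]
  congr 1; push_cast; ring

theorem character_comm (a y : EuclideanSpace ℝ (Fin d)) : character a y = character y a := by
  rw [character, character, real_inner_comm]

theorem character_zero_left (y : EuclideanSpace ℝ (Fin d)) : character 0 y = 1 := by
  simp [character]

theorem character_smul_left (c : ℝ) (a y : EuclideanSpace ℝ (Fin d)) :
    character (c • a) y = character a (c • y) := by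
  rw [character, character, inner_smul_left, inner_smul_right]; simp

theorem fourier_eq_integral_character (G : EuclideanSpace ℝ (Fin d) → ℂ)
    (y : EuclideanSpace ℝ (Fin d)) : 𝓕 G y = ∫ x, character (-y) x * G x := by
  rw [Real.fourier_eq']
  refine integral_congr_ae (Eventually.of_forall fun x ↦ ?_)
  simp only [character, smul_eq_mul, inner_neg_left, real_inner_comm]
  congr 3
  push_cast; ring

theorem fourierInv_eq_integral_character (G : EuclideanSpace ℝ (Fin d) → ℂ)
    (y : EuclideanSpace ℝ (Fin d)) : 𝓕⁻ G y = ∫ x, character y x * G x := by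
  rw [Real.fourierInv_eq']
  refine integral_congr_ae (Eventually.of_forall fun x ↦ ?_)
  simp only [character, smul_eq_mul, real_inner_comm]

/-! ### Fourier series of functions supported in the unit cube. -/

theorem mFourier_coe_eq_character (n : Fin d → ℤ) (x : EuclideanSpace ℝ (Fin d)) :
    UnitAddTorus.mFourier n (fun i ↦ ((x i : ℝ) : UnitAddCircle)) =
      character (latticePoint n) x := by
  simp only [UnitAddTorus.mFourier, ContinuousMap.coe_mk, fourier_coe_apply, character]
  rw [← Complex.exp_sum]
  congr 1
  rw [PiLp.inner_apply]
  simp only [latticePoint]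
  push_cast
  rw [Finset.mul_sum, Finset.sum_mul]
  refine Finset.sum_congr rfl fun i _ ↦ ?_
  simp
  ring

/-- The function on the torus whose lift to the cube `(-1/2, 1/2]^d` is `G`. -/
def torusLift (G : EuclideanSpace ℝ (Fin d) → ℂ) (t : UnitAddTorus (Fin d)) : ℂ :=
  G (WithLp.toLp 2 fun i ↦ (AddCircle.equivIoc 1 (-1 / 2 : ℝ) (t i) : ℝ))

theorem abs_apply_le_norm (x : EuclideanSpace ℝ (Fin d)) (i : Fin d) : |x i| ≤ ‖x‖ := by
  simpa using PiLp.norm_apply_le x i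

theorem torusLift_coe (G : EuclideanSpace ℝ (Fin d) → ℂ) {x : EuclideanSpace ℝ (Fin d)}
    (hx : ∀ i, x i ∈ Set.Ioc (-1 / 2 : ℝ) (-1 / 2 + 1)) :
    torusLift G (fun i ↦ ((x i : ℝ) : UnitAddCircle)) = G x := by
  unfold torusLift
  congr 1
  ext i
  simp only
  exact AddCircle.equivIoc_coe_of_mem (hx i)

theorem continuous_torusLift {G : EuclideanSpace ℝ (Fin d) → ℂ} (hG : Continuous G)
    (hsupp : ∀ η, 7 / 16 < ‖η‖ → G η = 0) : Continuous (torusLift G) := by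
  rw [continuous_iff_continuousAt]
  intro t
  by_cases ht : ∀ i, t i ≠ ((-1 / 2 : ℝ) : UnitAddCircle)
  · refine hG.continuousAt.comp ?_
    refine (PiLp.continuous_toLp 2 _).continuousAt.comp ?_
    refine continuousAt_pi.2 fun i ↦ ?_
    exact continuous_subtype_val.continuousAt.comp
      (ContinuousAt.comp (f := fun s : UnitAddTorus (Fin d) ↦ s i) (x := t)
        (AddCircle.continuousAt_equivIoc 1 (-1 / 2 : ℝ) (ht i)) (continuous_apply i).continuousAt)
  · push Not at ht
    obtain ⟨i, hi⟩ := ht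
    have hev : ∀ᶠ s in 𝓝 t, torusLift G s = 0 := by
      have hc : Continuous fun s : UnitAddTorus (Fin d) ↦ ‖s i‖ := (continuous_apply i).norm
      -- On the seam of the fundamental cube a coordinate has distance `1/2` from the integers. As
      -- `1/2 > 7/16`, the lift vanishes near the seam and the jump of `equivIoc` there is harmless.
      have h0 : 7 / 16 < ‖t i‖ := by
        rw [hi, UnitAddCircle.norm_eq]
        norm_num [round_eq]
      filter_upwards [hc.continuousAt.eventually (lt_mem_nhds h0)] with s hs
      refine hsupp _ (hs.trans_le ?_)
      refine le_trans ?_ (abs_apply_le_norm _ i)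
      have h1 : ((AddCircle.equivIoc 1 (-1 / 2 : ℝ) (s i) : ℝ) : UnitAddCircle) = s i :=
        (AddCircle.equivIoc 1 (-1 / 2 : ℝ)).symm_apply_apply (s i)
      conv_lhs => rw [← h1]
      rw [← Real.norm_eq_abs]
      exact QuotientAddGroup.norm_mk_le_norm
    have : ContinuousAt (fun _ : UnitAddTorus (Fin d) ↦ (0 : ℂ)) t := continuousAt_const
    exact this.congr (hev.mono fun s hs ↦ hs.symm)

theorem mFourierCoeff_torusLift {G : EuclideanSpace ℝ (Fin d) → ℂ}
    (hsupp : ∀ η, 7 / 16 < ‖η‖ → G η = 0) (n : Fin d → ℤ) :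
    UnitAddTorus.mFourierCoeff (torusLift G) n = 𝓕 G (latticePoint n) := by
  rw [UnitAddTorus.mFourierCoeff_eq_integral _ _ fun _ ↦ (-1 / 2 : ℝ)]
  have hmeas : MeasurableSet {x : Fin d → ℝ | ∀ i, x i ∈ Set.Ioc (-1 / 2 : ℝ) (-1 / 2 + 1)} :=
    MeasurableSet.univ_pi' fun i ↦ measurableSet_Ioc
  have h1 : ∀ x ∈ {x : Fin d → ℝ | ∀ i, x i ∈ Set.Ioc (-1 / 2 : ℝ) (-1 / 2 + 1)},
      UnitAddTorus.mFourier (-n) (fun i ↦ (x i : UnitAddCircle)) •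
        torusLift G (fun i ↦ (x i : UnitAddCircle)) =
      character (-latticePoint n) (WithLp.toLp 2 x) * G (WithLp.toLp 2 x) := by
    intro x hx
    have e1 := mFourier_coe_eq_character (-n) (WithLp.toLp 2 x)
    have e2 := torusLift_coe G (x := WithLp.toLp 2 x) hx
    simp only at e1 e2
    rw [e1, e2, smul_eq_mul]
    congr 2
    ext i; simp [latticePoint]
  rw [setIntegral_congr_fun hmeas h1, setIntegral_eq_integral_of_forall_compl_eq_zero,
    fourier_eq_integral_character]
  · exact (EuclideanSpace.volume_preserving_symm_measurableEquiv_toLp (Fin d)).symm.integral_comp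
      (MeasurableEquiv.toLp 2 (Fin d → ℝ)).measurableEmbedding
      (fun x ↦ character (-latticePoint n) x * G x)
  · intro x hx
    rw [hsupp, mul_zero]
    by_contra hle
    push Not at hle
    refine hx fun i ↦ ?_
    have := (abs_le.1 ((abs_apply_le_norm (WithLp.toLp 2 x) i).trans hle))
    simp only at this
    constructor <;> linarith [this.1, this.2]

/-- A continuous function supported well inside the unit cube is the sum of its Fourier series on
the ball of radius `1/2`. -/
theorem hasSum_fourier_latticePoint {G : EuclideanSpace ℝ (Fin d) → ℂ} (hG : Continuous G)
    (hsupp : ∀ η, 7 / 16 < ‖η‖ → G η = 0) (hs : Summable fun n ↦ 𝓕 G (latticePoint n))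
    {η : EuclideanSpace ℝ (Fin d)} (hη : ‖η‖ < 1 / 2) :
    HasSum (fun n ↦ 𝓕 G (latticePoint n) * character (latticePoint n) η) (G η) := by
  have h := UnitAddTorus.hasSum_mFourier_series_apply_of_summable
    (f := ⟨torusLift G, continuous_torusLift hG hsupp⟩) (by
      refine hs.congr fun n ↦ ?_
      exact (mFourierCoeff_torusLift hsupp n).symm) (fun i ↦ ((η i : ℝ) : UnitAddCircle))
  simp only [ContinuousMap.coe_mk, mFourier_coe_eq_character, mFourierCoeff_torusLift hsupp,
    smul_eq_mul] at h
  rwa [torusLift_coe] at h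
  intro i
  have := abs_le.1 ((abs_apply_le_norm η i).trans hη.le)
  have h2 := abs_lt.1 ((abs_apply_le_norm η i).trans_lt hη)
  constructor <;> linarith [this.1, this.2, h2.1]

/-! ### Superpositions of translates in `L^p`, including `p < 1`. -/

section Lp

theorem _root_.ENNReal.tsum_rpow_le_tsum_rpow {ι : Type*} (a : ι → ℝ≥0∞) {r : ℝ} (hr : 0 < r)
    (hr1 : r ≤ 1) : (∑' i, a i) ^ r ≤ ∑' i, a i ^ r := by
  have hfin : ∀ s : Finset ι, (∑ i ∈ s, a i) ^ r ≤ ∑ i ∈ s, a i ^ r := by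
    classical
    intro s
    induction s using Finset.induction_on with
    | empty => simp [hr]
    | insert i s hi ih =>
      rw [Finset.sum_insert hi, Finset.sum_insert hi]
      exact (ENNReal.rpow_add_le_add_rpow _ _ hr.le hr1).trans (by gcongr)
  have h : Tendsto (fun s : Finset ι ↦ (∑ i ∈ s, a i) ^ r) atTop (𝓝 ((∑' i, a i) ^ r)) :=
    (ENNReal.continuous_rpow_const.tendsto _).comp ENNReal.summable.hasSum
  exact le_of_tendsto' h fun s ↦ (hfin s).trans (ENNReal.sum_le_tsum s)

/-- The exponent `min 1 p` for which the `p`-th power of the `L^p` quasi-norm is subadditive. -/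
def subadditiveExponent (p : ℝ≥0∞) : ℝ := (min 1 p).toReal

theorem subadditiveExponent_pos {p : ℝ≥0∞} (hp : 0 < p) : 0 < subadditiveExponent p :=
  ENNReal.toReal_pos (lt_min one_pos hp).ne' (ne_top_of_le_ne_top ENNReal.one_ne_top (min_le_left _ _))

theorem subadditiveExponent_le_one (p : ℝ≥0∞) : subadditiveExponent p ≤ 1 := by
  have := ENNReal.toReal_mono ENNReal.one_ne_top (min_le_left 1 p)
  simpa [subadditiveExponent] using this

/-- Translations preserve the `L^p` norm. For `p ≥ 1` the triangle inequality gives an `ℓ^1`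
condition on `c`; for `p < 1` the pointwise inequality `|∑ a|^p ≤ ∑ |a|^p`, integrated, gives an
`ℓ^p` condition. This is the source of every restriction on `p`. -/
theorem eLpNorm_le_of_hasSum_translates {ι : Type*} [Countable ι] {p : ℝ≥0∞} (hp : 0 < p)
    {u v : EuclideanSpace ℝ (Fin d) → ℂ} (hu : Continuous u) {c : ι → ℂ}
    {a : ι → EuclideanSpace ℝ (Fin d)} (h : ∀ x, HasSum (fun n ↦ c n * u (x + a n)) (v x)) :
    eLpNorm v p volume ≤ (∑' n, ‖c n‖ₑ ^ subadditiveExponent p) ^ (1 / subadditiveExponent p) *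
      eLpNorm u p volume := by
  have htrans : ∀ n, eLpNorm (fun x ↦ u (x + a n)) p volume = eLpNorm u p volume := fun n ↦
    eLpNorm_comp_measurePreserving hu.aestronglyMeasurable (measurePreserving_add_right volume (a n))
  have hcont : ∀ n, Continuous fun x ↦ u (x + a n) := fun n ↦ by fun_prop
  rcases le_total 1 p with h1 | h1
  · have hr : subadditiveExponent p = 1 := by simp [subadditiveExponent, h1]
    rw [hr]
    simp only [ENNReal.rpow_one, div_one]
    refine Lp.eLpNorm_le_of_ae_tendsto (u := (atTop : Filter (Finset ι)))
      (f := fun s x ↦ ∑ n ∈ s, c n * u (x + a n)) (Eventually.of_forall fun s ↦ ?_) (fun s ↦ ?_)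
      (Eventually.of_forall fun x ↦ h x)
    · have e : (fun x ↦ ∑ n ∈ s, c n * u (x + a n)) =
          ∑ n ∈ s, (fun x ↦ c n * u (x + a n)) := by ext x; simp
      rw [e]
      refine (eLpNorm_sum_le (fun n _ ↦ ((hcont n).const_mul _).aestronglyMeasurable) h1).trans ?_
      rw [← ENNReal.tsum_mul_right]
      refine le_trans (le_of_eq ?_) (ENNReal.sum_le_tsum s)
      refine Finset.sum_congr rfl fun n _ ↦ ?_
      rw [← htrans n]
      exact eLpNorm_const_smul (c n) _ p volume
    · exact (continuous_finsetSum s fun n _ ↦ (hcont n).const_mul _).aestronglyMeasurable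
  · have hptop : p ≠ ∞ := ne_top_of_le_ne_top ENNReal.one_ne_top h1
    have hr : subadditiveExponent p = p.toReal := by simp [subadditiveExponent, h1]
    have hr0 := subadditiveExponent_pos hp
    have hr1 := subadditiveExponent_le_one p
    rw [hr] at hr0 hr1 ⊢
    rw [eLpNorm_eq_lintegral_rpow_enorm_toReal hp.ne' hptop,
      eLpNorm_eq_lintegral_rpow_enorm_toReal hp.ne' hptop, ← ENNReal.mul_rpow_of_nonneg _ _ (by positivity)]
    refine ENNReal.rpow_le_rpow ?_ (by positivity)
    calc ∫⁻ x, ‖v x‖ₑ ^ p.toReal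
        ≤ ∫⁻ x, ∑' n, ‖c n‖ₑ ^ p.toReal * ‖u (x + a n)‖ₑ ^ p.toReal := by
          refine lintegral_mono fun x ↦ ?_
          simp only
          rw [← (h x).tsum_eq]
          refine (ENNReal.rpow_le_rpow enorm_tsum_le_tsum_enorm hr0.le).trans ?_
          refine (ENNReal.tsum_rpow_le_tsum_rpow _ hr0 hr1).trans (le_of_eq ?_)
          refine tsum_congr fun n ↦ ?_
          rw [enorm_mul, ENNReal.mul_rpow_of_nonneg _ _ hr0.le]
      _ = ∑' n, ‖c n‖ₑ ^ p.toReal * ∫⁻ x, ‖u x‖ₑ ^ p.toReal := by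
          rw [lintegral_tsum]
          · refine tsum_congr fun n ↦ ?_
            rw [lintegral_const_mul _ (((hcont n).measurable.enorm).pow_const _)]
            congr 1
            exact lintegral_add_right_eq_self (fun x ↦ ‖u x‖ₑ ^ p.toReal) (a n)
          · intro n
            exact ((((hcont n).measurable.enorm).pow_const _).const_mul _).aemeasurable
      _ = _ := ENNReal.tsum_mul_right

end Lp

/-! ### Lattice sums. -/

section Lattice

theorem summable_one_add_norm_latticePoint {t : ℝ} (ht : (d : ℝ) < t) :
    Summable fun n : Fin d → ℤ ↦ (1 + ‖latticePoint n‖) ^ (-t) := by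
  let b := (EuclideanSpace.basisFun (Fin d) ℝ).toBasis
  let L := Submodule.span ℤ (Set.range b)
  let e : (Fin d → ℤ) ≃ L := (b.restrictScalars ℤ).equivFun.symm.toEquiv
  have he : ∀ n, ((e n : L) : EuclideanSpace ℝ (Fin d)) = latticePoint n := by
    intro n
    simp only [e, LinearEquiv.coe_toEquiv, Module.Basis.equivFun_symm_apply]
    rw [Submodule.coe_sum]
    ext i
    have hc : ∀ c, (((n c • b.restrictScalars ℤ c : L) : EuclideanSpace ℝ (Fin d))) i =
        if i = c then (n c : ℝ) else 0 := by
      intro c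
      rw [Submodule.coe_smul, Module.Basis.restrictScalars_apply]
      simp [b, PiLp.single_apply]
    simp only [WithLp.ofLp_sum, Finset.sum_apply, hc]
    simp [latticePoint]
  have hrank : Module.finrank ℤ L = d := by
    rw [Module.finrank_eq_card_basis (b.restrictScalars ℤ)]; simp
  have h1 : Summable fun n : Fin d → ℤ ↦ ‖latticePoint n‖ ^ (-t) := by
    have := (e.summable_iff).2 (ZLattice.summable_norm_rpow L (-t) (by rw [hrank]; linarith))
    refine this.congr fun n ↦ ?_
    simp only [Function.comp]
    rw [← he]; rfl
  -- The comparison fails only at `n = 0`, where `‖latticePoint n‖ ^ (-t)` has the default value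
  -- `0`.
  refine Summable.of_norm_bounded_eventually h1 ?_
  refine (Set.finite_singleton (0 : Fin d → ℤ)).subset fun n hn ↦ ?_
  by_contra hne
  refine hn ?_
  have hpos : 0 < ‖latticePoint n‖ := by
    rw [norm_pos_iff]
    intro h0
    refine hne (funext fun i ↦ ?_)
    have := congrArg (fun z : EuclideanSpace ℝ (Fin d) ↦ z i) h0
    simpa [latticePoint] using this
  change ‖(1 + ‖latticePoint n‖) ^ (-t)‖ ≤ _
  rw [Real.norm_of_nonneg (by positivity)]
  exact Real.rpow_le_rpow_of_nonpos hpos (by linarith) (by have := (Nat.cast_nonneg d : (0:ℝ) ≤ d); linarith)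

end Lattice

/-! ### Series and bounded families in the Schwartz space. -/

section Schwartz

variable {E F : Type*} [NormedAddCommGroup E] [NormedSpace ℝ E]
  [NormedAddCommGroup F] [NormedSpace ℂ F]

/-- A series of Schwartz functions that converges pointwise and absolutely in every seminorm
converges in the Schwartz space. -/
theorem _root_.SchwartzMap.hasSum_of_summable_seminorm [CompleteSpace F] {ι : Type*}
    {v : ι → 𝓢(E, F)} {w : 𝓢(E, F)} (hs : ∀ k l, Summable fun i ↦ SchwartzMap.seminorm ℂ k l (v i))
    (hw : ∀ x, HasSum (fun i ↦ v i x) (w x)) : HasSum v w := by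
  rw [HasSum, (schwartz_withSeminorms ℂ E F).tendsto_nhds]
  rintro ⟨k, l⟩ ε hε
  have h0 := tendsto_tsum_compl_atTop_zero fun i ↦ SchwartzMap.seminorm ℂ k l (v i)
  filter_upwards [h0.eventually (gt_mem_nhds hε)] with s hs'
  rw [SchwartzMap.schwartzSeminormFamily_apply, ← map_neg_eq_map, neg_sub]
  refine lt_of_le_of_lt ?_ hs'
  refine SchwartzMap.seminorm_le_bound ℂ k l _ (tsum_nonneg fun i ↦ apply_nonneg _ _) fun x ↦ ?_
  have e : ⇑(w - ∑ i ∈ s, v i) = fun x ↦ ∑' i : {i // i ∉ s}, v i x := by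
    ext y
    have h1 := (hw y).summable.sum_add_tsum_subtype_compl s
    rw [(hw y).tsum_eq] at h1
    rw [sub_apply, ← h1]
    simp
  have hsub : ∀ k l, Summable fun i : {i // i ∉ s} ↦ SchwartzMap.seminorm ℂ k l (v i) :=
    fun k l ↦ (hs k l).subtype _
  rw [e, iteratedFDeriv_tsum_apply (N := ⊤) (v := fun l (i : {i // i ∉ s}) ↦
      SchwartzMap.seminorm ℂ 0 l (v i)) (fun i ↦ (v i).smooth ⊤) (fun l _ ↦ hsub 0 l)
      (fun l i x _ ↦ SchwartzMap.norm_iteratedFDeriv_le_seminorm ℂ (v i) l x) le_top]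
  have hb : ∀ i : {i // i ∉ s}, ‖x‖ ^ k * ‖iteratedFDeriv ℝ l (v i) x‖ ≤
      SchwartzMap.seminorm ℂ k l (v i) := fun i ↦ SchwartzMap.le_seminorm ℂ k l _ x
  have hsum : Summable fun i : {i // i ∉ s} ↦ ‖iteratedFDeriv ℝ l (v i) x‖ :=
    Summable.of_nonneg_of_le (fun _ ↦ norm_nonneg _)
      (fun i ↦ SchwartzMap.norm_iteratedFDeriv_le_seminorm ℂ (v i) l x) (hsub 0 l)
  calc ‖x‖ ^ k * ‖∑' i : {i // i ∉ s}, iteratedFDeriv ℝ l (v i) x‖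
      ≤ ‖x‖ ^ k * ∑' i : {i // i ∉ s}, ‖iteratedFDeriv ℝ l (v i) x‖ := by
        gcongr; exact norm_tsum_le_tsum_norm hsum
    _ = ∑' i : {i // i ∉ s}, ‖x‖ ^ k * ‖iteratedFDeriv ℝ l (v i) x‖ := tsum_mul_left.symm
    _ ≤ _ := (hsum.mul_left _).tsum_le_tsum hb (hsub k l)

/-- A family of Schwartz functions that is bounded in every Schwartz seminorm. -/
def IsBoundedFamily {ι : Type*} (G : ι → 𝓢(E, F)) : Prop :=
  ∀ k l, ∃ C : ℝ, ∀ i, SchwartzMap.seminorm ℂ k l (G i) ≤ C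

theorem IsBoundedFamily.sup_le {ι : Type*} {G : ι → 𝓢(E, F)} (hG : IsBoundedFamily G)
    (s : Finset (ℕ × ℕ)) :
    ∃ C : ℝ, 0 ≤ C ∧ ∀ i, s.sup (schwartzSeminormFamily ℂ E F) (G i) ≤ C := by
  choose C hC using hG
  refine ⟨∑ m ∈ s, |C m.1 m.2|, by positivity, fun i ↦ ?_⟩
  refine Seminorm.finset_sup_apply_le (by positivity) fun m hm ↦ ?_
  refine ((hC m.1 m.2 i).trans (le_abs_self _)).trans ?_
  exact Finset.single_le_sum (f := fun m : ℕ × ℕ ↦ |C m.1 m.2|) (fun _ _ ↦ abs_nonneg _) hm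

/-- Continuity of `A` bounds each seminorm of `A (G i)` by finitely many seminorms of `G i`. Applied
to the Fourier transform, it turns bounded families into uniformly decaying Fourier coefficients. -/
theorem IsBoundedFamily.map {ι : Type*} {G : ι → 𝓢(E, F)} (hG : IsBoundedFamily G)
    (A : 𝓢(E, F) →L[ℂ] 𝓢(E, F)) : IsBoundedFamily fun i ↦ A (G i) := by
  intro k l
  let q : Seminorm ℂ 𝓢(E, F) := (SchwartzMap.seminorm ℂ k l).comp A.toLinearMap
  have hq : Continuous q :=
    ((schwartz_withSeminorms ℂ E F).continuous_seminorm (k, l)).comp A.continuous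
  obtain ⟨s, C, -, hC⟩ := Seminorm.bound_of_continuous (schwartz_withSeminorms ℂ E F) q hq
  obtain ⟨B, hB0, hB⟩ := hG.sup_le s
  refine ⟨C * B, fun i ↦ ?_⟩
  refine (hC (G i)).trans ?_
  rw [smul_apply, NNReal.smul_def, smul_eq_mul]
  exact mul_le_mul_of_nonneg_left (hB i) C.coe_nonneg

theorem IsBoundedFamily.exists_decay {ι : Type*} {G : ι → 𝓢(E, F)} (hG : IsBoundedFamily G)
    (N : ℕ) : ∃ C : ℝ, 0 ≤ C ∧ ∀ i x, ‖G i x‖ ≤ C * (1 + ‖x‖) ^ (-(N : ℝ)) := by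
  obtain ⟨C, hC0, hC⟩ := hG.sup_le (Finset.Iic (N, 0))
  refine ⟨2 ^ N * C, by positivity, fun i x ↦ ?_⟩
  have h := SchwartzMap.one_add_le_sup_seminorm_apply (𝕜 := ℂ) (m := (N, 0)) le_rfl le_rfl (G i) x
  rw [norm_iteratedFDeriv_zero] at h
  have hx : 0 < 1 + ‖x‖ := by positivity
  rw [Real.rpow_neg hx.le, Real.rpow_natCast, ← div_eq_mul_inv, le_div_iff₀ (by positivity), mul_comm]
  exact h.trans (by gcongr; exact hC i)

/-- A family of products of a fixed Schwartz function supported in the unit ball with smooth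
functions that are uniformly bounded there, with all derivatives, is a bounded family. -/
theorem isBoundedFamily_of_eq_mul {ι : Type*} {Y : 𝓢(E, ℂ)} (hY : tsupport Y ⊆ Metric.closedBall 0 1)
    {a : ι → E → ℂ} (ha : ∀ i, ContDiff ℝ (⊤ : ℕ∞) (a i))
    (hb : ∀ l : ℕ, ∃ C : ℝ, ∀ i x, ‖x‖ ≤ 1 → ‖iteratedFDeriv ℝ l (a i) x‖ ≤ C)
    {G : ι → 𝓢(E, ℂ)} (hG : ∀ i x, G i x = a i x * Y x) : IsBoundedFamily G := by
  choose C hC using hb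
  intro k l
  refine ⟨∑ j ∈ Finset.range (l + 1), (l.choose j : ℝ) * |C j| * SchwartzMap.seminorm ℂ 0 (l - j) Y,
    fun i ↦ ?_⟩
  refine SchwartzMap.seminorm_le_bound ℂ k l _ (by positivity) fun x ↦ ?_
  have e : ⇑(G i) = fun x ↦ a i x * Y x := funext (hG i)
  by_cases hx : ‖x‖ ≤ 1
  · have h1 : ‖x‖ ^ k ≤ 1 := pow_le_one₀ (norm_nonneg x) hx
    have h2 := norm_iteratedFDeriv_mul_le (𝕜 := ℝ) (N := (⊤ : ℕ∞)) (ha i) (Y.smooth ⊤) x (n := l) (by exact_mod_cast le_top)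
    rw [e]
    refine (mul_le_of_le_one_left (norm_nonneg _) h1).trans (h2.trans ?_)
    gcongr with j hj
    · exact (hC j i x hx).trans (le_abs_self _)
    · exact SchwartzMap.norm_iteratedFDeriv_le_seminorm ℂ Y _ x
  · have h0 : iteratedFDeriv ℝ l (G i) x = 0 := by
      have hsub : tsupport (G i) ⊆ tsupport Y := by
        rw [e]; exact tsupport_mul_subset_right
      by_contra hne
      have := support_iteratedFDeriv_subset l (f := ⇑(G i)) (𝕜 := ℝ) (Function.mem_support.2 hne)
      exact hx (by simpa using hY (hsub this))
    rw [h0, norm_zero, mul_zero]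
    positivity

end Schwartz

/-! ### Derivatives of unimodular exponentials. -/

section Exponential

variable {E : Type*} [NormedAddCommGroup E] [NormedSpace ℝ E]

theorem iteratedDeriv_cexp_mul_I (ε : ℝ) (n : ℕ) :
    iteratedDeriv n (fun t : ℝ ↦ Complex.exp ((ε * t : ℝ) * Complex.I)) =
      fun t : ℝ ↦ Complex.exp ((ε * t : ℝ) * Complex.I) * (ε * Complex.I) ^ n := by
  have hder : ∀ t : ℝ, HasDerivAt (fun t : ℝ ↦ Complex.exp ((ε * t : ℝ) * Complex.I))
      (Complex.exp ((ε * t : ℝ) * Complex.I) * (ε * Complex.I)) t := by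
    intro t
    have h := (((Complex.ofRealCLM.hasDerivAt (x := t)).const_mul (ε : ℂ)).mul_const Complex.I).cexp
    simpa using h
  induction n with
  | zero => simp
  | succ n ih =>
    rw [iteratedDeriv_succ, ih]
    ext t
    rw [((hder t).mul_const ((ε * Complex.I) ^ n)).deriv, pow_succ]
    ring

theorem contDiff_cexp_mul_I (ε : ℝ) :
    ContDiff ℝ (⊤ : ℕ∞) fun t : ℝ ↦ Complex.exp ((ε * t : ℝ) * Complex.I) := by
  have h := (((Complex.ofRealCLM.contDiff (n := (⊤ : ℕ∞))).comp
    (contDiff_const.mul contDiff_id : ContDiff ℝ (⊤ : ℕ∞) fun t : ℝ ↦ ε * t)).mul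
      (contDiff_const (c := Complex.I))).cexp
  exact h

theorem norm_iteratedFDeriv_cexp_mul_I_le (ε : ℝ) (n : ℕ) (t : ℝ) :
    ‖iteratedFDeriv ℝ n (fun t : ℝ ↦ Complex.exp ((ε * t : ℝ) * Complex.I)) t‖ = |ε| ^ n := by
  rw [norm_iteratedFDeriv_eq_norm_iteratedDeriv, iteratedDeriv_cexp_mul_I, norm_mul,
    Complex.norm_exp_ofReal_mul_I]
  simp

/-- Faà di Bruno's formula, with all derivatives of `t ↦ exp(it)` of modulus one. Only orders `≥ 1`
of `Q` enter, so the size of `Q` itself is irrelevant. -/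
theorem norm_iteratedFDeriv_cexp_comp_le {Q : E → ℝ} (hQ : ContDiff ℝ (⊤ : ℕ∞) Q) {n : ℕ} {x : E}
    {D : ℝ} (hD : ∀ i, 1 ≤ i → i ≤ n → ‖iteratedFDeriv ℝ i Q x‖ ≤ D ^ i) :
    ‖iteratedFDeriv ℝ n (fun y ↦ Complex.exp ((Q y : ℂ) * Complex.I)) x‖ ≤ n.factorial * D ^ n := by
  have h := norm_iteratedFDeriv_comp_le (contDiff_cexp_mul_I 1) hQ (n := n)
    (by exact_mod_cast le_top) x (C := 1) (D := D)
    (fun i _ ↦ by rw [norm_iteratedFDeriv_cexp_mul_I_le]; simp) hD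
  simpa [Function.comp_def] using h

theorem norm_iteratedFDeriv_clm_le (T : E →L[ℝ] ℝ) (x : E) {i : ℕ} (hi : 1 ≤ i) :
    ‖iteratedFDeriv ℝ i T x‖ ≤ ‖T‖ ^ i := by
  obtain ⟨i, rfl⟩ := Nat.exists_eq_succ_of_ne_zero (by omega : i ≠ 0)
  have hf : fderiv ℝ T = fun _ ↦ T := funext fun y ↦ T.fderiv
  rw [Nat.succ_eq_add_one, ← norm_iteratedFDeriv_fderiv, hf]
  rcases i with _ | i
  · simp
  · rw [iteratedFDeriv_const_of_ne (by omega)]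
    simp

end Exponential

theorem norm_iteratedFDeriv_character_le (a x : EuclideanSpace ℝ (Fin d)) (n : ℕ) :
    ‖iteratedFDeriv ℝ n (character a) x‖ ≤ n.factorial * (2 * Real.pi * ‖a‖) ^ n := by
  let T : EuclideanSpace ℝ (Fin d) →L[ℝ] ℝ := (2 * Real.pi) • innerSL ℝ a
  have hT : ‖T‖ = 2 * Real.pi * ‖a‖ := by
    rw [norm_smul, innerSL_apply_norm, Real.norm_of_nonneg (by positivity)]
  have e : character a = fun y ↦ Complex.exp ((T y : ℂ) * Complex.I) := by
    ext y; simp [character, T]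
  rw [e, ← hT]
  exact norm_iteratedFDeriv_cexp_comp_le T.contDiff fun i hi _ ↦ norm_iteratedFDeriv_clm_le T x hi

theorem contDiff_character (a : EuclideanSpace ℝ (Fin d)) :
    ContDiff ℝ (⊤ : ℕ∞) (character a) := (hasTemperateGrowth_character a).1

/-- Multiplication of a Schwartz function by the character `e_a`. -/
def charMul (a : EuclideanSpace ℝ (Fin d)) (Θ : 𝓢(EuclideanSpace ℝ (Fin d), ℂ)) :
    𝓢(EuclideanSpace ℝ (Fin d), ℂ) :=
  SchwartzMap.smulLeftCLM ℂ (character a) Θ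

theorem charMul_apply (a : EuclideanSpace ℝ (Fin d)) (Θ : 𝓢(EuclideanSpace ℝ (Fin d), ℂ))
    (ξ : EuclideanSpace ℝ (Fin d)) : charMul a Θ ξ = character a ξ * Θ ξ := by
  simp [charMul, SchwartzMap.smulLeftCLM_apply_apply (hasTemperateGrowth_character a)]

/-- Each derivative falling on the character costs a factor `‖a‖`. This polynomial growth is beaten
by the rapidly decaying coefficients in `hasSum_samp`. -/
theorem exists_seminorm_charMul_le (Θ : 𝓢(EuclideanSpace ℝ (Fin d), ℂ)) (k l : ℕ) :
    ∃ C : ℝ, 0 ≤ C ∧ ∀ a, SchwartzMap.seminorm ℂ k l (charMul a Θ) ≤ C * (1 + ‖a‖) ^ l := by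
  refine ⟨∑ j ∈ Finset.range (l + 1), (l.choose j : ℝ) * (j.factorial * (2 * Real.pi) ^ j) *
    SchwartzMap.seminorm ℂ k (l - j) Θ, by positivity, fun a ↦ ?_⟩
  refine SchwartzMap.seminorm_le_bound ℂ k l _ (by positivity) fun x ↦ ?_
  have e : ⇑(charMul a Θ) = fun x ↦ character a x * Θ x := funext (charMul_apply a Θ)
  rw [e]
  refine (mul_le_mul_of_nonneg_left (norm_iteratedFDeriv_mul_le (𝕜 := ℝ) (N := (⊤ : ℕ∞))
    (contDiff_character a) (Θ.smooth ⊤) x (n := l) (by exact_mod_cast le_top))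
    (by positivity)).trans ?_
  rw [Finset.mul_sum, Finset.sum_mul]
  refine Finset.sum_le_sum fun j hj ↦ ?_
  have hj' : j ≤ l := by simpa [Nat.lt_succ_iff] using hj
  have h1 := norm_iteratedFDeriv_character_le a x j
  have h2 := SchwartzMap.le_seminorm ℂ k (l - j) Θ x
  have h3 : (2 * Real.pi * ‖a‖) ^ j ≤ (2 * Real.pi) ^ j * (1 + ‖a‖) ^ l := by
    rw [mul_pow]
    gcongr
    calc ‖a‖ ^ j ≤ (1 + ‖a‖) ^ j := by gcongr; linarith
      _ ≤ (1 + ‖a‖) ^ l := pow_le_pow_right₀ (by linarith [norm_nonneg a]) hj'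
  calc ‖x‖ ^ k * ((l.choose j : ℝ) * ‖iteratedFDeriv ℝ j (character a) x‖ *
        ‖iteratedFDeriv ℝ (l - j) Θ x‖)
      = (l.choose j : ℝ) * ‖iteratedFDeriv ℝ j (character a) x‖ *
        (‖x‖ ^ k * ‖iteratedFDeriv ℝ (l - j) Θ x‖) := by ring
    _ ≤ (l.choose j : ℝ) * (j.factorial * ((2 * Real.pi) ^ j * (1 + ‖a‖) ^ l)) *
        SchwartzMap.seminorm ℂ k (l - j) Θ := by
          gcongr
          exact h1.trans (by gcongr)
    _ = _ := by ring

/-! ### Sampling formula on the frequency side. -/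

/-- The function `x ↦ F (e_x Θ)`, that is, the inverse Fourier transform of the compactly
supported distribution `Θ F` when `Θ` has compact support. -/
def samp (F : 𝓢'(EuclideanSpace ℝ (Fin d), ℂ)) (Θ : 𝓢(EuclideanSpace ℝ (Fin d), ℂ))
    (x : EuclideanSpace ℝ (Fin d)) : ℂ :=
  F (charMul x Θ)

theorem reflTranslate_eq_fourier (x : EuclideanSpace ℝ (Fin d))
    (ψ : 𝓢(EuclideanSpace ℝ (Fin d), ℂ)) : reflTranslate x ψ = 𝓕 (charMul x (𝓕 ψ)) := by
  ext y
  rw [reflTranslate_apply, SchwartzMap.fourier_coe, fourier_eq_integral_character]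
  conv_lhs => rw [show ψ = 𝓕⁻ (𝓕 ψ) from (FourierTransform.fourierInv_fourier_eq ψ).symm]
  rw [SchwartzMap.fourierInv_coe, fourierInv_eq_integral_character]
  refine integral_congr_ae (Eventually.of_forall fun ξ ↦ ?_)
  simp only
  rw [charMul_apply, ← mul_assoc, ← character_add_left, neg_add_eq_sub]

/-- Passage to the frequency side: from here on the pieces of `f` are handled as `samp (𝓕 f)` of a
compactly supported `Θ`. -/
theorem conv_eq_samp (f : 𝓢'(EuclideanSpace ℝ (Fin d), ℂ)) (ψ : 𝓢(EuclideanSpace ℝ (Fin d), ℂ)) :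
    conv f ψ = samp (𝓕 f) (𝓕 ψ) := by
  ext x
  rw [conv, samp, TemperedDistribution.fourier_apply, reflTranslate_eq_fourier]

theorem continuous_samp (F : 𝓢'(EuclideanSpace ℝ (Fin d), ℂ))
    (Θ : 𝓢(EuclideanSpace ℝ (Fin d), ℂ)) : Continuous (samp F Θ) := by
  have h := continuous_conv (𝓕⁻ F) (𝓕⁻ Θ)
  rwa [conv_eq_samp, FourierTransform.fourier_fourierInv_eq,
    FourierTransform.fourier_fourierInv_eq] at h

theorem fourier_modulation_apply (ω : EuclideanSpace ℝ (Fin d))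
    (χ : 𝓢(EuclideanSpace ℝ (Fin d), ℂ)) (ξ : EuclideanSpace ℝ (Fin d)) :
    (𝓕 (modulation ω χ) : 𝓢(EuclideanSpace ℝ (Fin d), ℂ)) ξ =
      (𝓕 χ : 𝓢(EuclideanSpace ℝ (Fin d), ℂ)) (ξ - ω) := by
  rw [SchwartzMap.fourier_coe, SchwartzMap.fourier_coe, fourier_eq_integral_character,
    fourier_eq_integral_character]
  refine integral_congr_ae (Eventually.of_forall fun x ↦ ?_)
  simp only
  rw [modulation_apply, ← mul_assoc, ← character_add_left, neg_sub, neg_add_eq_sub]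

theorem charMul_charMul (a b : EuclideanSpace ℝ (Fin d)) (Θ : 𝓢(EuclideanSpace ℝ (Fin d), ℂ)) :
    charMul a (charMul b Θ) = charMul (a + b) Θ := by
  ext ξ
  simp only [charMul_apply, character_add_left, mul_assoc]

/-- The sampling formula: multiplication on the Fourier side by a function that is the sum of its
Fourier series on the support of `Θ` is a superposition of translations. -/
theorem hasSum_samp (F : 𝓢'(EuclideanSpace ℝ (Fin d), ℂ)) {Θ Θ' : 𝓢(EuclideanSpace ℝ (Fin d), ℂ)}
    {G : EuclideanSpace ℝ (Fin d) → ℂ} {ω : EuclideanSpace ℝ (Fin d)} (hG : Continuous G)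
    (hsupp : ∀ η, 7 / 16 < ‖η‖ → G η = 0)
    (hdec : ∀ N : ℕ, Summable fun n ↦ ‖𝓕 G (latticePoint n)‖ * (1 + ‖latticePoint n‖) ^ N)
    (hΘ : ∀ ξ, Θ ξ ≠ 0 → ‖ξ - ω‖ ≤ 3) (hΘ' : ∀ ξ, Θ' ξ = G ((1 / 8 : ℝ) • (ξ - ω)) * Θ ξ)
    (x : EuclideanSpace ℝ (Fin d)) :
    HasSum (fun n ↦ 𝓕 G (latticePoint n) * character (latticePoint n) (-(1 / 8 : ℝ) • ω) *
      samp F Θ (x + (1 / 8 : ℝ) • latticePoint n)) (samp F Θ' x) := by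
  -- The Fourier series of `G` at `(ξ - ω)/8`, multiplied by `e_x Θ`: each character in `ξ/8` shifts
  -- `x` by `latticePoint n / 8`, and the part in `ω` is a unimodular constant. Convergence holds in
  -- the Schwartz space, so `F` may be applied termwise.
  have key : HasSum (fun n ↦ (𝓕 G (latticePoint n) *
      character (latticePoint n) (-(1 / 8 : ℝ) • ω)) •
        charMul (x + (1 / 8 : ℝ) • latticePoint n) Θ) (charMul x Θ') := by
    refine SchwartzMap.hasSum_of_summable_seminorm (fun k l ↦ ?_) fun ξ ↦ ?_
    · obtain ⟨C, hC0, hC⟩ := exists_seminorm_charMul_le Θ k l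
      refine Summable.of_nonneg_of_le (fun _ ↦ apply_nonneg _ _) (fun n ↦ ?_)
        ((hdec l).mul_left (C * (1 + ‖x‖) ^ l))
      rw [map_smul_eq_mul, norm_mul, norm_character, mul_one]
      have h1 : 1 + ‖x + (1 / 8 : ℝ) • latticePoint n‖ ≤ (1 + ‖x‖) * (1 + ‖latticePoint n‖) := by
        have := norm_add_le x ((1 / 8 : ℝ) • latticePoint n)
        rw [norm_smul, Real.norm_of_nonneg (by norm_num)] at this
        nlinarith [norm_nonneg x, norm_nonneg (latticePoint n)]
      calc ‖𝓕 G (latticePoint n)‖ * SchwartzMap.seminorm ℂ k l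
            (charMul (x + (1 / 8 : ℝ) • latticePoint n) Θ)
          ≤ ‖𝓕 G (latticePoint n)‖ * (C * ((1 + ‖x‖) * (1 + ‖latticePoint n‖)) ^ l) := by
            gcongr
            exact (hC _).trans (by gcongr)
        _ = _ := by rw [mul_pow]; ring
    · simp only [smul_apply, charMul_apply, smul_eq_mul, hΘ']
      by_cases h0 : Θ ξ = 0
      · simp [h0]
      -- The scale `1/8` sends the ball of radius `3` to radius `3/8`, inside the region where the
      -- Fourier series represents `G`.
      · have hη : ‖(1 / 8 : ℝ) • (ξ - ω)‖ < 1 / 2 := by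
          rw [norm_smul, Real.norm_of_nonneg (by norm_num)]
          linarith [hΘ ξ h0]
        have hs : Summable fun n ↦ 𝓕 G (latticePoint n) := by
          refine Summable.of_norm ?_
          simpa using hdec 0
        have h2 := (hasSum_fourier_latticePoint hG hsupp hs hη).mul_left (character x ξ * Θ ξ)
        have e1 : (fun n ↦ 𝓕 G (latticePoint n) * character (latticePoint n) (-(1 / 8 : ℝ) • ω) *
              (character (x + (1 / 8 : ℝ) • latticePoint n) ξ * Θ ξ)) =
            fun n ↦ character x ξ * Θ ξ * (𝓕 G (latticePoint n) *
              character (latticePoint n) ((1 / 8 : ℝ) • (ξ - ω))) := by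
          ext n
          rw [character_add_left, character_smul_left, smul_sub, sub_eq_add_neg, ← neg_smul,
            character_add_right]
          ring
        have e2 : character x ξ * (G ((1 / 8 : ℝ) • (ξ - ω)) * Θ ξ) =
            character x ξ * Θ ξ * G ((1 / 8 : ℝ) • (ξ - ω)) := by ring
        rw [e1, e2]
        exact h2
  refine (key.map F F.continuous).congr_fun fun n ↦ ?_
  exact (ContinuousLinearMap.map_smul (F : 𝓢(EuclideanSpace ℝ (Fin d), ℂ) →L[ℂ] ℂ) _ _).symm

theorem IsBoundedFamily.exists_fourier_le {ι : Type*} {G : ι → 𝓢(EuclideanSpace ℝ (Fin d), ℂ)}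
    (hG : IsBoundedFamily G) (N : ℕ) :
    ∃ C : ℝ, 0 ≤ C ∧ ∀ i x, ‖𝓕 (G i : EuclideanSpace ℝ (Fin d) → ℂ) x‖ ≤
      C * (1 + ‖x‖) ^ (-(N : ℝ)) :=
  (hG.map (fourierCLM ℂ 𝓢(EuclideanSpace ℝ (Fin d), ℂ))).exists_decay N

theorem summable_of_decay {c : (Fin d → ℤ) → ℂ}
    (hc : ∀ N : ℕ, ∃ C : ℝ, ∀ n, ‖c n‖ ≤ C * (1 + ‖latticePoint n‖) ^ (-(N : ℝ))) (N : ℕ) :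
    Summable fun n ↦ ‖c n‖ * (1 + ‖latticePoint n‖) ^ N := by
  obtain ⟨C, hC⟩ := hc (N + (d + 1))
  refine Summable.of_nonneg_of_le (fun _ ↦ by positivity) (fun n ↦ ?_)
    ((summable_one_add_norm_latticePoint (d := d) (t := (d + 1 : ℕ)) (by push_cast; linarith)).mul_left C)
  have hx : 0 < 1 + ‖latticePoint n‖ := by positivity
  calc ‖c n‖ * (1 + ‖latticePoint n‖) ^ N
      ≤ C * (1 + ‖latticePoint n‖) ^ (-((N + (d + 1) : ℕ) : ℝ)) * (1 + ‖latticePoint n‖) ^ N := by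
        gcongr; exact hC n
    _ = C * (1 + ‖latticePoint n‖) ^ (-((d + 1 : ℕ) : ℝ)) := by
        rw [← Real.rpow_natCast _ N, mul_assoc, ← Real.rpow_add hx]
        congr 2; push_cast; ring

theorem tsum_enorm_rpow_le {c : (Fin d → ℤ) → ℂ} {C t r : ℝ} (hC : 0 ≤ C) (hr : 0 < r)
    (hc : ∀ n, ‖c n‖ ≤ C * (1 + ‖latticePoint n‖) ^ (-t)) :
    ∑' n, ‖c n‖ₑ ^ r ≤ ∑' n : Fin d → ℤ,
      ENNReal.ofReal (C ^ r * (1 + ‖latticePoint n‖) ^ (-(t * r))) := by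
  refine ENNReal.tsum_le_tsum fun n ↦ ?_
  rw [← ofReal_norm, ENNReal.ofReal_rpow_of_nonneg (norm_nonneg _) hr.le]
  refine ENNReal.ofReal_le_ofReal ?_
  refine (Real.rpow_le_rpow (norm_nonneg _) (hc n) hr.le).trans (le_of_eq ?_)
  rw [Real.mul_rpow hC (by positivity), ← Real.rpow_mul (by positivity), neg_mul]

theorem tsum_ofReal_lt_top {C t : ℝ} (ht : (d : ℝ) < t) :
    ∑' n : Fin d → ℤ, ENNReal.ofReal (C * (1 + ‖latticePoint n‖) ^ (-t)) < ∞ := by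
  rw [lt_top_iff_ne_top]
  exact ((summable_one_add_norm_latticePoint ht).mul_left C).tsum_ofReal_ne_top

theorem exists_nat_mul_gt {r : ℝ} (hr : 0 < r) (b : ℝ) : ∃ N : ℕ, b < N * r := by
  obtain ⟨N, hN⟩ := exists_nat_gt (b / r)
  exact ⟨N, (div_lt_iff₀ hr).1 hN⟩

/-- Multiplication on the Fourier side by a bounded family of Schwartz functions is bounded in
`L^p`, uniformly in the family. -/
theorem IsBoundedFamily.exists_eLpNorm_samp_le {ι : Type*}
    {G : ι → 𝓢(EuclideanSpace ℝ (Fin d), ℂ)} (hG : IsBoundedFamily G)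
    (hsupp : ∀ i η, 7 / 16 < ‖η‖ → G i η = 0) {p : ℝ≥0∞} (hp : 0 < p) :
    ∃ C : ℝ≥0, ∀ i (F : 𝓢'(EuclideanSpace ℝ (Fin d), ℂ)) (Θ Θ' : 𝓢(EuclideanSpace ℝ (Fin d), ℂ))
      (ω : EuclideanSpace ℝ (Fin d)), (∀ ξ, Θ ξ ≠ 0 → ‖ξ - ω‖ ≤ 3) →
      (∀ ξ, Θ' ξ = G i ((1 / 8 : ℝ) • (ξ - ω)) * Θ ξ) →
      eLpNorm (samp F Θ') p volume ≤ C * eLpNorm (samp F Θ) p volume := by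
  have hr := subadditiveExponent_pos hp
  -- Decay of order `N` has an `ℓ^r` summable lattice restriction when `N r > d`.
  obtain ⟨N, hN⟩ := exists_nat_mul_gt hr d
  obtain ⟨C, hC0, hC⟩ := hG.exists_fourier_le N
  set S : ℝ≥0∞ := ∑' n : Fin d → ℤ, ENNReal.ofReal (C ^ subadditiveExponent p *
    (1 + ‖latticePoint n‖) ^ (-(N * subadditiveExponent p))) with hS
  have hS' : S ^ (1 / subadditiveExponent p) ≠ ∞ :=
    ENNReal.rpow_ne_top_of_nonneg (by positivity) (tsum_ofReal_lt_top hN).ne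
  refine ⟨(S ^ (1 / subadditiveExponent p)).toNNReal, fun i F Θ Θ' ω hΘ hΘ' ↦ ?_⟩
  rw [ENNReal.coe_toNNReal hS']
  have h := hasSum_samp F (G i).continuous (hsupp i) (summable_of_decay fun N ↦ by
    obtain ⟨C, -, hC⟩ := hG.exists_fourier_le N
    exact ⟨C, fun n ↦ hC i _⟩) hΘ hΘ'
  refine (eLpNorm_le_of_hasSum_translates hp (continuous_samp F Θ) h).trans ?_
  gcongr
  refine tsum_enorm_rpow_le hC0 hr fun n ↦ ?_
  rw [norm_mul, norm_character, mul_one]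
  exact hC i _

/-! ### Cutoff and uniform multiplier bounds in `L^p`. -/

/-- A smooth bump function, equal to `1` on the ball of radius `3/8` and supported in the ball of
radius `7/16`. -/
def bump (d : ℕ) : ContDiffBump (0 : EuclideanSpace ℝ (Fin d)) :=
  ⟨3 / 8, 7 / 16, by norm_num, by norm_num⟩

/-- The bump function `bump d` as a complex Schwartz function. -/
def cutoff (d : ℕ) : 𝓢(EuclideanSpace ℝ (Fin d), ℂ) :=
  HasCompactSupport.toSchwartzMap (f := fun x ↦ ((bump d x : ℝ) : ℂ))
    ((bump d).hasCompactSupport.comp_left Complex.ofReal_zero)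
    (Complex.ofRealCLM.contDiff.comp (bump d).contDiff)

theorem cutoff_apply (x : EuclideanSpace ℝ (Fin d)) : cutoff d x = ((bump d x : ℝ) : ℂ) := rfl

theorem cutoff_eq_one {x : EuclideanSpace ℝ (Fin d)} (hx : ‖x‖ ≤ 3 / 8) : cutoff d x = 1 := by
  rw [cutoff_apply, (bump d).one_of_mem_closedBall (by simpa [bump] using hx), Complex.ofReal_one]

theorem cutoff_eq_zero {x : EuclideanSpace ℝ (Fin d)} (hx : 7 / 16 < ‖x‖) : cutoff d x = 0 := by
  rw [cutoff_apply, (bump d).zero_of_le_dist (by simpa [bump] using hx.le), Complex.ofReal_zero]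

theorem tsupport_cutoff_subset : tsupport (cutoff d) ⊆ Metric.closedBall 0 1 := by
  refine closure_minimal (fun x hx ↦ ?_) Metric.isClosed_closedBall
  by_contra h
  refine hx (cutoff_eq_zero ?_)
  rw [mem_closedBall_zero_iff] at h
  linarith

/-- The factor `cutoff` cuts the symbol `a` down to a Schwartz function. -/
theorem exists_schwartz_cutoff_mul {a : EuclideanSpace ℝ (Fin d) → ℂ}
    (ha : ContDiff ℝ (⊤ : ℕ∞) a) :
    ∃ G : 𝓢(EuclideanSpace ℝ (Fin d), ℂ), ∀ x, G x = a x * cutoff d x :=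
  ⟨HasCompactSupport.toSchwartzMap (f := fun x ↦ a x * cutoff d x)
    (((bump d).hasCompactSupport.comp_left Complex.ofReal_zero).mul_left)
    (ha.mul ((cutoff d).smooth ⊤)), fun _ ↦ rfl⟩

/-- Multiplication on the Fourier side by a family of smooth functions that, recentred at the
support, have uniformly bounded derivatives is bounded in `L^p`, uniformly in the family. -/
theorem exists_eLpNorm_samp_mul_le {ι : Type*} {a : ι → EuclideanSpace ℝ (Fin d) → ℂ}
    (ha : ∀ i, ContDiff ℝ (⊤ : ℕ∞) (a i))
    (hb : ∀ l : ℕ, ∃ C : ℝ, ∀ i x, ‖x‖ ≤ 1 → ‖iteratedFDeriv ℝ l (a i) x‖ ≤ C)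
    {p : ℝ≥0∞} (hp : 0 < p) :
    ∃ C : ℝ≥0, ∀ i (F : 𝓢'(EuclideanSpace ℝ (Fin d), ℂ)) (Θ Θ' : 𝓢(EuclideanSpace ℝ (Fin d), ℂ))
      (ω : EuclideanSpace ℝ (Fin d)), (∀ ξ, Θ ξ ≠ 0 → ‖ξ - ω‖ ≤ 3) →
      (∀ ξ, Θ' ξ = a i ((1 / 8 : ℝ) • (ξ - ω)) * Θ ξ) →
      eLpNorm (samp F Θ') p volume ≤ C * eLpNorm (samp F Θ) p volume := by
  choose G hG using fun i ↦ exists_schwartz_cutoff_mul (ha i)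
  obtain ⟨C, hC⟩ := (isBoundedFamily_of_eq_mul tsupport_cutoff_subset ha hb hG).exists_eLpNorm_samp_le
    (fun i η hη ↦ by rw [hG, cutoff_eq_zero hη, mul_zero]) hp
  refine ⟨C, fun i F Θ Θ' ω hΘ hΘ' ↦ hC i F Θ Θ' ω hΘ fun ξ ↦ ?_⟩
  rw [hΘ', hG]
  by_cases h0 : Θ ξ = 0
  · simp [h0]
  · rw [cutoff_eq_one, mul_one]
    rw [norm_smul, Real.norm_of_nonneg (by norm_num)]
    linarith [hΘ ξ h0]

/-! ### A Bernstein–Nikol'skii inequality. -/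

/-- A band-limited function in `L^p` is bounded. -/
theorem exists_norm_samp_le (F : 𝓢'(EuclideanSpace ℝ (Fin d), ℂ))
    {Θ : 𝓢(EuclideanSpace ℝ (Fin d), ℂ)} {ω : EuclideanSpace ℝ (Fin d)}
    (hΘ : ∀ ξ, Θ ξ ≠ 0 → ‖ξ - ω‖ ≤ 3) {p : ℝ≥0∞} (hp : 0 < p)
    (hfin : eLpNorm (samp F Θ) p volume < ∞) : ∃ B : ℝ, ∀ x, ‖samp F Θ x‖ ≤ B := by
  set u := samp F Θ with hu
  have hucont : Continuous u := continuous_samp F Θ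
  let ι := {y : EuclideanSpace ℝ (Fin d) // ‖y‖ ≤ 1}
  -- At `(ξ - ω)/8` with `‖ξ - ω‖ ≤ 3` the cutoff is `1`, and `G y` takes the value `e_y(ξ - ω)`,
  -- the frequency-side form of translation by `y`.
  let G : ι → 𝓢(EuclideanSpace ℝ (Fin d), ℂ) := fun y ↦ charMul ((8 : ℝ) • y.1) (cutoff d)
  have hGb : IsBoundedFamily G := by
    refine isBoundedFamily_of_eq_mul tsupport_cutoff_subset
      (a := fun y : ι ↦ character ((8 : ℝ) • y.1)) (fun i ↦ contDiff_character _) (fun l ↦ ?_)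
      fun i x ↦ charMul_apply _ _ x
    refine ⟨l.factorial * (2 * Real.pi * 8) ^ l, fun y x _ ↦ ?_⟩
    refine (norm_iteratedFDeriv_character_le _ x l).trans ?_
    have : ‖(8 : ℝ) • y.1‖ ≤ 8 := by
      rw [norm_smul, Real.norm_of_nonneg (by norm_num)]; linarith [y.2]
    gcongr
  have hr := subadditiveExponent_pos hp
  have hr1 := subadditiveExponent_le_one p
  set r := subadditiveExponent p with hrdef
  obtain ⟨N, hN⟩ := exists_nat_mul_gt hr d
  obtain ⟨C, hC0, hC⟩ := hGb.exists_fourier_le N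
  let w : (Fin d → ℤ) → ℝ≥0∞ := fun n ↦
    ENNReal.ofReal (C ^ r * (1 + ‖latticePoint n‖) ^ (-(N * r)))
  have hw : ∑' n, w n < ∞ := tsum_ofReal_lt_top hN
  -- Going to `z - y` and translating back by `y` through the sampling formula writes `u z` in terms
  -- of the values `u (z - y + n/8)`. The weights `w n` do not depend on `y`, which allows averaging
  -- over the unit ball.
  have hpt : ∀ z y : EuclideanSpace ℝ (Fin d), ‖y‖ ≤ 1 →
      ‖u z‖ₑ ^ r ≤ ∑' n, w n * ‖u (z + (1 / 8 : ℝ) • latticePoint n - y)‖ₑ ^ r := by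
    intro z y hy
    have h := hasSum_samp F (Θ := Θ) (Θ' := character y (-ω) • charMul y Θ) (ω := ω)
      (G ⟨y, hy⟩).continuous
      (fun η hη ↦ by simp only [G]; rw [charMul_apply, cutoff_eq_zero hη, mul_zero])
      (summable_of_decay fun N ↦ by
        obtain ⟨C, -, hC⟩ := hGb.exists_fourier_le N
        exact ⟨C, fun n ↦ hC _ _⟩) hΘ (fun ξ ↦ by
          simp only [G, smul_apply, charMul_apply, smul_eq_mul]
          by_cases h0 : Θ ξ = 0
          · simp [h0]
          · rw [cutoff_eq_one, character_smul_left, smul_smul]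
            · norm_num
              rw [sub_eq_add_neg, character_add_right]; ring
            · rw [norm_smul, Real.norm_of_nonneg (by norm_num)]
              linarith [hΘ ξ h0]) (z - y)
    have e : samp F (character y (-ω) • charMul y Θ) (z - y) = character y (-ω) * u z := by
      have e1 : charMul (z - y) (character y (-ω) • charMul y Θ) =
          character y (-ω) • charMul z Θ := by
        ext ξ
        simp only [charMul_apply, smul_apply, smul_eq_mul]
        rw [show character z ξ = character (z - y) ξ * character y ξ by
          rw [← character_add_left, sub_add_cancel]]
        ring
      rw [samp, e1, map_smul]; rfl
    rw [e] at h
    have e2 : ‖u z‖ₑ = ‖character y (-ω) * u z‖ₑ := by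
      rw [enorm_mul, ← ofReal_norm (character y (-ω)), norm_character]; simp
    rw [e2, ← h.tsum_eq]
    refine (ENNReal.rpow_le_rpow enorm_tsum_le_tsum_enorm hr.le).trans ?_
    refine (ENNReal.tsum_rpow_le_tsum_rpow _ hr hr1).trans (ENNReal.tsum_le_tsum fun n ↦ ?_)
    rw [enorm_mul, ENNReal.mul_rpow_of_nonneg _ _ hr.le]
    refine mul_le_mul' ?_ (le_of_eq ?_)
    · rw [← ofReal_norm, ENNReal.ofReal_rpow_of_nonneg (norm_nonneg _) hr.le]
      refine ENNReal.ofReal_le_ofReal ?_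
      rw [norm_mul, norm_character, mul_one]
      refine (Real.rpow_le_rpow (norm_nonneg _) (hC ⟨y, hy⟩ _) hr.le).trans (le_of_eq ?_)
      rw [Real.mul_rpow hC0 (by positivity), ← Real.rpow_mul (by positivity), neg_mul]
    · rw [hu, sub_add_eq_add_sub]
  set B := Metric.closedBall (0 : EuclideanSpace ℝ (Fin d)) 1 with hB
  have hV0 : volume B ≠ 0 := (Metric.measure_closedBall_pos volume _ one_pos).ne'
  have hVt : volume B ≠ ∞ := measure_closedBall_lt_top.ne
  -- The `r`-th power of the Hölder bound for the `L^r` norm on a unit ball by the `L^p` norm, where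
  -- `r = min(1, p) ≤ p`.
  let A : ℝ≥0∞ := (eLpNorm u p volume * volume B ^ (1 / (min 1 p).toReal - 1 / p.toReal)) ^ r
  have hq0 : min 1 p ≠ 0 := (lt_min one_pos hp).ne'
  have hqt : min 1 p ≠ ∞ := ne_top_of_le_ne_top ENNReal.one_ne_top (min_le_left _ _)
  have hA : A ≠ ∞ := by
    refine ENNReal.rpow_ne_top_of_nonneg hr.le (ENNReal.mul_ne_top hfin.ne ?_)
    exact ENNReal.rpow_ne_top_of_ne_zero hV0 hVt
  have hint : ∀ b, ∫⁻ y in B, ‖u (b - y)‖ₑ ^ r ≤ A := by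
    intro b
    have hm : AEStronglyMeasurable (fun y ↦ u (b - y)) volume :=
      (hucont.comp (continuous_const.sub continuous_id)).aestronglyMeasurable
    have h1 := eLpNorm_le_eLpNorm_mul_rpow_measure_univ (μ := volume.restrict B)
      (min_le_right 1 p) hm.restrict
    have h2 : eLpNorm (fun y ↦ u (b - y)) p (volume.restrict B) ≤ eLpNorm u p volume := by
      refine (eLpNorm_mono_measure _ Measure.restrict_le_self).trans (le_of_eq ?_)
      exact eLpNorm_comp_measurePreserving hucont.aestronglyMeasurable
        (Measure.measurePreserving_sub_left volume b)
    rw [Measure.restrict_apply_univ] at h1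
    have h3 := ENNReal.rpow_le_rpow (h1.trans (mul_le_mul_left h2 _)) hr.le
    rw [eLpNorm_eq_lintegral_rpow_enorm_toReal hq0 hqt, ← ENNReal.rpow_mul] at h3
    change (∫⁻ y in B, ‖u (b - y)‖ₑ ^ r) ^ (1 / r * r) ≤ A at h3
    rwa [one_div_mul_cancel hr.ne', ENNReal.rpow_one] at h3
  have hfinal : ∀ z, ‖u z‖ₑ ^ r * volume B ≤ (∑' n, w n) * A := by
    intro z
    calc ‖u z‖ₑ ^ r * volume B = ∫⁻ _ in B, ‖u z‖ₑ ^ r := by rw [setLIntegral_const]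
      _ ≤ ∫⁻ y in B, ∑' n, w n * ‖u (z + (1 / 8 : ℝ) • latticePoint n - y)‖ₑ ^ r := by
          refine setLIntegral_mono' Metric.isClosed_closedBall.measurableSet fun y hy ↦ hpt z y ?_
          simpa [hB] using hy
      _ = ∑' n, w n * ∫⁻ y in B, ‖u (z + (1 / 8 : ℝ) • latticePoint n - y)‖ₑ ^ r := by
          have hm : ∀ n : Fin d → ℤ, Measurable fun y ↦
              ‖u (z + (1 / 8 : ℝ) • latticePoint n - y)‖ₑ ^ r := fun n ↦
            ((hucont.comp (continuous_const.sub continuous_id)).measurable.enorm).pow_const _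
          rw [lintegral_tsum fun n ↦ ((hm n).const_mul _).aemeasurable]
          exact tsum_congr fun n ↦ lintegral_const_mul _ (hm n)
      _ ≤ ∑' n, w n * A := ENNReal.tsum_le_tsum fun n ↦ by gcongr; exact hint _
      _ = _ := ENNReal.tsum_mul_right
  set K : ℝ≥0∞ := ((∑' n, w n) * A / volume B) ^ (1 / r) with hK
  have hKt : K ≠ ∞ := ENNReal.rpow_ne_top_of_nonneg (by positivity)
    (ENNReal.div_ne_top (ENNReal.mul_ne_top hw.ne hA) hV0)
  refine ⟨K.toReal, fun z ↦ ?_⟩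
  have h1 : ‖u z‖ₑ ^ r ≤ (∑' n, w n) * A / volume B :=
    (ENNReal.le_div_iff_mul_le (Or.inl hV0) (Or.inl hVt)).2 (hfinal z)
  have h2 : ‖u z‖ₑ ≤ K := by
    have := ENNReal.rpow_le_rpow h1 (z := 1 / r) (by positivity)
    rwa [← ENNReal.rpow_mul, mul_one_div_cancel hr.ne', ENNReal.rpow_one] at this
  have := ENNReal.toReal_mono hKt h2
  simpa using this

/-! ### Finite sums of the frequency partition. -/

theorem IsFrequencyPartition.norm_sub_le {β : ℝ} {χ : 𝓢(EuclideanSpace ℝ (Fin d), ℂ)}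
    (hχ : IsFrequencyPartition β χ) {ω ξ : EuclideanSpace ℝ (Fin d)}
    (h : (𝓕 (modulation ω χ) : 𝓢(EuclideanSpace ℝ (Fin d), ℂ)) ξ ≠ 0) : ‖ξ - ω‖ ≤ 1 := by
  rw [fourier_modulation_apply] at h
  simpa using hχ.support_subset (subset_tsupport _ h)

/-- The terms of a convergent lattice series tend to zero along the cofinite filter, so only
finitely many are at least the value attained at the given radius. -/
theorem finite_norm_smul_latticePoint_le {β : ℝ} (hβ : 0 < β) (R : ℝ) :
    {k : Fin d → ℤ | ‖β • latticePoint k‖ ≤ R}.Finite := by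
  have h := (summable_one_add_norm_latticePoint (d := d) (t := d + 1) (by linarith)).tendsto_cofinite_zero
  have hpos : 0 < (1 + max (R / β) 0) ^ (-((d : ℝ) + 1)) := by positivity
  have h2 := h.eventually (gt_mem_nhds hpos)
  refine (Filter.eventually_cofinite.1 h2).subset fun k hk ↦ ?_
  simp only [Set.mem_ofPred_eq, not_lt] at hk ⊢
  refine Real.rpow_le_rpow_of_nonpos (by positivity) ?_ (by linarith [(Nat.cast_nonneg d : (0 : ℝ) ≤ d)])
  have : ‖latticePoint k‖ ≤ R / β := by
    rw [le_div_iff₀ hβ, mul_comm]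
    rwa [norm_smul, Real.norm_of_nonneg hβ.le] at hk
  linarith [le_max_left (R / β) 0]

/-- A finite sum of the functions of the partition is a low-frequency cutoff. -/
theorem IsFrequencyPartition.exists_finset {β : ℝ} {χ : 𝓢(EuclideanSpace ℝ (Fin d), ℂ)}
    (hχ : IsFrequencyPartition β χ) : ∃ K : Finset (Fin d → ℤ),
      (∀ ξ, ‖ξ‖ ≤ 1 → (∑ k ∈ K, 𝓕 (modulation (β • latticePoint k) χ) :
        𝓢(EuclideanSpace ℝ (Fin d), ℂ)) ξ = 1) ∧
      ∀ ξ, (∑ k ∈ K, 𝓕 (modulation (β • latticePoint k) χ) :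
        𝓢(EuclideanSpace ℝ (Fin d), ℂ)) ξ ≠ 0 → ‖ξ‖ ≤ 3 := by
  -- A piece that is nonzero somewhere on the unit ball has its centre within distance `2` of the
  -- origin, and such pieces are supported within distance `3`, the radius accepted by the sampling
  -- formula.
  have hfin := finite_norm_smul_latticePoint_le (d := d) hχ.pos 2
  refine ⟨hfin.toFinset, fun ξ hξ ↦ ?_, fun ξ hξ ↦ ?_⟩
  · rw [sum_apply]
    refine HasSum.unique (hasSum_sum_of_ne_finset_zero fun k hk ↦ ?_) ((hχ.hasSum_one ξ).congr_fun
      fun k ↦ fourier_modulation_apply _ χ ξ)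
    by_contra hne
    refine hk ?_
    have h1 := hχ.norm_sub_le hne
    simp only [Set.Finite.mem_toFinset, Set.mem_ofPred_eq]
    have := norm_sub_norm_le (β • latticePoint k) ξ
    rw [norm_sub_rev] at this
    linarith
  · rw [sum_apply] at hξ
    obtain ⟨k, hk, hne⟩ := Finset.exists_ne_zero_of_sum_ne_zero hξ
    have h1 := hχ.norm_sub_le hne
    simp only [Set.Finite.mem_toFinset, Set.mem_ofPred_eq] at hk
    have := norm_sub_norm_le ξ (β • latticePoint k)
    linarith

/-! ### Low-frequency operators as sampling series. -/

/-- Pointwise multiplication of Schwartz functions. -/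
def schwartzMul (ρ Θ : 𝓢(EuclideanSpace ℝ (Fin d), ℂ)) : 𝓢(EuclideanSpace ℝ (Fin d), ℂ) :=
  SchwartzMap.smulLeftCLM ℂ ρ Θ

theorem schwartzMul_apply (ρ Θ : 𝓢(EuclideanSpace ℝ (Fin d), ℂ)) (ξ : EuclideanSpace ℝ (Fin d)) :
    schwartzMul ρ Θ ξ = ρ ξ * Θ ξ := by
  simp [schwartzMul, SchwartzMap.smulLeftCLM_apply_apply ρ.hasTemperateGrowth]

theorem samp_add_left (F F' : 𝓢'(EuclideanSpace ℝ (Fin d), ℂ))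
    (Θ : 𝓢(EuclideanSpace ℝ (Fin d), ℂ)) (x : EuclideanSpace ℝ (Fin d)) :
    samp (F + F') Θ x = samp F Θ x + samp F' Θ x := rfl

theorem samp_smul_left (c : ℂ) (F : 𝓢'(EuclideanSpace ℝ (Fin d), ℂ))
    (Θ : 𝓢(EuclideanSpace ℝ (Fin d), ℂ)) (x : EuclideanSpace ℝ (Fin d)) :
    samp (c • F) Θ x = c * samp F Θ x := rfl

theorem charMul_add (a : EuclideanSpace ℝ (Fin d)) (Θ Θ' : 𝓢(EuclideanSpace ℝ (Fin d), ℂ)) :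
    charMul a (Θ + Θ') = charMul a Θ + charMul a Θ' := map_add _ _ _

theorem charMul_smul (a : EuclideanSpace ℝ (Fin d)) (c : ℂ) (Θ : 𝓢(EuclideanSpace ℝ (Fin d), ℂ)) :
    charMul a (c • Θ) = c • charMul a Θ := map_smul _ _ _

theorem samp_add_right (F : 𝓢'(EuclideanSpace ℝ (Fin d), ℂ))
    (Θ Θ' : 𝓢(EuclideanSpace ℝ (Fin d), ℂ)) (x : EuclideanSpace ℝ (Fin d)) :
    samp F (Θ + Θ') x = samp F Θ x + samp F Θ' x := by
  rw [samp, charMul_add]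
  exact map_add (F : 𝓢(EuclideanSpace ℝ (Fin d), ℂ) →L[ℂ] ℂ) _ _

theorem samp_smul_right (F : 𝓢'(EuclideanSpace ℝ (Fin d), ℂ)) (c : ℂ)
    (Θ : 𝓢(EuclideanSpace ℝ (Fin d), ℂ)) (x : EuclideanSpace ℝ (Fin d)) :
    samp F (c • Θ) x = c * samp F Θ x := by
  rw [samp, charMul_smul]
  exact map_smul (F : 𝓢(EuclideanSpace ℝ (Fin d), ℂ) →L[ℂ] ℂ) _ _

theorem samp_sum_right {ι : Type*} (F : 𝓢'(EuclideanSpace ℝ (Fin d), ℂ)) (s : Finset ι)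
    (Θ : ι → 𝓢(EuclideanSpace ℝ (Fin d), ℂ)) (x : EuclideanSpace ℝ (Fin d)) :
    samp F (∑ i ∈ s, Θ i) x = ∑ i ∈ s, samp F (Θ i) x := by
  rw [samp, charMul, map_sum]
  exact map_sum (F : 𝓢(EuclideanSpace ℝ (Fin d), ℂ) →L[ℂ] ℂ) _ _

theorem samp_charMul (F : 𝓢'(EuclideanSpace ℝ (Fin d), ℂ)) (a : EuclideanSpace ℝ (Fin d))
    (Θ : 𝓢(EuclideanSpace ℝ (Fin d), ℂ)) (x : EuclideanSpace ℝ (Fin d)) :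
    samp F (charMul a Θ) x = samp F Θ (x + a) := by
  rw [samp, charMul_charMul, samp]

/-- If the low-frequency part `samp F ρ` is bounded, multiplying `ρ` by a Schwartz function `Θ`
gives a bounded function, with a bound that is a continuous seminorm of `Θ`. -/
theorem exists_norm_samp_schwartzMul_le {ρ : 𝓢(EuclideanSpace ℝ (Fin d), ℂ)}
    (hρ : ∀ ξ, ρ ξ ≠ 0 → ‖ξ‖ ≤ 3) : ∃ (s : Finset (ℕ × ℕ)) (C : ℝ), 0 ≤ C ∧
      ∀ (F : 𝓢'(EuclideanSpace ℝ (Fin d), ℂ)) (B : ℝ), (∀ x, ‖samp F ρ x‖ ≤ B) →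
        ∀ (ψ : 𝓢(EuclideanSpace ℝ (Fin d), ℂ)) x, ‖samp F (schwartzMul ρ (𝓕⁻ ψ)) x‖ ≤
          B * (C * s.sup (schwartzSeminormFamily ℂ (EuclideanSpace ℝ (Fin d)) ℂ) ψ) := by
  let e : EuclideanSpace ℝ (Fin d) ≃L[ℝ] EuclideanSpace ℝ (Fin d) :=
    ContinuousLinearEquiv.smulLeft (Units.mk0 (8 : ℝ) (by norm_num))
  -- The cutoff is `1` on the rescaled support of `ρ`, so `ρ · 𝓕⁻ψ` equals `ρ` times the rescaled
  -- `A₀ ψ`, an admissible `G` for the sampling formula that depends linearly and continuously on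
  -- `ψ`.
  let A₀ : 𝓢(EuclideanSpace ℝ (Fin d), ℂ) →L[ℂ] 𝓢(EuclideanSpace ℝ (Fin d), ℂ) :=
    SchwartzMap.smulLeftCLM ℂ (cutoff d) ∘L SchwartzMap.compCLMOfContinuousLinearEquiv ℂ e ∘L
      fourierInvCLM ℂ 𝓢(EuclideanSpace ℝ (Fin d), ℂ)
  have hA₀ : ∀ ψ η, A₀ ψ η = cutoff d η * (𝓕⁻ ψ : 𝓢(EuclideanSpace ℝ (Fin d), ℂ)) ((8 : ℝ) • η) := by
    intro ψ η
    change SchwartzMap.smulLeftCLM ℂ (cutoff d) (SchwartzMap.compCLMOfContinuousLinearEquiv ℂ e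
      (𝓕⁻ ψ)) η = _
    rw [SchwartzMap.smulLeftCLM_apply_apply (cutoff d).hasTemperateGrowth]
    rfl
  let A : 𝓢(EuclideanSpace ℝ (Fin d), ℂ) →L[ℂ] 𝓢(EuclideanSpace ℝ (Fin d), ℂ) :=
    fourierCLM ℂ 𝓢(EuclideanSpace ℝ (Fin d), ℂ) ∘L A₀
  -- Controls decay of order `d + 1` of the Fourier transform of `A₀ ψ`, enough for the lattice sum
  -- `S` to converge.
  let q : Seminorm ℂ 𝓢(EuclideanSpace ℝ (Fin d), ℂ) :=
    ((Finset.Iic (d + 1, 0)).sup (schwartzSeminormFamily ℂ (EuclideanSpace ℝ (Fin d)) ℂ)).comp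
      A.toLinearMap
  have hq : Continuous q := by
    have h : Continuous ((Finset.Iic ((d + 1, 0) : ℕ × ℕ)).sup
        (schwartzSeminormFamily ℂ (EuclideanSpace ℝ (Fin d)) ℂ) :
          Seminorm ℂ 𝓢(EuclideanSpace ℝ (Fin d), ℂ)) :=
      Finset.sup_induction (p := fun q : Seminorm ℂ 𝓢(EuclideanSpace ℝ (Fin d), ℂ) ↦ Continuous q)
        continuous_const (fun p hp q hq ↦ hp.sup hq)
        fun i _ ↦ (schwartz_withSeminorms ℂ _ ℂ).continuous_seminorm i
    exact h.comp A.continuous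
  obtain ⟨s, C, -, hC⟩ := Seminorm.bound_of_continuous
    (schwartz_withSeminorms ℂ (EuclideanSpace ℝ (Fin d)) ℂ) q hq
  set S := ∑' n : Fin d → ℤ, (1 + ‖latticePoint n‖) ^ (-((d + 1 : ℕ) : ℝ)) with hS
  have hsum := summable_one_add_norm_latticePoint (d := d) (t := (d + 1 : ℕ)) (by push_cast; linarith)
  refine ⟨s, S * (2 ^ (d + 1) * C), by positivity, fun F B hB ψ x ↦ ?_⟩
  have hdec : ∀ n, ‖𝓕 (A₀ ψ : EuclideanSpace ℝ (Fin d) → ℂ) (latticePoint n)‖ ≤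
      2 ^ (d + 1) * q ψ * (1 + ‖latticePoint n‖) ^ (-((d + 1 : ℕ) : ℝ)) := by
    intro n
    have h := SchwartzMap.one_add_le_sup_seminorm_apply (𝕜 := ℂ) (m := (d + 1, 0)) le_rfl le_rfl
      (A ψ) (latticePoint n)
    rw [norm_iteratedFDeriv_zero] at h
    have hx : 0 < 1 + ‖latticePoint n‖ := by positivity
    rw [Real.rpow_neg hx.le, Real.rpow_natCast, ← div_eq_mul_inv, le_div_iff₀ (by positivity), mul_comm]
    exact h
  have hA₀b : IsBoundedFamily fun _ : Unit ↦ A₀ ψ := fun k l ↦ ⟨_, fun _ ↦ le_rfl⟩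
  have h := hasSum_samp F (Θ := ρ) (Θ' := schwartzMul ρ (𝓕⁻ ψ)) (ω := 0) (A₀ ψ).continuous
    (fun η hη ↦ by rw [hA₀, cutoff_eq_zero hη, zero_mul])
    (summable_of_decay fun N ↦ by
      obtain ⟨C, -, hC⟩ := hA₀b.exists_fourier_le N
      exact ⟨C, fun n ↦ hC () _⟩) (by simpa using hρ) (fun ξ ↦ by
        rw [schwartzMul_apply, hA₀]
        by_cases h0 : ρ ξ = 0
        · simp [h0]
        · rw [cutoff_eq_one, sub_zero, smul_smul]
          · norm_num; ring
          · rw [sub_zero, norm_smul, Real.norm_of_nonneg (by norm_num)]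
            linarith [hρ ξ h0]) x
  have hB0 : 0 ≤ B := (norm_nonneg _).trans (hB 0)
  rw [← h.tsum_eq]
  refine (tsum_of_norm_bounded ((hsum.hasSum.mul_left (2 ^ (d + 1) * q ψ)).mul_right B)
    fun n ↦ ?_).trans ?_
  · rw [norm_mul, norm_mul, norm_character, mul_one]
    gcongr
    · exact hdec n
    · exact hB _
  · have h1 : q ψ ≤ C * s.sup (schwartzSeminormFamily ℂ (EuclideanSpace ℝ (Fin d)) ℂ) ψ := hC ψ
    have hS0 : 0 ≤ S := tsum_nonneg fun _ ↦ by positivity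
    calc 2 ^ (d + 1) * q ψ * S * B ≤ 2 ^ (d + 1) *
          (C * s.sup (schwartzSeminormFamily ℂ (EuclideanSpace ℝ (Fin d)) ℂ) ψ) * S * B := by gcongr
      _ = _ := by ring

/-- The multiplier operator with a symbol of absolutely summable Fourier coefficients `c`, applied
to a distribution with bounded low-frequency part. -/
theorem exists_hasSum_samp_schwartzMul {ρ : 𝓢(EuclideanSpace ℝ (Fin d), ℂ)}
    (hρ : ∀ ξ, ρ ξ ≠ 0 → ‖ξ‖ ≤ 3) {c : (Fin d → ℤ) → ℂ} (hc : Summable fun n ↦ ‖c n‖)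
    {F : 𝓢'(EuclideanSpace ℝ (Fin d), ℂ)} (hF : ∃ B, ∀ x, ‖samp F ρ x‖ ≤ B) :
    ∃ g : 𝓢'(EuclideanSpace ℝ (Fin d), ℂ), ∀ ψ : 𝓢(EuclideanSpace ℝ (Fin d), ℂ),
      HasSum (fun n ↦ c n * samp F (schwartzMul ρ (𝓕⁻ ψ)) ((1 / 8 : ℝ) • latticePoint n)) (g ψ) := by
  obtain ⟨B, hB⟩ := hF
  have hB0 : 0 ≤ B := (norm_nonneg _).trans (hB 0)
  obtain ⟨s, C, hC0, hC⟩ := exists_norm_samp_schwartzMul_le hρ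
  have hle : ∀ (ψ : 𝓢(EuclideanSpace ℝ (Fin d), ℂ)) n,
      ‖c n * samp F (schwartzMul ρ (𝓕⁻ ψ)) ((1 / 8 : ℝ) • latticePoint n)‖ ≤
        ‖c n‖ * (B * (C * s.sup (schwartzSeminormFamily ℂ (EuclideanSpace ℝ (Fin d)) ℂ) ψ)) := by
    intro ψ n
    rw [norm_mul]
    gcongr
    exact hC F B hB ψ _
  have hsum : ∀ ψ : 𝓢(EuclideanSpace ℝ (Fin d), ℂ), Summable fun n ↦
      c n * samp F (schwartzMul ρ (𝓕⁻ ψ)) ((1 / 8 : ℝ) • latticePoint n) := fun ψ ↦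
    Summable.of_norm_bounded (hc.mul_right _) (hle ψ)
  -- The bound `hle` is uniform in the sampling point, so absolute summability of `c` gives
  -- convergence; being a Schwartz seminorm of `ψ`, it also gives continuity of the functional.
  let T : 𝓢(EuclideanSpace ℝ (Fin d), ℂ) →L[ℂ] ℂ := SchwartzMap.mkCLMtoNormedSpace
    (fun ψ ↦ ∑' n, c n * samp F (schwartzMul ρ (𝓕⁻ ψ)) ((1 / 8 : ℝ) • latticePoint n))
    (fun ψ φ ↦ by
      rw [← (hsum ψ).tsum_add (hsum φ)]
      refine tsum_congr fun n ↦ ?_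
      rw [FourierTransform.fourierInv_add, schwartzMul, map_add, samp_add_right, mul_add]
      rfl)
    (fun a ψ ↦ by
      rw [RingHom.id_apply, smul_eq_mul, ← tsum_mul_left]
      refine tsum_congr fun n ↦ ?_
      rw [FourierTransform.fourierInv_smul, schwartzMul, map_smul, samp_smul_right]
      exact mul_left_comm _ _ _)
    ⟨s, (∑' n, ‖c n‖) * (B * C), by positivity, fun ψ ↦ by
      refine (tsum_of_norm_bounded (hc.hasSum.mul_right _) (hle ψ)).trans (le_of_eq ?_)
      ring⟩
  exact ⟨ContinuousLinearMap.toPointwiseConvergenceCLM _ _ _ _ T, fun ψ ↦ (hsum ψ).hasSum⟩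

/-! ### Phases with bounded derivatives of order at least two. -/

theorem iteratedFDeriv_affine {E F : Type*} [NormedAddCommGroup E] [NormedSpace ℝ E]
    [NormedAddCommGroup F] [NormedSpace ℝ F] {f : E → F} (hf : ContDiff ℝ (⊤ : ℕ∞) f) (t : ℝ)
    (ω : E) (l : ℕ) (η : E) : iteratedFDeriv ℝ l (fun η ↦ f (ω + t • η)) η =
      t ^ l • iteratedFDeriv ℝ l f (ω + t • η) := by
  have h1 : ContDiff ℝ l fun z ↦ f (ω + z) :=
    (hf.of_le (by exact_mod_cast le_top)).comp (contDiff_const.add contDiff_id)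
  rw [iteratedFDeriv_comp_const_smul (f := fun z ↦ f (ω + z)) t h1]
  simp only [iteratedFDeriv_comp_add_left]

theorem iteratedFDeriv_clm_of_two_le {E : Type*} [NormedAddCommGroup E] [NormedSpace ℝ E]
    (T : E →L[ℝ] ℝ) {i : ℕ} (hi : 2 ≤ i) (x : E) : iteratedFDeriv ℝ i T x = 0 := by
  obtain ⟨j, rfl⟩ : ∃ j, i = j + 1 + 1 := ⟨i - 2, by omega⟩
  have hf : fderiv ℝ T = fun _ ↦ T := funext fun y ↦ T.fderiv
  rw [← norm_eq_zero, ← norm_iteratedFDeriv_fderiv, hf, iteratedFDeriv_const_of_ne (by omega)]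
  simp

theorem hasTemperateGrowth_cexp {P : EuclideanSpace ℝ (Fin d) → ℝ} (hP : P.HasTemperateGrowth) :
    (fun ξ ↦ Complex.exp ((P ξ : ℂ) * Complex.I)).HasTemperateGrowth :=
  hasTemperateGrowth_exp_mul_I.comp hP

/-- A phase function with bounded derivatives of all orders `≥ 2` differs, near every point, from
an affine function by a function with derivatives that are bounded uniformly in the point. -/
theorem exists_norm_iteratedFDeriv_remainder_le {P : EuclideanSpace ℝ (Fin d) → ℝ}
    (hP : ContDiff ℝ (⊤ : ℕ∞) P)
    (hb : ∀ j : ℕ, 2 ≤ j → ∃ C : ℝ, ∀ ξ, ‖iteratedFDeriv ℝ j P ξ‖ ≤ C) (l : ℕ) :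
    ∃ C : ℝ, ∀ ω x : EuclideanSpace ℝ (Fin d), ‖x‖ ≤ 1 → ‖iteratedFDeriv ℝ l (fun η ↦
      Complex.exp (((P (ω + (8 : ℝ) • η) - (P ω + ((8 : ℝ) • fderiv ℝ P ω) η) : ℝ) : ℂ) *
        Complex.I)) x‖ ≤ C := by
  have hb' : ∀ j : ℕ, ∃ C : ℝ, 2 ≤ j → ∀ ξ, ‖iteratedFDeriv ℝ j P ξ‖ ≤ C := by
    intro j
    by_cases hj : 2 ≤ j
    · obtain ⟨C, hC⟩ := hb j hj; exact ⟨C, fun _ ↦ hC⟩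
    · exact ⟨0, fun h ↦ absurd h hj⟩
  choose B hB using hb'
  have hB0 : ∀ j, 2 ≤ j → 0 ≤ B j := fun j hj ↦ (norm_nonneg _).trans (hB j hj 0)
  -- For the first derivative, the mean value theorem gives `8 · B 2 · 8 ‖x‖`, hence `64`. For order
  -- `j ≥ 2` the affine part disappears and the scaling gives `8 ^ j`.
  set D : ℝ := 1 + 64 * |B 2| + ∑ j ∈ Finset.range (l + 1), 8 ^ j * |B j| with hD
  have hD1 : 1 ≤ D := by
    have : 0 ≤ ∑ j ∈ Finset.range (l + 1), 8 ^ j * |B j| := by positivity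
    rw [hD]; linarith [abs_nonneg (B 2)]
  refine ⟨l.factorial * D ^ l, fun ω x hx ↦ ?_⟩
  have hP8 : ContDiff ℝ (⊤ : ℕ∞) fun η : EuclideanSpace ℝ (Fin d) ↦ P (ω + (8 : ℝ) • η) :=
    hP.comp (contDiff_const.add (contDiff_const_smul _))
  set T := (8 : ℝ) • fderiv ℝ P ω with hT
  have hT' : ContDiff ℝ (⊤ : ℕ∞) fun η ↦ P ω + T η := contDiff_const.add T.contDiff
  refine norm_iteratedFDeriv_cexp_comp_le (hP8.sub hT') fun i hi hil ↦ ?_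
  refine le_trans ?_ (le_self_pow₀ hD1 (by omega))
  have hdiff : Differentiable ℝ P := hP.differentiable (by simp)
  rcases hi.eq_or_lt with rfl | hi2
  · rw [norm_iteratedFDeriv_one]
    have hd1 : HasFDerivAt (fun η : EuclideanSpace ℝ (Fin d) ↦ P (ω + (8 : ℝ) • η))
        ((8 : ℝ) • fderiv ℝ P (ω + (8 : ℝ) • x)) x := by
      have h1 := (hdiff (ω + (8 : ℝ) • x)).hasFDerivAt
      have h2 : HasFDerivAt (fun η : EuclideanSpace ℝ (Fin d) ↦ ω + (8 : ℝ) • η)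
          ((8 : ℝ) • ContinuousLinearMap.id ℝ _) x :=
        ((hasFDerivAt_id x).const_smul (8 : ℝ)).const_add ω
      have h3 := h1.comp x h2
      have e : (fderiv ℝ P (ω + (8 : ℝ) • x)).comp ((8 : ℝ) • ContinuousLinearMap.id ℝ _) =
          (8 : ℝ) • fderiv ℝ P (ω + (8 : ℝ) • x) := by ext v; simp
      rw [e] at h3
      exact h3
    have hd2 : HasFDerivAt (fun η ↦ P ω + T η) T x := T.hasFDerivAt.const_add (P ω)
    have hd3 : fderiv ℝ (fun η ↦ P (ω + (8 : ℝ) • η) - (P ω + T η)) x =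
        (8 : ℝ) • fderiv ℝ P (ω + (8 : ℝ) • x) - T := (hd1.sub hd2).fderiv
    rw [hd3, hT, ← smul_sub, norm_smul]
    have hmv := (convex_univ).norm_image_sub_le_of_norm_fderiv_le (𝕜 := ℝ) (f := fderiv ℝ P)
      (C := B 2) (fun y _ ↦ ?_) (fun y _ ↦ ?_) (Set.mem_univ ω) (Set.mem_univ (ω + (8 : ℝ) • x))
    · rw [add_sub_cancel_left, norm_smul] at hmv
      have h8 : ‖(8 : ℝ)‖ = 8 := by norm_num
      rw [h8] at hmv ⊢
      have : 0 ≤ ∑ j ∈ Finset.range (l + 1), 8 ^ j * |B j| := by positivity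
      have h0 := hB0 2 le_rfl
      rw [hD, abs_of_nonneg h0]
      nlinarith [norm_nonneg x]
    · exact ((hP.fderiv_right (m := 1) (by norm_cast)).differentiable (by simp)) y
    · have := hB 2 le_rfl y
      rwa [← norm_iteratedFDeriv_fderiv, norm_iteratedFDeriv_one] at this
  · have e : (fun η ↦ P (ω + (8 : ℝ) • η) - (P ω + T η)) =
        (fun η ↦ P (ω + (8 : ℝ) • η)) -
          ((fun _ ↦ P ω) + (T : EuclideanSpace ℝ (Fin d) → ℝ)) := rfl
    have hT2 : ContDiff ℝ i ((fun _ ↦ P ω) + (T : EuclideanSpace ℝ (Fin d) → ℝ)) :=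
      contDiff_const.add T.contDiff
    rw [e, iteratedFDeriv_sub_apply (hP8.of_le (by exact_mod_cast le_top)).contDiffAt
      hT2.contDiffAt, iteratedFDeriv_add_apply contDiffAt_const
      T.contDiff.contDiffAt, iteratedFDeriv_const_of_ne (by omega),
      iteratedFDeriv_clm_of_two_le T hi2, iteratedFDeriv_affine hP]
    simp only [Pi.zero_apply, add_zero, sub_zero]
    rw [norm_smul]
    have h1 : 8 ^ i * |B i| ≤ ∑ j ∈ Finset.range (l + 1), 8 ^ j * |B j| :=
      Finset.single_le_sum (f := fun j ↦ (8 : ℝ) ^ j * |B j|) (fun _ _ ↦ by positivity)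
        (Finset.mem_range.2 (by omega))
    have h2 := hB i hi2 (ω + (8 : ℝ) • x)
    have h3 : ‖(8 : ℝ) ^ i‖ = 8 ^ i := by simp
    rw [h3]
    calc 8 ^ i * ‖iteratedFDeriv ℝ i P (ω + (8 : ℝ) • x)‖ ≤ 8 ^ i * |B i| := by
          gcongr; exact h2.trans (le_abs_self _)
      _ ≤ D := by rw [hD]; linarith [abs_nonneg (B 2)]

theorem eLpNorm_samp_smul_charMul (F : 𝓢'(EuclideanSpace ℝ (Fin d), ℂ)) {z : ℂ} (hz : ‖z‖ = 1)
    (b : EuclideanSpace ℝ (Fin d)) (Θ : 𝓢(EuclideanSpace ℝ (Fin d), ℂ)) (p : ℝ≥0∞) :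
    eLpNorm (samp F (z • charMul b Θ)) p volume = eLpNorm (samp F Θ) p volume := by
  have e : samp F (z • charMul b Θ) = z • fun x ↦ samp F Θ (x + b) := by
    ext x
    rw [samp_smul_right, samp_charMul]; rfl
  rw [e, eLpNorm_const_smul, ← ofReal_norm, hz, ENNReal.ofReal_one, one_mul]
  exact eLpNorm_comp_measurePreserving (continuous_samp F Θ).aestronglyMeasurable
    (measurePreserving_add_right volume b)

/-- The first-order Taylor polynomial of `P` at `ω` contributes a unimodular constant and a
translation, which do not change the `L^p` norm. The remaining factor has derivatives bounded
independently of `ω`, so one constant serves all centres. -/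
theorem exists_eLpNorm_samp_cexp_le {P : EuclideanSpace ℝ (Fin d) → ℝ} (hP : P.HasTemperateGrowth)
    (hb : ∀ j : ℕ, 2 ≤ j → ∃ C : ℝ, ∀ ξ, ‖iteratedFDeriv ℝ j P ξ‖ ≤ C) {p : ℝ≥0∞} (hp : 0 < p) :
    ∃ C : ℝ≥0, ∀ (F : 𝓢'(EuclideanSpace ℝ (Fin d), ℂ)) (Θ : 𝓢(EuclideanSpace ℝ (Fin d), ℂ))
      (ω : EuclideanSpace ℝ (Fin d)), (∀ ξ, Θ ξ ≠ 0 → ‖ξ - ω‖ ≤ 3) →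
      eLpNorm (samp F (SchwartzMap.smulLeftCLM ℂ
        (fun ξ ↦ Complex.exp ((P ξ : ℂ) * Complex.I)) Θ)) p volume ≤
        C * eLpNorm (samp F Θ) p volume := by
  have hexp := hasTemperateGrowth_cexp hP
  obtain ⟨C, hC⟩ := exists_eLpNorm_samp_mul_le (ι := EuclideanSpace ℝ (Fin d))
    (a := fun ω η ↦ Complex.exp (((P (ω + (8 : ℝ) • η) - (P ω + ((8 : ℝ) • fderiv ℝ P ω) η) : ℝ) :
      ℂ) * Complex.I)) (fun ω ↦ by
        have h8 : ContDiff ℝ (⊤ : ℕ∞) fun η : EuclideanSpace ℝ (Fin d) ↦ P (ω + (8 : ℝ) • η) :=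
          hP.1.comp (contDiff_const.add (contDiff_const_smul _))
        have h := (h8.sub (contDiff_const.add ((8 : ℝ) • fderiv ℝ P ω).contDiff :
          ContDiff ℝ (⊤ : ℕ∞) fun η ↦ P ω + ((8 : ℝ) • fderiv ℝ P ω) η))
        exact ((Complex.ofRealCLM.contDiff.comp h).mul contDiff_const).cexp)
    (exists_norm_iteratedFDeriv_remainder_le hP.1 hb) hp
  refine ⟨C, fun F Θ ω hΘ ↦ ?_⟩
  -- The gradient of `P` at `ω` divided by `2π`, so that `character b v = exp(i dP_ω(v))`.
  set b : EuclideanSpace ℝ (Fin d) :=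
    (2 * Real.pi)⁻¹ • (InnerProductSpace.toDual ℝ _).symm (fderiv ℝ P ω) with hbdef
  have hbv : ∀ v, character b v = Complex.exp ((fderiv ℝ P ω v : ℝ) * Complex.I) := by
    intro v
    rw [character, hbdef, inner_smul_left, InnerProductSpace.toDual_symm_apply]
    congr 3
    simp only [conj_trivial]
    field_simp
  set z : ℂ := Complex.exp ((P ω : ℂ) * Complex.I) * character b (-ω) with hz
  have hz1 : ‖z‖ = 1 := by
    rw [hz, norm_mul, norm_character, Complex.norm_exp_ofReal_mul_I, one_mul]
  have hz0 : z ≠ 0 := fun h ↦ by rw [h, norm_zero] at hz1; exact zero_ne_one hz1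
  set Θ₁ := SchwartzMap.smulLeftCLM ℂ (fun ξ ↦ Complex.exp ((P ξ : ℂ) * Complex.I)) Θ with hΘ₁
  set Θ₂ := z⁻¹ • charMul (-b) Θ₁ with hΘ₂
  have e : Θ₁ = z • charMul b Θ₂ := by
    rw [hΘ₂, charMul_smul, smul_smul, mul_inv_cancel₀ hz0, one_smul, charMul_charMul,
      add_neg_cancel]
    ext ξ; rw [charMul_apply, character_zero_left, one_mul]
  rw [e, eLpNorm_samp_smul_charMul F hz1]
  refine hC ω F Θ Θ₂ ω hΘ fun ξ ↦ ?_
  have hξ : ω + (8 : ℝ) • (1 / 8 : ℝ) • (ξ - ω) = ξ := by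
    rw [smul_smul]; norm_num
  have hlin : ((8 : ℝ) • fderiv ℝ P ω) ((1 / 8 : ℝ) • (ξ - ω)) = fderiv ℝ P ω (ξ - ω) := by
    simp
  simp only [hΘ₂, smul_apply, charMul_apply, smul_eq_mul, hξ, hlin]
  rw [hΘ₁, SchwartzMap.smulLeftCLM_apply_apply hexp, smul_eq_mul]
  have h2 : Complex.exp (((P ξ - (P ω + fderiv ℝ P ω (ξ - ω)) : ℝ) : ℂ) * Complex.I) *
      (z * character b ξ) = Complex.exp ((P ξ : ℂ) * Complex.I) := by
    rw [hz, mul_assoc _ _ (character b ξ), ← character_add_right, neg_add_eq_sub, hbv,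
      ← Complex.exp_add, ← Complex.exp_add]
    congr 1; push_cast; ring
  have h3 : character (-b) ξ * character b ξ = 1 := by
    rw [← character_add_left, neg_add_cancel, character_zero_left]
  have h4 : character b ξ ≠ 0 := fun h ↦ by rw [h, mul_zero] at h3; exact zero_ne_one h3
  rw [← h2]
  calc _ = (z⁻¹ * z) * (character (-b) ξ * character b ξ) * (Complex.exp (((P ξ -
        (P ω + fderiv ℝ P ω (ξ - ω)) : ℝ) : ℂ) * Complex.I) * Θ ξ) := by ring
    _ = _ := by rw [h3, inv_mul_cancel₀ hz0, one_mul, one_mul]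

/-! ### Schwartz functions belong to the modulation space. -/

theorem eLpNorm_count_lt_top_of_le {q : ℝ≥0∞} {t : ℝ} (ht0 : 0 ≤ t)
    (ht : (d : ℝ) < t * q.toReal ∨ q = ∞) {g : (Fin d → ℤ) → ℝ≥0∞} {D : ℝ≥0}
    (hg : ∀ k, g k ≤ D * ENNReal.ofReal ((1 + ‖latticePoint k‖) ^ (-t))) :
    eLpNorm g q Measure.count < ∞ := by
  rcases eq_or_ne q ∞ with rfl | hq
  · rw [eLpNorm_exponent_top, eLpNormEssSup_count]
    refine lt_of_le_of_lt (iSup_le fun k ↦ ?_) (ENNReal.coe_lt_top (r := D))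
    rw [enorm_eq_self]
    refine (hg k).trans (mul_le_of_le_one_right' ?_)
    rw [ENNReal.ofReal_le_one]
    exact Real.rpow_le_one_of_one_le_of_nonpos (by linarith [norm_nonneg (latticePoint k)])
      (by linarith)
  · have ht' := ht.resolve_right hq
    rcases eq_or_ne q 0 with rfl | hq0
    · simp
    have hqr : 0 < q.toReal := ENNReal.toReal_pos hq0 hq
    rw [eLpNorm_lt_top_iff_lintegral_rpow_enorm_lt_top hq0 hq, lintegral_count]
    refine lt_of_le_of_lt (ENNReal.tsum_le_tsum fun k ↦ ?_)
      (tsum_ofReal_lt_top (C := (D : ℝ) ^ q.toReal) ht')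
    rw [enorm_eq_self]
    refine (ENNReal.rpow_le_rpow (hg k) hqr.le).trans (le_of_eq ?_)
    rw [← ENNReal.ofReal_coe_nnreal, ← ENNReal.ofReal_mul D.coe_nonneg,
      ENNReal.ofReal_rpow_of_nonneg (by positivity) hqr.le,
      Real.mul_rpow D.coe_nonneg (by positivity), ← Real.rpow_mul (by positivity), neg_mul]

theorem exists_exponent_of_pos {q : ℝ≥0∞} (hq : 0 < q) :
    ∃ N : ℕ, (d : ℝ) < N * q.toReal ∨ q = ∞ := by
  rcases eq_or_ne q ∞ with h | h
  · exact ⟨0, Or.inr h⟩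
  · obtain ⟨N, hN⟩ := exists_nat_mul_gt (ENNReal.toReal_pos hq.ne' h) d
    exact ⟨N, Or.inl hN⟩

theorem modNorm_le_of_forall_le {β : ℝ} {χ : 𝓢(EuclideanSpace ℝ (Fin d), ℂ)} {p q : ℝ≥0∞} {s : ℝ}
    {f g : 𝓢'(EuclideanSpace ℝ (Fin d), ℂ)} {C : ℝ≥0}
    (h : ∀ k : Fin d → ℤ, eLpNorm (conv g (modulation (β • latticePoint k) χ)) p volume ≤
      C * eLpNorm (conv f (modulation (β • latticePoint k) χ)) p volume) :
    modNorm β χ p q s g ≤ C * modNorm β χ p q s f := by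
  refine (eLpNorm_le_nnreal_smul_eLpNorm_of_ae_le_mul' (c := C)
    (Eventually.of_forall fun k ↦ ?_) q).trans (le_of_eq rfl)
  simp only [enorm_eq_self]
  rw [mul_left_comm]
  gcongr
  exact h k

theorem eLpNorm_conv_lt_top {β : ℝ} {χ : 𝓢(EuclideanSpace ℝ (Fin d), ℂ)} {p q : ℝ≥0∞} {s : ℝ}
    (hq : 0 < q) {f : 𝓢'(EuclideanSpace ℝ (Fin d), ℂ)} (hf : f ∈ modSpace β χ p q s)
    (k : Fin d → ℤ) : eLpNorm (conv f (modulation (β • latticePoint k) χ)) p volume < ∞ := by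
  have h := (enorm_le_eLpNorm_count (fun k : Fin d → ℤ ↦
    ENNReal.ofReal (bracket (β • latticePoint k) ^ s) *
      eLpNorm (conv f (modulation (β • latticePoint k) χ)) p volume) k hq.ne').trans_lt hf
  rw [enorm_eq_self] at h
  have hpos : 0 < bracket (β • latticePoint k) ^ s := by
    have : 0 < bracket (β • latticePoint k) := Real.sqrt_pos.2 (by positivity)
    positivity
  by_contra hne
  rw [not_lt, top_le_iff] at hne
  rw [hne, ENNReal.mul_top (by simpa using hpos)] at h
  exact lt_irrefl _ h

theorem fourier_toTempered_apply (φ θ : 𝓢(EuclideanSpace ℝ (Fin d), ℂ)) :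
    (𝓕 (SchwartzMap.toTemperedDistributionCLM (EuclideanSpace ℝ (Fin d)) ℂ volume φ) :
      𝓢'(EuclideanSpace ℝ (Fin d), ℂ)) θ =
      ∫ ξ, θ ξ * (𝓕 φ : 𝓢(EuclideanSpace ℝ (Fin d), ℂ)) ξ := by
  rw [TemperedDistribution.fourier_toTemperedDistributionCLM_eq]
  simp

theorem bracket_le (x : EuclideanSpace ℝ (Fin d)) : bracket x ≤ 1 + ‖x‖ := by
  rw [bracket]
  refine Real.sqrt_le_iff.2 ⟨by positivity, ?_⟩
  nlinarith [norm_nonneg x]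

/-- The frequency-localized pieces of a Schwartz function decay rapidly in space and frequency. -/
theorem exists_norm_conv_toTempered_le {χ : 𝓢(EuclideanSpace ℝ (Fin d), ℂ)}
    (hχ : tsupport (𝓕 χ : 𝓢(EuclideanSpace ℝ (Fin d), ℂ)) ⊆ Metric.closedBall 0 1)
    (φ : 𝓢(EuclideanSpace ℝ (Fin d), ℂ)) (N M : ℕ) :
    ∃ C : ℝ, 0 ≤ C ∧ ∀ ω x, ‖conv (SchwartzMap.toTemperedDistributionCLM
      (EuclideanSpace ℝ (Fin d)) ℂ volume φ) (modulation ω χ) x‖ ≤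
        C * (1 + ‖ω‖) ^ (-(N : ℝ)) * (1 + ‖x‖) ^ (-(M : ℝ)) := by
  set X : 𝓢(EuclideanSpace ℝ (Fin d), ℂ) := 𝓕 χ with hX
  set Φ : 𝓢(EuclideanSpace ℝ (Fin d), ℂ) := 𝓕 φ with hΦ
  -- The piece at frequency `ω`, recentred at the origin and normalized by `(1 + ‖ω‖)^N`. It stays
  -- bounded because `1 + ‖ω‖ ≤ 2 (1 + ‖ω + η‖)` for `‖η‖ ≤ 1`, so the decay of `Φ` absorbs the
  -- factor.
  let G : EuclideanSpace ℝ (Fin d) → 𝓢(EuclideanSpace ℝ (Fin d), ℂ) := fun ω ↦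
    ((1 + ‖ω‖ : ℝ) ^ N : ℂ) • schwartzMul (SchwartzMap.compSubConstCLM ℂ (-ω) Φ) X
  have hG : ∀ ω η, G ω η = ((1 + ‖ω‖ : ℝ) ^ N : ℂ) * Φ (ω + (1 : ℝ) • η) * X η := by
    intro ω η
    simp only [G, smul_apply, schwartzMul_apply, smul_eq_mul, SchwartzMap.compSubConstCLM_apply,
      sub_neg_eq_add, one_smul, mul_assoc, add_comm]
  have hGb : IsBoundedFamily G := by
    refine isBoundedFamily_of_eq_mul hχ
      (a := fun ω η ↦ ((1 + ‖ω‖ : ℝ) ^ N : ℂ) * Φ (ω + (1 : ℝ) • η))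
      (fun ω ↦ contDiff_const.mul ((Φ.smooth ⊤).comp (contDiff_const.add (contDiff_const_smul _))))
      (fun l ↦ ?_) hG
    obtain ⟨C, hC⟩ : ∃ C : ℝ, ∀ y, (1 + ‖y‖) ^ N * ‖iteratedFDeriv ℝ l Φ y‖ ≤ C :=
      ⟨_, fun y ↦ SchwartzMap.one_add_le_sup_seminorm_apply (𝕜 := ℂ) (m := (N, l)) le_rfl le_rfl Φ y⟩
    refine ⟨2 ^ N * C, fun ω η hη ↦ ?_⟩
    have h1 : ContDiff ℝ l fun η : EuclideanSpace ℝ (Fin d) ↦ Φ (ω + (1 : ℝ) • η) :=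
      (Φ.smooth l).comp (contDiff_const.add (contDiff_const_smul _))
    have h2 := iteratedFDeriv_const_smul_apply (𝕜 := ℝ) (a := ((1 + ‖ω‖ : ℝ) ^ N : ℂ)) (x := η)
      h1.contDiffAt
    simp only [Pi.smul_def, smul_eq_mul] at h2
    rw [h2, norm_smul, iteratedFDeriv_affine (Φ.smooth ⊤), one_pow, one_smul, one_smul]
    have h3 : ‖((1 + ‖ω‖ : ℝ) ^ N : ℂ)‖ = (1 + ‖ω‖) ^ N := by
      rw [norm_pow, Complex.norm_real, Real.norm_of_nonneg (by positivity)]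
    have h4 : 1 + ‖ω‖ ≤ 2 * (1 + ‖ω + η‖) := by
      have := norm_sub_le (ω + η) η
      rw [add_sub_cancel_right] at this
      linarith [norm_nonneg (ω + η)]
    rw [h3]
    calc (1 + ‖ω‖) ^ N * ‖iteratedFDeriv ℝ l Φ (ω + η)‖
        ≤ (2 * (1 + ‖ω + η‖)) ^ N * ‖iteratedFDeriv ℝ l Φ (ω + η)‖ := by gcongr
      _ = 2 ^ N * ((1 + ‖ω + η‖) ^ N * ‖iteratedFDeriv ℝ l Φ (ω + η)‖) := by rw [mul_pow]; ring
      _ ≤ 2 ^ N * C := by gcongr; exact hC _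
  obtain ⟨C, hC0, hC⟩ := (hGb.map (fourierInvCLM ℂ 𝓢(EuclideanSpace ℝ (Fin d), ℂ))).exists_decay M
  refine ⟨C, hC0, fun ω x ↦ ?_⟩
  have key : ((1 + ‖ω‖ : ℝ) ^ N : ℂ) * conv (SchwartzMap.toTemperedDistributionCLM
      (EuclideanSpace ℝ (Fin d)) ℂ volume φ) (modulation ω χ) x =
        character x ω * (𝓕⁻ (G ω) : 𝓢(EuclideanSpace ℝ (Fin d), ℂ)) x := by
    rw [conv_eq_samp, samp, fourier_toTempered_apply, SchwartzMap.fourierInv_coe,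
      fourierInv_eq_integral_character, ← integral_add_right_eq_self _ ω, ← integral_const_mul,
      ← integral_const_mul]
    refine integral_congr_ae (Eventually.of_forall fun η ↦ ?_)
    simp only
    rw [hG, charMul_apply, fourier_modulation_apply, add_sub_cancel_right, character_add_right,
      one_smul, add_comm ω η]
    ring
  have h1 := congrArg norm key
  rw [norm_mul, norm_mul, norm_character, one_mul, norm_pow, Complex.norm_real,
    Real.norm_of_nonneg (by positivity : (0 : ℝ) ≤ 1 + ‖ω‖)] at h1
  have h2 := hC ω x
  have hω : 0 < 1 + ‖ω‖ := by positivity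
  rw [Real.rpow_neg hω.le, Real.rpow_natCast, mul_right_comm, ← div_eq_mul_inv,
    le_div_iff₀ (by positivity), mul_comm]
  exact h1.le.trans h2

theorem toTempered_mem_modSpace {β : ℝ} {χ : 𝓢(EuclideanSpace ℝ (Fin d), ℂ)}
    (hχ : IsFrequencyPartition β χ) {p q : ℝ≥0∞} (hq : 0 < q) {s : ℝ} (hs : 0 ≤ s)
    (φ : 𝓢(EuclideanSpace ℝ (Fin d), ℂ)) :
    SchwartzMap.toTemperedDistributionCLM (EuclideanSpace ℝ (Fin d)) ℂ volume φ ∈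
      modSpace β χ p q s := by
  obtain ⟨M, hM⟩ := Measure.HasTemperateGrowth.exists_eLpNorm_lt_top p
    (inferInstance : (volume : Measure (EuclideanSpace ℝ (Fin d))).HasTemperateGrowth)
  obtain ⟨N, hN⟩ := exists_exponent_of_pos (d := d) hq
  obtain ⟨S, hS⟩ := exists_nat_ge s
  -- Frequency decay of order `S` absorbs the weight and of order `N` the `ℓ^q` norm; spatial decay
  -- of order `M` gives the `L^p` norm.
  obtain ⟨C, hC0, hC⟩ := exists_norm_conv_toTempered_le hχ.support_subset φ (N + S) M
  set A := eLpNorm (fun x : EuclideanSpace ℝ (Fin d) ↦ (1 + ‖x‖) ^ (-(M : ℝ))) p volume with hA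
  have hβ := hχ.pos
  -- Chosen so that `m (1 + ‖k‖) ≤ 1 + ‖βk‖`.
  set m : ℝ := min 1 β with hm
  have hm0 : 0 < m := lt_min one_pos hβ
  change eLpNorm _ q Measure.count < ∞
  refine eLpNorm_count_lt_top_of_le (t := N) (by positivity) hN
    (D := (C * m ^ (-(N : ℝ))).toNNReal * A.toNNReal) fun k ↦ ?_
  set y := β • latticePoint k with hy
  have h1 : eLpNorm (conv (SchwartzMap.toTemperedDistributionCLM (EuclideanSpace ℝ (Fin d)) ℂ
      volume φ) (modulation y χ)) p volume ≤
        ENNReal.ofReal (C * (1 + ‖y‖) ^ (-((N + S : ℕ) : ℝ))) * A := by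
    refine eLpNorm_le_mul_eLpNorm_of_ae_le_mul (Eventually.of_forall fun x ↦ ?_) p
    rw [Real.norm_of_nonneg (by positivity : (0 : ℝ) ≤ (1 + ‖x‖) ^ (-(M : ℝ)))]
    exact hC y x
  have hy0 : 0 < 1 + ‖y‖ := by positivity
  have h2 : bracket y ^ s * (C * (1 + ‖y‖) ^ (-((N + S : ℕ) : ℝ))) ≤
      C * m ^ (-(N : ℝ)) * (1 + ‖latticePoint k‖) ^ (-(N : ℝ)) := by
    have hb : bracket y ^ s ≤ (1 + ‖y‖) ^ (S : ℝ) :=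
      (Real.rpow_le_rpow (Real.sqrt_nonneg _) (bracket_le y) hs).trans
        (Real.rpow_le_rpow_of_exponent_le (by linarith [norm_nonneg y]) hS)
    have hmy : m * (1 + ‖latticePoint k‖) ≤ 1 + ‖y‖ := by
      rw [hy, norm_smul, Real.norm_of_nonneg hβ.le, mul_add, mul_one]
      exact add_le_add (min_le_left _ _) (by gcongr; exact min_le_right _ _)
    calc bracket y ^ s * (C * (1 + ‖y‖) ^ (-((N + S : ℕ) : ℝ)))
        ≤ (1 + ‖y‖) ^ (S : ℝ) * (C * (1 + ‖y‖) ^ (-((N + S : ℕ) : ℝ))) := by gcongr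
      _ = C * (1 + ‖y‖) ^ (-(N : ℝ)) := by
          rw [mul_left_comm, ← Real.rpow_add hy0]; congr 2; push_cast; ring
      _ ≤ C * (m * (1 + ‖latticePoint k‖)) ^ (-(N : ℝ)) := by
          gcongr ?_ * ?_
          exact Real.rpow_le_rpow_of_nonpos (by positivity) hmy (by simp)
      _ = _ := by rw [Real.mul_rpow hm0.le (by positivity), mul_assoc]
  calc ENNReal.ofReal (bracket y ^ s) * eLpNorm (conv (SchwartzMap.toTemperedDistributionCLM
        (EuclideanSpace ℝ (Fin d)) ℂ volume φ) (modulation y χ)) p volume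
      ≤ ENNReal.ofReal (bracket y ^ s) *
        (ENNReal.ofReal (C * (1 + ‖y‖) ^ (-((N + S : ℕ) : ℝ))) * A) := by gcongr
    _ = ENNReal.ofReal (bracket y ^ s * (C * (1 + ‖y‖) ^ (-((N + S : ℕ) : ℝ)))) * A := by
        rw [← mul_assoc, ENNReal.ofReal_mul
          (Real.rpow_nonneg (show 0 ≤ bracket y from Real.sqrt_nonneg _) _)]
    _ ≤ ENNReal.ofReal (C * m ^ (-(N : ℝ)) * (1 + ‖latticePoint k‖) ^ (-(N : ℝ))) * A := by gcongr
    _ = _ := by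
        rw [ENNReal.ofReal_mul (by positivity), ENNReal.coe_mul, ENNReal.coe_toNNReal hM.ne,
          mul_right_comm]
        rfl

/-! ### The two parts of the operator, on pieces and on Schwartz functions. -/

theorem fourierInv_reflTranslate (x : EuclideanSpace ℝ (Fin d))
    (ψ : 𝓢(EuclideanSpace ℝ (Fin d), ℂ)) :
    (𝓕⁻ (reflTranslate x ψ) : 𝓢(EuclideanSpace ℝ (Fin d), ℂ)) = charMul x (𝓕 ψ) := by
  rw [reflTranslate_eq_fourier, FourierTransform.fourierInv_fourier_eq]

theorem conv_fourierMultiplier {g : EuclideanSpace ℝ (Fin d) → ℂ} (hg : g.HasTemperateGrowth)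
    (f : 𝓢'(EuclideanSpace ℝ (Fin d), ℂ)) (ψ : 𝓢(EuclideanSpace ℝ (Fin d), ℂ)) :
    conv (TemperedDistribution.fourierMultiplierCLM ℂ g f) ψ =
      samp (𝓕 f) (SchwartzMap.smulLeftCLM ℂ g (𝓕 ψ)) := by
  ext x
  have e : SchwartzMap.smulLeftCLM ℂ g (charMul x (𝓕 ψ)) =
      charMul x (SchwartzMap.smulLeftCLM ℂ g (𝓕 ψ)) := by
    ext ξ
    simp only [SchwartzMap.smulLeftCLM_apply_apply hg, charMul_apply, smul_eq_mul]
    ring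
  rw [conv, TemperedDistribution.fourierMultiplierCLM_apply_apply, fourierInv_reflTranslate, e]
  rfl

/-- Testing the series that defines `g` on `reflTranslate x ψ` exhibits `conv g ψ` as a
superposition of translates of one function, the form needed for `eLpNorm_le_of_hasSum_translates`.
-/
theorem hasSum_conv {F g : 𝓢'(EuclideanSpace ℝ (Fin d), ℂ)}
    {ρ : 𝓢(EuclideanSpace ℝ (Fin d), ℂ)} {c : (Fin d → ℤ) → ℂ}
    (hg : ∀ ψ : 𝓢(EuclideanSpace ℝ (Fin d), ℂ), HasSum (fun n ↦ c n *
      samp F (schwartzMul ρ (𝓕⁻ ψ)) ((1 / 8 : ℝ) • latticePoint n)) (g ψ))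
    (ψ : 𝓢(EuclideanSpace ℝ (Fin d), ℂ)) (x : EuclideanSpace ℝ (Fin d)) :
    HasSum (fun n ↦ c n * samp F (schwartzMul ρ (𝓕 ψ)) (x + (1 / 8 : ℝ) • latticePoint n))
      (conv g ψ x) := by
  have e : schwartzMul ρ (charMul x (𝓕 ψ)) = charMul x (schwartzMul ρ (𝓕 ψ)) := by
    ext ξ
    simp only [schwartzMul_apply, charMul_apply]
    ring
  have h := hg (reflTranslate x ψ)
  rw [fourierInv_reflTranslate, e] at h
  simp only [samp_charMul] at h
  simp only [add_comm x]
  exact h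

/-- The recentred symbols `ρ (ω + 8 ·)` have derivatives bounded uniformly in `ω`, because those of
`ρ` are bounded on the whole space. -/
theorem exists_eLpNorm_samp_schwartzMul_le (ρ : 𝓢(EuclideanSpace ℝ (Fin d), ℂ)) {p : ℝ≥0∞}
    (hp : 0 < p) :
    ∃ C : ℝ≥0, ∀ (F : 𝓢'(EuclideanSpace ℝ (Fin d), ℂ)) (Θ : 𝓢(EuclideanSpace ℝ (Fin d), ℂ))
      (ω : EuclideanSpace ℝ (Fin d)), (∀ ξ, Θ ξ ≠ 0 → ‖ξ - ω‖ ≤ 3) →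
      eLpNorm (samp F (schwartzMul ρ Θ)) p volume ≤ C * eLpNorm (samp F Θ) p volume := by
  obtain ⟨C, hC⟩ := exists_eLpNorm_samp_mul_le (ι := EuclideanSpace ℝ (Fin d))
    (a := fun ω η ↦ ρ (ω + (8 : ℝ) • η))
    (fun ω ↦ (ρ.smooth ⊤).comp (contDiff_const.add (contDiff_const_smul _)))
    (fun l ↦ by
      obtain ⟨B, hB⟩ : ∃ B : ℝ, ∀ y, ‖iteratedFDeriv ℝ l ρ y‖ ≤ B :=
        ⟨_, fun y ↦ by simpa using SchwartzMap.le_seminorm ℂ 0 l ρ y⟩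
      refine ⟨8 ^ l * B, fun ω x _ ↦ ?_⟩
      rw [iteratedFDeriv_affine (ρ.smooth ⊤), norm_smul]
      have h8 : ‖(8 : ℝ) ^ l‖ = 8 ^ l := by simp
      rw [h8]
      gcongr
      exact hB _) hp
  refine ⟨C, fun F Θ ω hΘ ↦ hC ω F Θ _ ω hΘ fun ξ ↦ ?_⟩
  have hξ : ω + (8 : ℝ) • (1 / 8 : ℝ) • (ξ - ω) = ξ := by
    rw [smul_smul]; norm_num
  simp only [schwartzMul_apply, hξ]

theorem samp_toTempered_apply (φ Θ : 𝓢(EuclideanSpace ℝ (Fin d), ℂ))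
    (x : EuclideanSpace ℝ (Fin d)) :
    samp (𝓕 (SchwartzMap.toTemperedDistributionCLM (EuclideanSpace ℝ (Fin d)) ℂ volume φ)) Θ x =
      ∫ ξ, character x ξ * Θ ξ * (𝓕 φ : 𝓢(EuclideanSpace ℝ (Fin d), ℂ)) ξ := by
  rw [samp, fourier_toTempered_apply]
  simp only [charMul_apply]

theorem continuous_character (ω : EuclideanSpace ℝ (Fin d)) : Continuous (character ω) :=
  (hasTemperateGrowth_character ω).1.continuous

theorem integrable_schwartz_mul (Θ Φ : 𝓢(EuclideanSpace ℝ (Fin d), ℂ)) :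
    Integrable fun ξ ↦ Θ ξ * Φ ξ := by
  have h := (schwartzMul Θ Φ).integrable (μ := volume)
  exact h.congr (Eventually.of_forall fun ξ ↦ schwartzMul_apply _ _ _)

theorem integrable_mul_schwartz {m : EuclideanSpace ℝ (Fin d) → ℂ} (hm : Continuous m) {B : ℝ}
    (hB : ∀ ξ, ‖m ξ‖ ≤ B) {h : EuclideanSpace ℝ (Fin d) → ℂ} (hh : Integrable h) :
    Integrable fun ξ ↦ m ξ * h ξ :=
  hh.bdd_mul hm.aestronglyMeasurable (Eventually.of_forall hB)

/-- Fubini's theorem for the multiplier operator tested against a Schwartz function. -/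
theorem integral_multiplier_mul {σ : EuclideanSpace ℝ (Fin d) → ℂ} (hσ : Continuous σ) {B : ℝ}
    (hB : ∀ ξ, ‖σ ξ‖ ≤ B) (φ ψ : 𝓢(EuclideanSpace ℝ (Fin d), ℂ)) :
    ∫ x, multiplier σ φ x * ψ x = ∫ ξ, σ ξ * ((𝓕⁻ ψ : 𝓢(EuclideanSpace ℝ (Fin d), ℂ)) ξ *
      (𝓕 φ : 𝓢(EuclideanSpace ℝ (Fin d), ℂ)) ξ) := by
  have hint : Integrable (Function.uncurry fun x ξ : EuclideanSpace ℝ (Fin d) ↦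
      σ ξ * (𝓕 φ : 𝓢(EuclideanSpace ℝ (Fin d), ℂ)) ξ * character ξ x * ψ x)
      (volume.prod volume) := by
    have h1 := (ψ.integrable (μ := volume)).mul_prod (integrable_mul_schwartz hσ hB
      ((𝓕 φ : 𝓢(EuclideanSpace ℝ (Fin d), ℂ)).integrable (μ := volume)))
    have hc : Continuous fun z : EuclideanSpace ℝ (Fin d) × EuclideanSpace ℝ (Fin d) ↦
        character z.2 z.1 := by
      unfold character; fun_prop
    have h2 := h1.bdd_mul (c := 1) hc.aestronglyMeasurable
      (Eventually.of_forall fun z ↦ (norm_character _ _).le)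
    refine h2.congr (Eventually.of_forall fun z ↦ ?_)
    simp only [Function.uncurry]
    ring
  simp only [multiplier, ← integral_mul_const]
  rw [integral_integral_swap hint]
  refine integral_congr_ae (Eventually.of_forall fun ξ ↦ ?_)
  simp only
  rw [SchwartzMap.fourierInv_coe, fourierInv_eq_integral_character, mul_comm (∫ _, _ ∂_),
    ← mul_assoc, ← integral_const_mul]
  refine integral_congr_ae (Eventually.of_forall fun x ↦ ?_)
  simp only
  rw [character_comm ξ x]
  ring

/-- Shows that the sampling series is the multiplier `m` on Schwartz functions: the Fourier series
of `m (8 ·)` represents `m` on the support of `ρ`, and `m ρ = m` since `ρ = 1` where `m` is nonzero.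
-/
theorem hasSum_integral_samples {m : EuclideanSpace ℝ (Fin d) → ℂ}
    {ρ : 𝓢(EuclideanSpace ℝ (Fin d), ℂ)} (hρ1 : ∀ ξ, ‖ξ‖ ≤ 1 → ρ ξ = 1)
    (hρ3 : ∀ ξ, ρ ξ ≠ 0 → ‖ξ‖ ≤ 3) (hm : ∀ ξ, 1 < ‖ξ‖ → m ξ = 0) (hmc : Continuous m)
    (hc : Summable fun n ↦ ‖𝓕 (fun η : EuclideanSpace ℝ (Fin d) ↦ m ((8 : ℝ) • η))
      (latticePoint n)‖) (φ θ : 𝓢(EuclideanSpace ℝ (Fin d), ℂ)) :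
    HasSum (fun n ↦ 𝓕 (fun η : EuclideanSpace ℝ (Fin d) ↦ m ((8 : ℝ) • η)) (latticePoint n) *
      samp (𝓕 (SchwartzMap.toTemperedDistributionCLM (EuclideanSpace ℝ (Fin d)) ℂ volume φ))
        (schwartzMul ρ θ) ((1 / 8 : ℝ) • latticePoint n))
      (∫ ξ, m ξ * (θ ξ * (𝓕 φ : 𝓢(EuclideanSpace ℝ (Fin d), ℂ)) ξ)) := by
  set c := fun n ↦ 𝓕 (fun η : EuclideanSpace ℝ (Fin d) ↦ m ((8 : ℝ) • η)) (latticePoint n) with hcdef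
  set Φ : 𝓢(EuclideanSpace ℝ (Fin d), ℂ) := 𝓕 φ with hΦ
  have hsum : ∀ ξ, HasSum (fun n ↦ c n *
      (character ((1 / 8 : ℝ) • latticePoint n) ξ * schwartzMul ρ θ ξ * Φ ξ))
      (m ξ * (θ ξ * Φ ξ)) := by
    intro ξ
    by_cases hξ : ‖ξ‖ ≤ 3
    · have h1 := hasSum_fourier_latticePoint (G := fun η ↦ m ((8 : ℝ) • η))
        (hmc.comp (continuous_const_smul _)) (fun η hη ↦ hm _ (by
          rw [norm_smul, Real.norm_of_nonneg (by norm_num)]; linarith)) hc.of_norm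
        (η := (1 / 8 : ℝ) • ξ) (by
          rw [norm_smul, Real.norm_of_nonneg (by norm_num)]; linarith)
      have h2 := h1.mul_right (ρ ξ * θ ξ * Φ ξ)
      have h8 : (8 : ℝ) • (1 / 8 : ℝ) • ξ = ξ := by rw [smul_smul]; norm_num
      simp only [h8] at h2
      have e : m ξ * (ρ ξ * θ ξ * Φ ξ) = m ξ * (θ ξ * Φ ξ) := by
        by_cases h : ‖ξ‖ ≤ 1
        · rw [hρ1 ξ h, one_mul]
        · rw [hm ξ (not_le.1 h), zero_mul, zero_mul]
      rw [e] at h2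
      refine (congrArg (fun u ↦ HasSum u _) (funext fun n ↦ ?_)).mpr h2
      rw [character_smul_left, schwartzMul_apply, mul_assoc, mul_assoc]
      simp only [hcdef, mul_assoc]
    · have h0 : ρ ξ = 0 := by
        by_contra h
        exact hξ (hρ3 ξ h)
      simp [schwartzMul_apply, h0, hm ξ (by linarith)]
  have hint : Integrable fun ξ ↦ schwartzMul ρ θ ξ * Φ ξ := integrable_schwartz_mul _ _
  have h1 : ∀ n, Integrable fun ξ ↦ c n *
      (character ((1 / 8 : ℝ) • latticePoint n) ξ * schwartzMul ρ θ ξ * Φ ξ) := by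
    intro n
    simp only [mul_assoc]
    exact (integrable_mul_schwartz (continuous_character _) (B := 1)
      (fun ξ ↦ (norm_character _ _).le) hint).const_mul _
  have h2 := hasSum_integral_of_summable_integral_norm h1 (by
    have e : ∀ n, (∫ ξ, ‖c n * (character ((1 / 8 : ℝ) • latticePoint n) ξ *
        schwartzMul ρ θ ξ * Φ ξ)‖) = ‖c n‖ * ∫ ξ, ‖schwartzMul ρ θ ξ * Φ ξ‖ := by
      intro n
      rw [← integral_const_mul]
      simp only [norm_mul, norm_character, one_mul]
    simp only [e]
    exact hc.mul_right _)
  simp only [fun ξ ↦ (hsum ξ).tsum_eq, integral_const_mul] at h2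
  simp only [samp_toTempered_apply]
  exact h2

/-! ### Extension theorem for the split symbol. -/

/-- A Fourier multiplier whose symbol is the sum of `exp (i P)`, where `P` has bounded
derivatives of order at least two, and of a continuous function supported in the unit ball with
`ℓ^r` summable Fourier samples, extends to a bounded operator on modulation spaces. -/
theorem multiplierExtends_cexp_add {β : ℝ} {χ : 𝓢(EuclideanSpace ℝ (Fin d), ℂ)}
    (hχ : IsFrequencyPartition β χ) {p q : ℝ≥0∞} (hp : 0 < p) (hq : 0 < q) {s : ℝ} (hs : 0 ≤ s)
    {P : EuclideanSpace ℝ (Fin d) → ℝ} (hP : P.HasTemperateGrowth)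
    (hb : ∀ j : ℕ, 2 ≤ j → ∃ C : ℝ, ∀ ξ, ‖iteratedFDeriv ℝ j P ξ‖ ≤ C)
    {m : EuclideanSpace ℝ (Fin d) → ℂ} (hmc : Continuous m) (hm : ∀ ξ, 1 < ‖ξ‖ → m ξ = 0)
    (hc : Summable fun n ↦ ‖𝓕 (fun η : EuclideanSpace ℝ (Fin d) ↦ m ((8 : ℝ) • η))
      (latticePoint n)‖ ^ subadditiveExponent p) :
    MultiplierExtends (fun ξ ↦ Complex.exp ((P ξ : ℂ) * Complex.I) + m ξ) β χ p q s := by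
  classical
  set c := fun n ↦ 𝓕 (fun η : EuclideanSpace ℝ (Fin d) ↦ m ((8 : ℝ) • η)) (latticePoint n) with hcdef
  set r := subadditiveExponent p with hr
  have hr0 : 0 < r := subadditiveExponent_pos hp
  have hr1 : r ≤ 1 := subadditiveExponent_le_one p
  -- `ℓ^r ⊆ ℓ^1` for `r ≤ 1`: all but finitely many `c n` have modulus at most one.
  have hc1 : Summable fun n ↦ ‖c n‖ := by
    refine Summable.of_norm_bounded_eventually hc ?_
    have h0 := (hc.tendsto_cofinite_zero).eventually (gt_mem_nhds one_pos)
    filter_upwards [h0] with n hn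
    rw [norm_norm]
    have hle : ‖c n‖ ≤ 1 := by
      by_contra h
      exact absurd (Real.one_le_rpow (not_le.1 h).le hr0.le) (not_le.2 hn)
    simpa using Real.rpow_le_rpow_of_exponent_ge_of_imp (norm_nonneg _) hle hr1
      (fun _ h ↦ absurd h one_ne_zero)
  obtain ⟨K, hK1, hK3⟩ := hχ.exists_finset
  set ρ : 𝓢(EuclideanSpace ℝ (Fin d), ℂ) :=
    ∑ k ∈ K, 𝓕 (modulation (β • latticePoint k) χ) with hρ
  set E : EuclideanSpace ℝ (Fin d) → ℂ := fun ξ ↦ Complex.exp ((P ξ : ℂ) * Complex.I) with hE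
  have hEt : E.HasTemperateGrowth := hasTemperateGrowth_cexp hP
  have hsupp : ∀ (k : Fin d → ℤ) (ξ : EuclideanSpace ℝ (Fin d)),
      (𝓕 (modulation (β • latticePoint k) χ) : 𝓢(EuclideanSpace ℝ (Fin d), ℂ)) ξ ≠ 0 →
        ‖ξ - β • latticePoint k‖ ≤ 3 := fun k ξ h ↦ (hχ.norm_sub_le h).trans (by norm_num)
  -- The low-frequency part is a finite sum of pieces, each in `L^p` and band-limited, hence
  -- bounded.
  have hbdd : ∀ f ∈ modSpace β χ p q s, ∃ B : ℝ, ∀ x, ‖samp (𝓕 f) ρ x‖ ≤ B := by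
    intro f hf
    have h1 : ∀ k : Fin d → ℤ, ∃ B : ℝ, ∀ x,
        ‖samp (𝓕 f) (𝓕 (modulation (β • latticePoint k) χ)) x‖ ≤ B := fun k ↦
      exists_norm_samp_le (𝓕 f) (hsupp k) hp (by
        rw [← conv_eq_samp]; exact eLpNorm_conv_lt_top hq hf k)
    choose B hB using h1
    refine ⟨∑ k ∈ K, B k, fun x ↦ ?_⟩
    rw [hρ, samp_sum_right]
    exact norm_sum_le_of_le _ fun k _ ↦ hB k x
  have hg : ∀ f : modSpace β χ p q s, ∃ g : 𝓢'(EuclideanSpace ℝ (Fin d), ℂ),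
      ∀ ψ : 𝓢(EuclideanSpace ℝ (Fin d), ℂ), HasSum (fun n ↦ c n *
        samp (𝓕 (f : 𝓢'(EuclideanSpace ℝ (Fin d), ℂ))) (schwartzMul ρ (𝓕⁻ ψ))
          ((1 / 8 : ℝ) • latticePoint n)) (g ψ) := fun f ↦
    exists_hasSum_samp_schwartzMul hK3 hc1 (hbdd f f.2)
  choose g hg using hg
  obtain ⟨C₁, hC₁⟩ := exists_eLpNorm_samp_cexp_le hP hb hp
  obtain ⟨C₂, hC₂⟩ := exists_eLpNorm_samp_schwartzMul_le ρ hp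
  set A : ℝ≥0∞ := (∑' n, ‖c n‖ₑ ^ r) ^ (1 / r) with hA
  have hAtop : A < ∞ := by
    refine ENNReal.rpow_lt_top_of_nonneg (by positivity) ?_
    have e : ∀ n, ‖c n‖ₑ ^ r = ENNReal.ofReal (‖c n‖ ^ r) := fun n ↦ by
      rw [← ofReal_norm, ENNReal.ofReal_rpow_of_nonneg (norm_nonneg _) hr0.le]
    simp only [e]
    exact hc.tsum_ofReal_ne_top
  set C : ℝ≥0∞ := ENNReal.LpAddConst p * (C₁ + A * C₂) with hC
  have hCtop : C ≠ ∞ := (ENNReal.mul_lt_top (ENNReal.LpAddConst_lt_top p)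
    (ENNReal.add_lt_top.2 ⟨ENNReal.coe_lt_top, ENNReal.mul_lt_top hAtop ENNReal.coe_lt_top⟩)).ne
  have hbound : ∀ f : modSpace β χ p q s, modNorm β χ p q s
      (TemperedDistribution.fourierMultiplierCLM ℂ E f + g f) ≤
        C.toNNReal * modNorm β χ p q s f := by
    intro f
    refine modNorm_le_of_forall_le fun k ↦ ?_
    set X := modulation (β • latticePoint k) χ with hX
    have hadd : conv (TemperedDistribution.fourierMultiplierCLM ℂ E f + g f) X =
        conv (TemperedDistribution.fourierMultiplierCLM ℂ E f) X + conv (g f) X := by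
      ext x; rfl
    rw [hadd, ENNReal.coe_toNNReal hCtop]
    refine (eLpNorm_add_le' (continuous_conv _ _).aestronglyMeasurable
      (continuous_conv _ _).aestronglyMeasurable p).trans ?_
    rw [hC, mul_assoc]
    gcongr
    rw [add_mul]
    refine add_le_add ?_ ?_
    · rw [conv_fourierMultiplier hEt, conv_eq_samp]
      exact hC₁ _ _ _ (hsupp k)
    · refine (eLpNorm_le_of_hasSum_translates hp (continuous_samp _ _)
        (hasSum_conv (hg f) X)).trans ?_
      rw [mul_assoc, conv_eq_samp]
      gcongr
      exact hC₂ _ _ _ (hsupp k)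
  refine ⟨{ toFun := fun f ↦ ⟨TemperedDistribution.fourierMultiplierCLM ℂ E f + g f,
              (hbound f).trans_lt (ENNReal.mul_lt_top ENNReal.coe_lt_top f.2)⟩
            map_add' := fun f₁ f₂ ↦ Subtype.ext ?_
            map_smul' := fun a f ↦ Subtype.ext ?_ }, ⟨C.toNNReal, hbound⟩, fun φ ↦
          ⟨toTempered_mem_modSpace hχ hq hs φ, fun ψ ↦ ?_⟩⟩
  -- `g` comes from a choice; its linearity is forced by uniqueness of sums.
  · have h : g (f₁ + f₂) = g f₁ + g f₂ := by
      ext ψ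
      refine (hg (f₁ + f₂) ψ).unique ?_
      have h1 := (hg f₁ ψ).add (hg f₂ ψ)
      simp only [← mul_add, ← samp_add_left] at h1
      rw [Submodule.coe_add, FourierTransform.fourier_add]
      exact h1
    simp only [Submodule.coe_add, map_add, h]
    abel
  · have h : g (a • f) = a • g f := by
      ext ψ
      refine (hg (a • f) ψ).unique ?_
      refine (congrArg (fun u ↦ HasSum u _) (funext fun n ↦ ?_)).mpr
        ((hg f ψ).mul_left a)
      rw [Submodule.coe_smul, FourierTransform.fourier_smul, samp_smul_left, mul_left_comm]
    simp only [Submodule.coe_smul, map_smul, h, RingHom.id_apply, smul_add]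
  · set f : modSpace β χ p q s := ⟨_, toTempered_mem_modSpace hχ hq hs φ⟩ with hf
    have hEb : ∀ ξ, ‖E ξ‖ ≤ 1 := fun ξ ↦ (Complex.norm_exp_ofReal_mul_I _).le
    have hEc : Continuous E := hEt.1.continuous
    obtain ⟨B, hB⟩ := hmc.bounded_above_of_compact_support
      (HasCompactSupport.intro (isCompact_closedBall (0 : EuclideanSpace ℝ (Fin d)) 1)
        fun ξ hξ ↦ hm ξ (by simpa using hξ))
    have h1 : (g f) ψ = ∫ ξ, m ξ * ((𝓕⁻ ψ : 𝓢(EuclideanSpace ℝ (Fin d), ℂ)) ξ *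
        (𝓕 φ : 𝓢(EuclideanSpace ℝ (Fin d), ℂ)) ξ) :=
      (hg f ψ).unique (hasSum_integral_samples hK1 hK3 hm hmc hc1 φ (𝓕⁻ ψ))
    have h2 : (TemperedDistribution.fourierMultiplierCLM ℂ E
        (f : 𝓢'(EuclideanSpace ℝ (Fin d), ℂ))) ψ =
        ∫ ξ, E ξ * ((𝓕⁻ ψ : 𝓢(EuclideanSpace ℝ (Fin d), ℂ)) ξ *
        (𝓕 φ : 𝓢(EuclideanSpace ℝ (Fin d), ℂ)) ξ) := by
      rw [TemperedDistribution.fourierMultiplierCLM_apply_apply]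
      refine (fourier_toTempered_apply φ _).trans ?_
      simp only [SchwartzMap.smulLeftCLM_apply_apply hEt, smul_eq_mul, mul_assoc]
    have hint := integrable_schwartz_mul (𝓕⁻ ψ : 𝓢(EuclideanSpace ℝ (Fin d), ℂ)) (𝓕 φ)
    refine Eq.trans ?_ (integral_multiplier_mul (σ := fun ξ ↦ E ξ + m ξ) (hEc.add hmc)
      (B := 1 + B) (fun ξ ↦ norm_add_le_of_le (hEb ξ) (hB ξ)) φ ψ).symm
    simp only [add_mul]
    exact ((integral_add (integrable_mul_schwartz hEc hEb hint)
      (integrable_mul_schwartz hmc hB hint)).trans (congrArg₂ (· + ·) h2.symm h1.symm)).symm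

/-! ### The smooth phase. -/

/-- The function `|ξ|^α`, with its singularity at the origin removed. -/
def phase (α : ℝ) (ξ : EuclideanSpace ℝ (Fin d)) : ℝ :=
  (1 - bump d ξ) * ‖ξ‖ ^ α

theorem phase_eq_zero (α : ℝ) {ξ : EuclideanSpace ℝ (Fin d)} (h : ‖ξ‖ ≤ 3 / 8) :
    phase α ξ = 0 := by
  rw [phase, (bump d).one_of_mem_closedBall (by simpa [bump] using h), sub_self, zero_mul]

theorem phase_eq_rpow (α : ℝ) {ξ : EuclideanSpace ℝ (Fin d)} (h : 7 / 16 < ‖ξ‖) :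
    phase α ξ = ‖ξ‖ ^ α := by
  rw [phase, (bump d).zero_of_le_dist (by simpa [bump] using h.le), sub_zero, one_mul]

theorem contDiff_phase (α : ℝ) :
    ContDiff ℝ (⊤ : ℕ∞) (phase α : EuclideanSpace ℝ (Fin d) → ℝ) := by
  rw [contDiff_iff_contDiffAt]
  intro ξ
  by_cases h : ‖ξ‖ < 3 / 8
  · have h0 : (phase α : EuclideanSpace ℝ (Fin d) → ℝ) =ᶠ[𝓝 ξ] fun _ ↦ 0 := by
      filter_upwards [(isOpen_lt continuous_norm continuous_const).mem_nhds h] with η hη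
      exact phase_eq_zero α (le_of_lt hη)
    exact contDiffAt_const.congr_of_eventuallyEq h0
  · have hξ : ξ ≠ 0 := fun h0 ↦ h (by rw [h0, norm_zero]; norm_num)
    exact (contDiffAt_const.sub (bump d).contDiff.contDiffAt).mul
      ((contDiffAt_norm ℝ hξ).rpow_const_of_ne (norm_ne_zero_iff.2 hξ))

/-- Near any point at distance larger than `7 t / 16` from the origin, `|ξ|^α` is a rescaling of
the smooth function `phase α`. -/
theorem rpow_norm_eventuallyEq (α : ℝ) {t : ℝ} (ht : 0 < t) {ξ : EuclideanSpace ℝ (Fin d)}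
    (h : 7 / 16 * t < ‖ξ‖) :
    (fun η : EuclideanSpace ℝ (Fin d) ↦ ‖η‖ ^ α) =ᶠ[𝓝 ξ] fun η ↦ t ^ α * phase α (t⁻¹ • η) := by
  filter_upwards [(isOpen_lt continuous_const continuous_norm).mem_nhds h] with η hη
  have h1 : 7 / 16 < ‖t⁻¹ • η‖ := by
    rw [norm_smul, norm_inv, Real.norm_of_nonneg ht.le, inv_mul_eq_div, lt_div_iff₀ ht]
    exact hη
  rw [phase_eq_rpow α h1, norm_smul, norm_inv, Real.norm_of_nonneg ht.le,
    Real.mul_rpow (by positivity) (norm_nonneg _), Real.inv_rpow ht.le, ← mul_assoc,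
    mul_inv_cancel₀ (by positivity), one_mul]

theorem iteratedFDeriv_comp_smul_of_eventuallyEq {F : Type*} [NormedAddCommGroup F]
    [NormedSpace ℝ F] {f G : EuclideanSpace ℝ (Fin d) → F} (hG : ContDiff ℝ (⊤ : ℕ∞) G) {t : ℝ}
    {ξ : EuclideanSpace ℝ (Fin d)} (h : f =ᶠ[𝓝 ξ] fun η ↦ G (t • η)) (j : ℕ) :
    iteratedFDeriv ℝ j f ξ = t ^ j • iteratedFDeriv ℝ j G (t • ξ) := by
  rw [(h.iteratedFDeriv ℝ j).eq_of_nhds,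
    iteratedFDeriv_comp_const_smul t (hG.of_le (by exact_mod_cast le_top))]

theorem exists_norm_iteratedFDeriv_le_of_norm_le {F : Type*} [NormedAddCommGroup F]
    [NormedSpace ℝ F] {G : EuclideanSpace ℝ (Fin d) → F} (hG : ContDiff ℝ (⊤ : ℕ∞) G) (R : ℝ)
    (j : ℕ) : ∃ C : ℝ, 0 ≤ C ∧ ∀ ξ, ‖ξ‖ ≤ R → ‖iteratedFDeriv ℝ j G ξ‖ ≤ C := by
  obtain ⟨C, hC⟩ := (isCompact_closedBall (0 : EuclideanSpace ℝ (Fin d)) R).exists_bound_of_continuousOn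
    (hG.continuous_iteratedFDeriv (m := j) (by exact_mod_cast le_top)).continuousOn
  exact ⟨max C 0, le_max_right _ _, fun ξ hξ ↦ (hC ξ (by simpa using hξ)).trans (le_max_left _ _)⟩

/-- Homogeneity: rescaling by `t = ‖ξ‖` moves `ξ` to the unit sphere, where compactness bounds the
derivatives; the factors `t^α` and `t^{-j}` give the exponent. -/
theorem exists_norm_iteratedFDeriv_phase_le (α : ℝ) (j : ℕ) :
    ∃ C : ℝ, 0 ≤ C ∧ ∀ ξ : EuclideanSpace ℝ (Fin d), 1 ≤ ‖ξ‖ →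
      ‖iteratedFDeriv ℝ j (phase α) ξ‖ ≤ C * ‖ξ‖ ^ (α - j) := by
  obtain ⟨C, hC0, hC⟩ := exists_norm_iteratedFDeriv_le_of_norm_le (contDiff_phase (d := d) α) 1 j
  refine ⟨C, hC0, fun ξ hξ ↦ ?_⟩
  set t := ‖ξ‖ with ht
  have ht0 : 0 < t := by linarith
  have h1 : (phase α : EuclideanSpace ℝ (Fin d) → ℝ) =ᶠ[𝓝 ξ]
      fun η ↦ (t ^ α • phase α) (t⁻¹ • η) := by
    have h2 := rpow_norm_eventuallyEq α ht0 (ξ := ξ) (by linarith)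
    refine EventuallyEq.trans ?_ h2
    have h3 : 7 / 16 < ‖ξ‖ := by linarith
    filter_upwards [(isOpen_lt continuous_const continuous_norm).mem_nhds h3] with η hη
    exact phase_eq_rpow α hη
  rw [iteratedFDeriv_comp_smul_of_eventuallyEq (G := t ^ α • phase α)
      (contDiff_const.smul (contDiff_phase α)) h1,
    iteratedFDeriv_const_smul_apply
      ((contDiff_phase α).of_le (by exact_mod_cast le_top)).contDiffAt, norm_smul, norm_smul]
  have h4 := hC (t⁻¹ • ξ) (by
    rw [norm_smul, norm_inv, Real.norm_of_nonneg ht0.le, ← ht, inv_mul_cancel₀ ht0.ne'])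
  have h5 : ‖t⁻¹ ^ j‖ * ‖t ^ α‖ = t ^ (α - j) := by
    rw [Real.rpow_sub ht0, Real.rpow_natCast, Real.norm_of_nonneg (by positivity),
      Real.norm_of_nonneg (by positivity), inv_pow, div_eq_inv_mul]
  rw [← mul_assoc, h5, mul_comm C]
  gcongr

/-- For `j ≥ 2` the exponent `α - j` is nonpositive; this is what `α ≤ 2` is for. -/
theorem exists_norm_iteratedFDeriv_phase_le_const {α : ℝ} (hα : α ≤ 2) {j : ℕ} (hj : 2 ≤ j) :
    ∃ C : ℝ, ∀ ξ : EuclideanSpace ℝ (Fin d), ‖iteratedFDeriv ℝ j (phase α) ξ‖ ≤ C := by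
  obtain ⟨C, hC0, hC⟩ := exists_norm_iteratedFDeriv_phase_le (d := d) α j
  obtain ⟨B, hB0, hB⟩ := exists_norm_iteratedFDeriv_le_of_norm_le (contDiff_phase (d := d) α) 1 j
  refine ⟨C + B, fun ξ ↦ ?_⟩
  rcases le_total ‖ξ‖ 1 with h | h
  · linarith [hB ξ h]
  · have hj' : (2 : ℝ) ≤ j := by exact_mod_cast hj
    have h1 : ‖ξ‖ ^ (α - j) ≤ 1 := Real.rpow_le_one_of_one_le_of_nonpos h (by linarith)
    nlinarith [hC ξ h]

theorem hasTemperateGrowth_phase {α : ℝ} (hα : α ≤ 2) :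
    (phase α : EuclideanSpace ℝ (Fin d) → ℝ).HasTemperateGrowth := by
  refine ⟨contDiff_phase α, fun j ↦ ?_⟩
  obtain ⟨C, hC0, hC⟩ := exists_norm_iteratedFDeriv_phase_le (d := d) α j
  obtain ⟨B, hB0, hB⟩ := exists_norm_iteratedFDeriv_le_of_norm_le (contDiff_phase (d := d) α) 1 j
  refine ⟨2, C + B, fun ξ ↦ ?_⟩
  rcases le_total ‖ξ‖ 1 with h | h
  · refine (hB ξ h).trans ?_
    have : 1 ≤ (1 + ‖ξ‖) ^ 2 := one_le_pow₀ (by linarith [norm_nonneg ξ])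
    nlinarith
  · have h1 : ‖ξ‖ ^ (α - j) ≤ (1 + ‖ξ‖) ^ 2 := by
      calc ‖ξ‖ ^ (α - j) ≤ ‖ξ‖ ^ (2 : ℝ) :=
            Real.rpow_le_rpow_of_exponent_le h (by linarith [(Nat.cast_nonneg j : (0 : ℝ) ≤ j)])
        _ = ‖ξ‖ ^ 2 := by norm_cast
        _ ≤ (1 + ‖ξ‖) ^ 2 := by gcongr; linarith
    calc ‖iteratedFDeriv ℝ j (phase α) ξ‖ ≤ C * ‖ξ‖ ^ (α - j) := hC ξ h
      _ ≤ (C + B) * (1 + ‖ξ‖) ^ 2 := by gcongr; linarith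

/-- Linear smallness in `ε`: at order zero `|exp(iεt) - 1| ≤ ε|t|`, and at order `i ≥ 1` the outer
derivative has size `ε^i ≤ ε`. It is applied with `ε = ‖ξ‖^α`. -/
theorem exists_norm_iteratedFDeriv_cexp_sub_one_le {Q : EuclideanSpace ℝ (Fin d) → ℝ}
    (hQ : ContDiff ℝ (⊤ : ℕ∞) Q) (j : ℕ) :
    ∃ C : ℝ, ∀ ε : ℝ, 0 < ε → ε ≤ 1 → ∀ z, ‖z‖ ≤ 1 →
      ‖iteratedFDeriv ℝ j (fun z ↦ Complex.exp ((ε * Q z : ℝ) * Complex.I) - 1) z‖ ≤ C * ε := by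
  choose B hB0 hB using fun i ↦ exists_norm_iteratedFDeriv_le_of_norm_le hQ 1 i
  set D : ℝ := 1 + ∑ i ∈ Finset.range (j + 1), B i with hD
  have hle : ∀ i ≤ j, B i ≤ D := fun i hi ↦ by
    have := Finset.single_le_sum (f := B) (fun i _ ↦ hB0 i) (Finset.mem_range.2 (Nat.lt_succ_of_le hi))
    linarith
  have hD1 : 1 ≤ D := by
    have := Finset.sum_nonneg (s := Finset.range (j + 1)) (f := B) fun i _ ↦ hB0 i
    linarith
  refine ⟨j.factorial * D * D ^ j, fun ε hε hε1 z hz ↦ ?_⟩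
  have hg : ContDiff ℝ (⊤ : ℕ∞) fun t : ℝ ↦ Complex.exp ((ε * t : ℝ) * Complex.I) - 1 :=
    (contDiff_cexp_mul_I ε).sub contDiff_const
  have h := norm_iteratedFDeriv_comp_le hg hQ (n := j) (by exact_mod_cast le_top) z (C := D * ε)
    (D := D) (fun i hi ↦ ?_) (fun i hi hij ↦ ?_)
  · calc _ ≤ j.factorial * (D * ε) * D ^ j := h
      _ = _ := by ring
  · rcases Nat.eq_zero_or_pos i with rfl | hi0
    · rw [norm_iteratedFDeriv_zero]
      have h1 := Real.norm_exp_I_mul_ofReal_sub_one_le (x := ε * Q z)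
      rw [mul_comm] at h1
      refine h1.trans ?_
      rw [norm_mul, Real.norm_of_nonneg hε.le, mul_comm]
      gcongr
      have := hB 0 z hz
      rw [norm_iteratedFDeriv_zero] at this
      exact this.trans (hle 0 (Nat.zero_le _))
    · have e : (fun t : ℝ ↦ Complex.exp ((ε * t : ℝ) * Complex.I) - 1) =
          (fun t : ℝ ↦ Complex.exp ((ε * t : ℝ) * Complex.I)) - fun _ ↦ 1 := rfl
      rw [e, iteratedFDeriv_sub_apply ((contDiff_cexp_mul_I ε).of_le
        (by exact_mod_cast le_top)).contDiffAt contDiffAt_const,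
        iteratedFDeriv_const_of_ne hi0.ne', Pi.zero_apply, sub_zero,
        norm_iteratedFDeriv_cexp_mul_I_le, abs_of_pos hε]
      calc ε ^ i ≤ ε ^ 1 := pow_le_pow_of_le_one hε.le hε1 hi0
        _ ≤ D * ε := by rw [pow_one]; nlinarith
  · exact ((hB i z hz).trans (hle i hij)).trans (le_self_pow₀ hD1 (by omega))

/-! ### The singular part at the origin. -/

/-- The part of the symbol `exp (i |ξ|^α)` that is singular at the origin. -/
def singularPart (α : ℝ) (ξ : EuclideanSpace ℝ (Fin d)) : ℂ :=
  symbol α ξ - Complex.exp ((phase α ξ : ℂ) * Complex.I)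

theorem symbol_eq (α : ℝ) (ξ : EuclideanSpace ℝ (Fin d)) :
    symbol α ξ = Complex.exp (((‖ξ‖ ^ α : ℝ) : ℂ) * Complex.I) := by
  rw [symbol, mul_comm]

theorem continuous_singularPart {α : ℝ} (hα : 0 < α) :
    Continuous (singularPart α : EuclideanSpace ℝ (Fin d) → ℂ) := by
  have h1 : Continuous fun ξ : EuclideanSpace ℝ (Fin d) ↦ ‖ξ‖ ^ α :=
    continuous_norm.rpow_const fun _ ↦ Or.inr hα.le
  have h2 : Continuous (phase α : EuclideanSpace ℝ (Fin d) → ℝ) := (contDiff_phase α).continuous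
  unfold singularPart symbol
  fun_prop

theorem singularPart_eq_zero (α : ℝ) {ξ : EuclideanSpace ℝ (Fin d)} (h : 7 / 16 < ‖ξ‖) :
    singularPart α ξ = 0 := by
  rw [singularPart, symbol_eq, phase_eq_rpow α h, sub_self]

theorem contDiffAt_singularPart (α : ℝ) {ξ : EuclideanSpace ℝ (Fin d)} (hξ : ξ ≠ 0) :
    ContDiffAt ℝ (⊤ : ℕ∞) (singularPart α) ξ := by
  have h1 : ContDiffAt ℝ (⊤ : ℕ∞) (fun ξ : EuclideanSpace ℝ (Fin d) ↦ ‖ξ‖ ^ α) ξ :=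
    (contDiffAt_norm ℝ hξ).rpow_const_of_ne (norm_ne_zero_iff.2 hξ)
  have h2 : ∀ {f : EuclideanSpace ℝ (Fin d) → ℝ}, ContDiffAt ℝ (⊤ : ℕ∞) f ξ →
      ContDiffAt ℝ (⊤ : ℕ∞) (fun ξ ↦ Complex.exp ((f ξ : ℂ) * Complex.I)) ξ := fun hf ↦
    ((Complex.ofRealCLM.contDiff.contDiffAt.comp ξ hf).mul contDiffAt_const).cexp
  have e : (singularPart α : EuclideanSpace ℝ (Fin d) → ℂ) = fun ξ ↦
      Complex.exp (((‖ξ‖ ^ α : ℝ) : ℂ) * Complex.I) - Complex.exp ((phase α ξ : ℂ) * Complex.I) :=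
    funext fun ξ ↦ by rw [singularPart, symbol_eq]
  rw [e]
  exact (h2 h1).sub (h2 (contDiff_phase α).contDiffAt)

/-- Near the origin `phase` vanishes and the function is `exp(i|ξ|^α) - 1`. Rescaling by `t = ‖ξ‖`
yields `t^{-j}` times a derivative of `exp(i t^α Q) - 1` on the unit sphere, which is `O(t^α)`. Away
from the origin only a compact annulus matters. -/
theorem exists_norm_iteratedFDeriv_singularPart_le {α : ℝ} (hα : 0 < α) (j : ℕ) :
    ∃ C : ℝ, ∀ ξ : EuclideanSpace ℝ (Fin d), ξ ≠ 0 →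
      ‖iteratedFDeriv ℝ j (singularPart α) ξ‖ ≤ C * ‖ξ‖ ^ (α - j) := by
  obtain ⟨C, hC⟩ := exists_norm_iteratedFDeriv_cexp_sub_one_le (contDiff_phase (d := d) α) j
  have hcexp : ∀ {f : EuclideanSpace ℝ (Fin d) → ℝ}, ContDiff ℝ (⊤ : ℕ∞) f →
      ContDiff ℝ (⊤ : ℕ∞) (fun ξ ↦ Complex.exp ((f ξ : ℂ) * Complex.I)) := fun hf ↦
    ((Complex.ofRealCLM.contDiff.comp hf).mul contDiff_const).cexp
  -- `phase α` itself is known to be `|ξ|^α` only for `‖ξ‖ > 7/16`. Rescaled by `1/2` it represents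
  -- `|ξ|^α` for `‖ξ‖ > 7/32`, which covers the annulus from `3/8` to `1`.
  have hQ : ContDiff ℝ (⊤ : ℕ∞) fun ξ : EuclideanSpace ℝ (Fin d) ↦
      Complex.exp ((((1 / 2 : ℝ) ^ α * phase α ((1 / 2 : ℝ)⁻¹ • ξ) : ℝ) : ℂ) * Complex.I) -
        Complex.exp ((phase α ξ : ℂ) * Complex.I) :=
    (hcexp (contDiff_const.mul ((contDiff_phase α).comp (contDiff_const_smul _)))).sub
      (hcexp (contDiff_phase α))
  obtain ⟨B, hB0, hB⟩ := exists_norm_iteratedFDeriv_le_of_norm_le hQ 1 j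
  set A : ℝ := max 1 ((3 / 8 : ℝ) ^ (j - α)) with hA
  refine ⟨max C (B * A), fun ξ hξ ↦ ?_⟩
  have hξ0 : 0 < ‖ξ‖ := norm_pos_iff.2 hξ
  have hpow : 0 < ‖ξ‖ ^ (α - j) := by positivity
  rcases lt_or_ge ‖ξ‖ (3 / 8) with h | h
  · set t := ‖ξ‖ with ht
    have h1 : singularPart α =ᶠ[𝓝 ξ] fun η : EuclideanSpace ℝ (Fin d) ↦
        (fun z ↦ Complex.exp ((t ^ α * phase α z : ℝ) * Complex.I) - 1) (t⁻¹ • η) := by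
      filter_upwards [rpow_norm_eventuallyEq α hξ0 (ξ := ξ) (by linarith),
        (isOpen_lt continuous_norm continuous_const).mem_nhds h] with η h2 h3
      rw [singularPart, symbol_eq, h2, phase_eq_zero α (le_of_lt h3)]
      simp
    rw [iteratedFDeriv_comp_smul_of_eventuallyEq
      ((hcexp (contDiff_const.mul (contDiff_phase α))).sub contDiff_const) h1, norm_smul]
    have h4 := hC (t ^ α) (by positivity) (Real.rpow_le_one hξ0.le (by linarith) hα.le) (t⁻¹ • ξ) (by
      rw [norm_smul, norm_inv, Real.norm_of_nonneg hξ0.le, ← ht, inv_mul_cancel₀ hξ0.ne'])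
    have h5 : ‖t⁻¹ ^ j‖ * t ^ α = t ^ (α - j) := by
      rw [Real.rpow_sub hξ0, Real.rpow_natCast, Real.norm_of_nonneg (by positivity), inv_pow,
        div_eq_inv_mul]
    calc _ ≤ ‖t⁻¹ ^ j‖ * (C * t ^ α) := by gcongr
      _ = C * t ^ (α - j) := by rw [← h5]; ring
      _ ≤ _ := by gcongr; exact le_max_left _ _
  · rcases le_or_gt ‖ξ‖ 1 with h' | h'
    · have h1 : singularPart α =ᶠ[𝓝 ξ] fun ξ : EuclideanSpace ℝ (Fin d) ↦
          Complex.exp ((((1 / 2 : ℝ) ^ α * phase α ((1 / 2 : ℝ)⁻¹ • ξ) : ℝ) : ℂ) * Complex.I) -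
            Complex.exp ((phase α ξ : ℂ) * Complex.I) := by
        filter_upwards [rpow_norm_eventuallyEq α (t := 1 / 2) (by norm_num) (ξ := ξ)
          (by linarith)] with η h2
        rw [singularPart, symbol_eq, h2]
      rw [(h1.iteratedFDeriv ℝ j).eq_of_nhds]
      have h2 : 1 ≤ A * ‖ξ‖ ^ (α - j) := by
        rcases le_total 0 (α - j) with h3 | h3
        · have h4 : (3 / 8 : ℝ) ^ (α - j) ≤ ‖ξ‖ ^ (α - j) := Real.rpow_le_rpow (by norm_num) h h3
          calc (1 : ℝ) = (3 / 8 : ℝ) ^ (j - α) * (3 / 8 : ℝ) ^ (α - j) := by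
                rw [← Real.rpow_add (by norm_num)]; simp
            _ ≤ A * ‖ξ‖ ^ (α - j) := by gcongr; exact le_max_right _ _
        · have h4 : 1 ≤ ‖ξ‖ ^ (α - j) := Real.one_le_rpow_of_pos_of_le_one_of_nonpos hξ0 h' h3
          have h5 : 1 ≤ A := le_max_left _ _
          nlinarith
      calc _ ≤ B := hB ξ h'
        _ ≤ B * (A * ‖ξ‖ ^ (α - j)) := le_mul_of_one_le_right hB0 h2
        _ = B * A * ‖ξ‖ ^ (α - j) := by ring
        _ ≤ _ := by gcongr; exact le_max_right _ _
    · have h1 : (singularPart α : EuclideanSpace ℝ (Fin d) → ℂ) =ᶠ[𝓝 ξ] fun _ ↦ 0 := by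
        filter_upwards [(isOpen_lt continuous_const continuous_norm).mem_nhds h'] with η hη
        exact singularPart_eq_zero α (lt_trans (by norm_num) hη)
      rw [(h1.iteratedFDeriv ℝ j).eq_of_nhds]
      have h2 : iteratedFDeriv ℝ j (fun _ : EuclideanSpace ℝ (Fin d) ↦ (0 : ℂ)) ξ = 0 := by simp
      rw [h2, norm_zero]
      have h3 : 0 ≤ B * A := mul_nonneg hB0 (zero_le_one.trans (le_max_left _ _))
      exact mul_nonneg (h3.trans (le_max_right _ _)) hpow.le

/-! ### Fourier decay of conical singularities. -/

/-- Integration by parts `N` times in the direction `u`, with a factor `(2π)^N ≥ 1` to spare. Unit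
vectors suffice because other frequencies are reached by dilation. -/
theorem norm_fourier_le_integral_iteratedFDeriv {W : EuclideanSpace ℝ (Fin d) → ℂ}
    (hW : ContDiff ℝ (⊤ : ℕ∞) W) (hWc : HasCompactSupport W) (N : ℕ)
    {u : EuclideanSpace ℝ (Fin d)} (hu : ‖u‖ = 1) :
    ‖𝓕 W u‖ ≤ ∫ x, ‖iteratedFDeriv ℝ N W x‖ := by
  have hint : ∀ n : ℕ, (n : ℕ∞) ≤ (⊤ : ℕ∞) → Integrable (iteratedFDeriv ℝ n W) := fun n _ ↦
    (hW.continuous_iteratedFDeriv (m := n) (by exact_mod_cast le_top)).integrable_of_hasCompactSupport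
      (hWc.iteratedFDeriv n)
  have h := congrFun (Real.fourier_iteratedFDeriv hW hint (n := N) le_top) u
  have h1 := congrArg (fun T : EuclideanSpace ℝ (Fin d) [×N]→L[ℝ] ℂ ↦ ‖T fun _ ↦ u‖) h
  simp only [VectorFourier.fourierPowSMulRight_apply, norm_smul, norm_pow, norm_neg,
    Finset.prod_const, Finset.card_univ, Fintype.card_fin] at h1
  have h2 : ‖((-innerSL ℝ : EuclideanSpace ℝ (Fin d) →L[ℝ] _) u) u‖ = 1 := by
    simp [hu]
  have h3 : (1 : ℝ) ≤ ‖(2 * (Real.pi : ℂ) * Complex.I : ℂ)‖ ^ N := by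
    refine one_le_pow₀ ?_
    have : (1 : ℝ) ≤ 2 * Real.pi := by linarith [Real.pi_gt_three]
    simpa [abs_of_pos Real.pi_pos] using this
  have h4 : ‖(𝓕 (iteratedFDeriv ℝ N W) u) fun _ ↦ u‖ ≤ ∫ x, ‖iteratedFDeriv ℝ N W x‖ := by
    refine (ContinuousMultilinearMap.le_opNorm _ _).trans ?_
    simp only [hu, Finset.prod_const_one, mul_one]
    exact VectorFourier.norm_fourierIntegral_le_integral_norm _ _ _ _ _
  refine le_trans ?_ (h1.symm.le.trans h4)
  rw [h2, one_pow, one_mul]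
  exact le_mul_of_one_le_left (norm_nonneg _) h3

/-- The Fourier transforms of functions with a controlled conical singularity at the origin are
uniformly bounded on the unit sphere. -/
theorem exists_norm_fourier_le_of_conical {α : ℝ} (hα : 0 ≤ α) {C : ℕ → ℝ} (hC : ∀ j, 0 ≤ C j) :
    ∃ K : ℝ, 0 ≤ K ∧ ∀ (H : EuclideanSpace ℝ (Fin d) → ℂ) (A : ℝ), 0 ≤ A → Continuous H →
      HasCompactSupport H → H 0 = 0 → (∀ z, z ≠ 0 → ContDiffAt ℝ (⊤ : ℕ∞) H z) →
      (∀ j z, z ≠ 0 → ‖iteratedFDeriv ℝ j H z‖ ≤ A * (C j * ‖z‖ ^ (α - j))) →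
      ∀ u, ‖u‖ = 1 → ‖𝓕 H u‖ ≤ A * K := by
  -- Makes the bound `‖z‖^{α - N}` on the `N`-th derivative integrable at infinity.
  obtain ⟨N, hN⟩ := exists_nat_gt (d + α)
  set Ψ : EuclideanSpace ℝ (Fin d) → ℂ := fun z ↦ 1 - cutoff d z with hΨ
  have hΨs : ContDiff ℝ (⊤ : ℕ∞) Ψ := contDiff_const.sub ((cutoff d).smooth ⊤)
  choose B hB0 hB using fun i ↦ exists_norm_iteratedFDeriv_le_of_norm_le hΨs 1 i
  -- Leibniz bound for `Ψ H` on the annulus `3/8 ≤ ‖z‖ ≤ 1`, where `‖z‖⁻¹ ≤ 8/3`.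
  set K₂ : ℝ := ∑ i ∈ Finset.range (N + 1), (N.choose i : ℝ) * B i *
    (C (N - i) * (8 / 3) ^ (N - i)) with hK₂
  have hK₂0 : 0 ≤ K₂ := Finset.sum_nonneg fun i _ ↦ by have := hB0 i; have := hC (N - i); positivity
  set K₁ : ℝ := 2 ^ (N - α) * (K₂ + C N) with hK₁
  set J : ℝ := ∫ z : EuclideanSpace ℝ (Fin d), (1 + ‖z‖) ^ (-(N - α)) with hJ
  have hJint : Integrable fun z : EuclideanSpace ℝ (Fin d) ↦ (1 + ‖z‖) ^ (-(N - α)) :=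
    integrable_one_add_norm (by rw [finrank_euclideanSpace_fin]; linarith)
  have hJ0 : 0 ≤ J := integral_nonneg fun z ↦ by positivity
  set V : ℝ := volume.real (Metric.closedBall (0 : EuclideanSpace ℝ (Fin d)) 1) with hV
  have hK₁0 : 0 ≤ K₁ := mul_nonneg (by positivity) (add_nonneg hK₂0 (hC N))
  refine ⟨C 0 * V + K₁ * J, add_nonneg (mul_nonneg (hC 0) measureReal_nonneg)
    (mul_nonneg hK₁0 hJ0), fun H A hA hHc hHs hH0 hHd hH u hu ↦ ?_⟩
  -- Near the origin `U` is estimated by its `L^1` norm without derivatives; `W` vanishes near the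
  -- origin, is smooth, and is integrated by parts.
  set U : EuclideanSpace ℝ (Fin d) → ℂ := fun z ↦ cutoff d z * H z with hU
  set W : EuclideanSpace ℝ (Fin d) → ℂ := fun z ↦ Ψ z * H z with hW
  have hWd : ContDiff ℝ (⊤ : ℕ∞) W := by
    rw [contDiff_iff_contDiffAt]
    intro z
    rcases lt_or_ge ‖z‖ (3 / 8) with h | h
    · have h0 : W =ᶠ[𝓝 z] fun _ ↦ 0 := by
        filter_upwards [(isOpen_lt continuous_norm continuous_const).mem_nhds h] with η hη
        simp only [hW, hΨ]
        rw [cutoff_eq_one (le_of_lt hη), sub_self, zero_mul]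
      exact contDiffAt_const.congr_of_eventuallyEq h0
    · have hz : z ≠ 0 := fun h0 ↦ by rw [h0, norm_zero] at h; linarith
      exact hΨs.contDiffAt.mul (hHd z hz)
  have hWc : HasCompactSupport W := hHs.mul_left
  have hUc : Continuous U := (cutoff d).continuous.mul hHc
  have hsplit : 𝓕 H u = 𝓕 U u + 𝓕 W u := by
    simp only [fourier_eq_integral_character]
    rw [← integral_add]
    · refine integral_congr_ae (Eventually.of_forall fun z ↦ ?_)
      simp only [hU, hW, hΨ]; ring
    · exact integrable_mul_schwartz (continuous_character _) (B := 1)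
        (fun z ↦ (norm_character _ _).le)
        (hUc.integrable_of_hasCompactSupport hHs.mul_left)
    · exact integrable_mul_schwartz (continuous_character _) (B := 1)
        (fun z ↦ (norm_character _ _).le)
        (hWd.continuous.integrable_of_hasCompactSupport hWc)
  have hUb : ‖𝓕 U u‖ ≤ A * (C 0 * V) := by
    have h1 : ‖𝓕 U u‖ ≤ ∫ z, ‖U z‖ := VectorFourier.norm_fourierIntegral_le_integral_norm _ _ _ _ _
    have h2 : ∀ z, ‖U z‖ ≤ (Metric.closedBall (0 : EuclideanSpace ℝ (Fin d)) 1).indicator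
        (fun _ ↦ A * C 0) z := by
      intro z
      by_cases hz : ‖z‖ ≤ 1
      · rw [Set.indicator_of_mem (by simpa using hz), hU, norm_mul]
        have hc1 : ‖cutoff d z‖ ≤ 1 := by
          rw [cutoff_apply, Complex.norm_real, Real.norm_of_nonneg (bump d).nonneg]
          exact (bump d).le_one
        have hH1 : ‖H z‖ ≤ A * C 0 := by
          rcases eq_or_ne z 0 with rfl | hz0
          · rw [hH0, norm_zero]; exact mul_nonneg hA (hC 0)
          · have := hH 0 z hz0
            rw [norm_iteratedFDeriv_zero, Nat.cast_zero, sub_zero] at this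
            refine this.trans ?_
            have h3 : ‖z‖ ^ α ≤ 1 := Real.rpow_le_one (norm_nonneg z) hz hα
            gcongr
            exact mul_le_of_le_one_right (hC 0) h3
        calc ‖cutoff d z‖ * ‖H z‖ ≤ 1 * (A * C 0) := by gcongr
          _ = A * C 0 := one_mul _
      · have h0 : U z = 0 := by
          simp only [hU]
          rw [cutoff_eq_zero (by linarith), zero_mul]
        rw [h0, norm_zero, Set.indicator_of_notMem (by simpa using hz)]
    refine h1.trans ((integral_mono (hUc.integrable_of_hasCompactSupport hHs.mul_left).norm
      ((integrable_indicator_iff Metric.isClosed_closedBall.measurableSet).2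
        (integrableOn_const (isCompact_closedBall _ _).measure_lt_top.ne)) h2).trans (le_of_eq ?_))
    rw [integral_indicator Metric.isClosed_closedBall.measurableSet, setIntegral_const, smul_eq_mul,
      ← hV]
    ring
  have hWb : ‖𝓕 W u‖ ≤ A * (K₁ * J) := by
    refine (norm_fourier_le_integral_iteratedFDeriv hWd hWc N hu).trans ?_
    have hb : ∀ z, ‖iteratedFDeriv ℝ N W z‖ ≤ A * (K₁ * (1 + ‖z‖) ^ (-(N - α))) := by
      intro z
      have hz1 : 0 < 1 + ‖z‖ := by positivity
      have hAK : 0 ≤ A * (K₁ * (1 + ‖z‖) ^ (-(N - α))) := by positivity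
      rcases lt_or_ge ‖z‖ (3 / 8) with h | h
      · have h0 : W =ᶠ[𝓝 z] fun _ ↦ 0 := by
          filter_upwards [(isOpen_lt continuous_norm continuous_const).mem_nhds h] with η hη
          simp only [hW, hΨ]
          rw [cutoff_eq_one (le_of_lt hη), sub_self, zero_mul]
        have h2 : iteratedFDeriv ℝ N (fun _ : EuclideanSpace ℝ (Fin d) ↦ (0 : ℂ)) z = 0 := by simp
        rw [(h0.iteratedFDeriv ℝ N).eq_of_nhds, h2, norm_zero]
        exact hAK
      have hz0 : 0 < ‖z‖ := by linarith
      have hz : z ≠ 0 := norm_pos_iff.1 hz0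
      rcases le_or_gt ‖z‖ 1 with h' | h'
      · have hopen : IsOpen ({0}ᶜ : Set (EuclideanSpace ℝ (Fin d))) := isOpen_compl_singleton
        have hHon : ContDiffOn ℝ (⊤ : ℕ∞) H {0}ᶜ := fun w hw ↦ (hHd w hw).contDiffWithinAt
        have hL := norm_iteratedFDerivWithin_mul_le hΨs.contDiffOn hHon hopen.uniqueDiffOn
          (show z ∈ ({0}ᶜ : Set (EuclideanSpace ℝ (Fin d))) from hz) (n := N)
          (by exact_mod_cast le_top)
        simp only [iteratedFDerivWithin_of_isOpen _ hopen
          (show z ∈ ({0}ᶜ : Set (EuclideanSpace ℝ (Fin d))) from hz)] at hL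
        have hsum : ‖iteratedFDeriv ℝ N W z‖ ≤ A * K₂ := by
          refine hL.trans ?_
          rw [hK₂, Finset.mul_sum]
          refine Finset.sum_le_sum fun i _ ↦ ?_
          have h1 := hB i z h'
          have h2 := hH (N - i) z hz
          have h3 : ‖z‖ ^ (α - (N - i : ℕ)) ≤ (8 / 3) ^ (N - i) := by
            rw [Real.rpow_sub hz0, Real.rpow_natCast, div_eq_mul_inv, ← inv_pow]
            have h4 : ‖z‖ ^ α ≤ 1 := Real.rpow_le_one hz0.le h' hα
            have h5 : ‖z‖⁻¹ ≤ 8 / 3 := by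
              rw [inv_le_comm₀ hz0 (by norm_num)]; norm_num; linarith
            calc ‖z‖ ^ α * ‖z‖⁻¹ ^ (N - i) ≤ 1 * (8 / 3) ^ (N - i) := by gcongr
              _ = _ := one_mul _
          have := hB0 i
          have := hC (N - i)
          calc (N.choose i : ℝ) * ‖iteratedFDeriv ℝ i Ψ z‖ * ‖iteratedFDeriv ℝ (N - i) H z‖
              ≤ (N.choose i : ℝ) * B i * (A * (C (N - i) * (8 / 3) ^ (N - i))) := by
                gcongr
                refine h2.trans ?_
                gcongr
            _ = _ := by ring
        have h6 : 1 ≤ 2 ^ (N - α) * (1 + ‖z‖) ^ (-(N - α)) := by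
          rw [Real.rpow_neg hz1.le, ← div_eq_mul_inv, ← Real.div_rpow (by norm_num) hz1.le]
          refine Real.one_le_rpow ?_ ?_
          · rw [le_div_iff₀ hz1]; linarith
          · have : (0 : ℝ) ≤ d := Nat.cast_nonneg d
            linarith
        calc _ ≤ A * K₂ := hsum
          _ ≤ A * (K₂ + C N) := by gcongr; linarith [hC N]
          _ ≤ A * (K₂ + C N) * (2 ^ (N - α) * (1 + ‖z‖) ^ (-(N - α))) :=
              le_mul_of_one_le_right (mul_nonneg hA (add_nonneg hK₂0 (hC N))) h6
          _ = _ := by rw [hK₁]; ring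
      · have h0 : W =ᶠ[𝓝 z] H := by
          filter_upwards [(isOpen_lt continuous_const continuous_norm).mem_nhds h'] with η hη
          simp only [hW, hΨ]
          rw [cutoff_eq_zero (lt_trans (by norm_num) hη), sub_zero, one_mul]
        rw [(h0.iteratedFDeriv ℝ N).eq_of_nhds]
        have h1 : ‖z‖ ^ (α - N) ≤ 2 ^ (N - α) * (1 + ‖z‖) ^ (-(N - α)) := by
          have e : α - N = -(N - α) := by ring
          rw [e, Real.rpow_neg hz1.le, ← div_eq_mul_inv, ← Real.div_rpow (by norm_num) hz1.le,
            Real.rpow_neg hz0.le, ← Real.inv_rpow hz0.le]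
          refine Real.rpow_le_rpow (by positivity) ?_ ?_
          · rw [le_div_iff₀ hz1, inv_mul_le_iff₀ hz0]; linarith
          · have : (0 : ℝ) ≤ d := Nat.cast_nonneg d
            linarith
        have hCN := hC N
        calc _ ≤ A * (C N * ‖z‖ ^ (α - N)) := hH N z hz
          _ ≤ A * ((K₂ + C N) * (2 ^ (N - α) * (1 + ‖z‖) ^ (-(N - α)))) := by
              gcongr; linarith
          _ = _ := by rw [hK₁]; ring
    refine (integral_mono ((hWd.continuous_iteratedFDeriv (m := N)
      (by exact_mod_cast le_top)).integrable_of_hasCompactSupport (hWc.iteratedFDeriv N)).norm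
      ((hJint.const_mul K₁).const_mul A) hb).trans (le_of_eq ?_)
    rw [integral_const_mul, integral_const_mul]
  rw [hsplit, mul_add]
  exact norm_add_le_of_le hUb hWb

/-- A dilation is a linear equivalence, so no differentiability of `f` is required; the lemma thus
applies to functions singular at the origin. -/
theorem iteratedFDeriv_comp_smul_apply {F : Type*} [NormedAddCommGroup F] [NormedSpace ℝ F]
    (f : EuclideanSpace ℝ (Fin d) → F) {t : ℝ} (ht : t ≠ 0) (j : ℕ)
    (z : EuclideanSpace ℝ (Fin d)) :
    iteratedFDeriv ℝ j (fun z ↦ f (t • z)) z = t ^ j • iteratedFDeriv ℝ j f (t • z) := by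
  have h := (ContinuousLinearEquiv.smulLeft (R₁ := ℝ) (M₁ := EuclideanSpace ℝ (Fin d))
    (Units.mk0 t ht)).iteratedFDerivWithin_comp_right f (s := Set.univ) uniqueDiffOn_univ
    (x := z) (Set.mem_univ _) j
  rw [Set.preimage_univ, iteratedFDerivWithin_univ, iteratedFDerivWithin_univ] at h
  refine Eq.trans h ?_
  ext v
  rw [ContinuousMultilinearMap.compContinuousLinearMap_apply]
  exact (iteratedFDeriv ℝ j f (t • z)).map_smul_univ (fun _ ↦ t) v |>.trans (by simp)

theorem fourier_comp_smul (G : EuclideanSpace ℝ (Fin d) → ℂ) {l : ℝ} (hl : 0 < l)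
    (y : EuclideanSpace ℝ (Fin d)) :
    𝓕 G y = ((l ^ d)⁻¹ : ℝ) • 𝓕 (fun z ↦ G (l⁻¹ • z)) (l⁻¹ • y) := by
  have h := Measure.integral_comp_smul (volume : Measure (EuclideanSpace ℝ (Fin d)))
    (fun x ↦ character (-y) x * G x) l⁻¹
  simp only [fourier_eq_integral_character]
  rw [finrank_euclideanSpace_fin, inv_pow, inv_inv, abs_of_pos (by positivity)] at h
  have e : ∀ z, character (-(l⁻¹ • y)) z = character (-y) (l⁻¹ • z) := fun z ↦ by
    rw [← smul_neg, character_smul_left]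
  simp only [e]
  rw [h, smul_smul, inv_mul_cancel₀ (by positivity), one_smul]

/-- The Fourier transform of a function with a conical singularity `|ξ|^α` at the origin decays
like `|y|^{-d-α}`. -/
theorem exists_norm_fourier_comp_smul_le {α : ℝ} (hα : 0 ≤ α)
    {H : EuclideanSpace ℝ (Fin d) → ℂ} (hHc : Continuous H) (hHs : HasCompactSupport H)
    (hH0 : H 0 = 0) (hHd : ∀ z, z ≠ 0 → ContDiffAt ℝ (⊤ : ℕ∞) H z)
    (hH : ∀ j : ℕ, ∃ C : ℝ, ∀ z, z ≠ 0 → ‖iteratedFDeriv ℝ j H z‖ ≤ C * ‖z‖ ^ (α - j))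
    {t : ℝ} (ht : 0 < t) :
    ∃ K : ℝ, 0 ≤ K ∧ ∀ y : EuclideanSpace ℝ (Fin d), y ≠ 0 →
      ‖𝓕 (fun η ↦ H (t • η)) y‖ ≤ K * ‖y‖ ^ (-(d + α)) := by
  choose C hC using hH
  obtain ⟨K, hK0, hK⟩ := exists_norm_fourier_le_of_conical (d := d) hα (C := fun j ↦ |C j|)
    fun j ↦ abs_nonneg _
  refine ⟨t ^ α * K, by positivity, fun y hy ↦ ?_⟩
  have hl : 0 < ‖y‖ := norm_pos_iff.2 hy
  set l := ‖y‖ with hldef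
  have hτ : 0 < t * l⁻¹ := by positivity
  -- `H (τ ·)` satisfies the conical bounds of `H` with the same constants times `τ^α`. With the
  -- Jacobian `l^{-d}` this gives the decay `l^{-d-α}`.
  set τ := t * l⁻¹ with hτdef
  have h1 := hK (fun z ↦ H (τ • z)) (τ ^ α) (by positivity) (hHc.comp (continuous_const_smul _))
    (hHs.comp_smul hτ.ne') (by rw [smul_zero, hH0])
    (fun z hz ↦ (hHd (τ • z) (smul_ne_zero hτ.ne' hz)).comp z (contDiff_const_smul τ).contDiffAt)
    (fun j z hz ↦ by
      have hz0 : 0 < ‖z‖ := norm_pos_iff.2 hz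
      rw [iteratedFDeriv_comp_smul_apply H hτ.ne', norm_smul, norm_pow, Real.norm_of_nonneg hτ.le]
      calc τ ^ j * ‖iteratedFDeriv ℝ j H (τ • z)‖
          ≤ τ ^ j * (|C j| * ‖τ • z‖ ^ (α - j)) := by
            gcongr
            refine (hC j _ (smul_ne_zero hτ.ne' hz)).trans ?_
            gcongr
            exact le_abs_self _
        _ = (τ ^ (j : ℝ) * τ ^ (α - j)) * (|C j| * ‖z‖ ^ (α - j)) := by
            rw [norm_smul, Real.norm_of_nonneg hτ.le, Real.mul_rpow hτ.le hz0.le,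
              Real.rpow_natCast]
            ring
        _ = _ := by rw [← Real.rpow_add hτ]; congr 2; ring)
    (l⁻¹ • y) (by rw [norm_smul, norm_inv, Real.norm_of_nonneg hl.le, ← hldef,
      inv_mul_cancel₀ hl.ne'])
  rw [fourier_comp_smul _ hl, norm_smul, Real.norm_of_nonneg (by positivity)]
  simp only [smul_smul, ← hτdef]
  calc (l ^ d)⁻¹ * _ ≤ (l ^ d)⁻¹ * (τ ^ α * K) := by gcongr
    _ = _ := by
      rw [hτdef, Real.mul_rpow ht.le (by positivity), Real.inv_rpow hl.le, Real.rpow_neg hl.le,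
        Real.rpow_add hl, Real.rpow_natCast, mul_inv]
      ring

theorem summable_norm_rpow_of_le {c : (Fin d → ℤ) → ℂ} {K a r : ℝ} (hr : 0 < r) (ha : 0 ≤ a)
    (har : (d : ℝ) < a * r) (hK : 0 ≤ K)
    (hc : ∀ n, latticePoint n ≠ 0 → ‖c n‖ ≤ K * ‖latticePoint n‖ ^ (-a)) :
    Summable fun n ↦ ‖c n‖ ^ r := by
  have hs := (summable_one_add_norm_latticePoint har).mul_left
    ((K * 2 ^ a + ‖c 0‖) ^ r)
  refine Summable.of_nonneg_of_le (fun n ↦ by positivity) (fun n ↦ ?_) hs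
  have hle : ‖c n‖ ≤ (K * 2 ^ a + ‖c 0‖) * (1 + ‖latticePoint n‖) ^ (-a) := by
    rcases eq_or_ne n 0 with rfl | hn
    · have h0 : latticePoint (0 : Fin d → ℤ) = 0 := by
        ext i; simp [latticePoint]
      rw [h0, norm_zero, add_zero, Real.one_rpow, mul_one]
      have : 0 ≤ K * 2 ^ a := by positivity
      linarith
    · obtain ⟨i, hi⟩ := Function.ne_iff.1 hn
      have h1 : 1 ≤ ‖latticePoint n‖ := by
        refine le_trans ?_ (PiLp.norm_apply_le (latticePoint n) i)
        have h2 : (1 : ℤ) ≤ |n i| := Int.one_le_abs hi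
        have h3 : ((1 : ℤ) : ℝ) ≤ ((|n i| : ℤ) : ℝ) := Int.cast_le.2 h2
        simpa [latticePoint] using h3
      have hn0 : latticePoint n ≠ 0 := norm_pos_iff.1 (by linarith)
      have h4 : ‖latticePoint n‖ ^ (-a) ≤ 2 ^ a * (1 + ‖latticePoint n‖) ^ (-a) := by
        have hz1 : 0 < 1 + ‖latticePoint n‖ := by positivity
        have hz0 : 0 < ‖latticePoint n‖ := by linarith
        rw [Real.rpow_neg hz1.le, ← div_eq_mul_inv, ← Real.div_rpow (by norm_num) hz1.le,
          Real.rpow_neg hz0.le, ← Real.inv_rpow hz0.le]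
        refine Real.rpow_le_rpow (by positivity) ?_ ha
        rw [le_div_iff₀ hz1, inv_mul_le_iff₀ hz0]; linarith
      calc ‖c n‖ ≤ K * ‖latticePoint n‖ ^ (-a) := hc n hn0
        _ ≤ K * (2 ^ a * (1 + ‖latticePoint n‖) ^ (-a)) := by gcongr
        _ = K * 2 ^ a * (1 + ‖latticePoint n‖) ^ (-a) := by ring
        _ ≤ _ := by gcongr; linarith [norm_nonneg (c 0)]
  have hA : 0 ≤ K * 2 ^ a + ‖c 0‖ := by positivity
  calc ‖c n‖ ^ r ≤ ((K * 2 ^ a + ‖c 0‖) * (1 + ‖latticePoint n‖) ^ (-a)) ^ r := by gcongr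
    _ = _ := by
      rw [Real.mul_rpow hA (by positivity), ← Real.rpow_mul (by positivity), neg_mul]

/-! ### Unimodular multipliers. -/

/-- The unimodular multiplier `exp (i |ξ|^α)` is bounded on modulation spaces if
`d < (d + α) min(1, p)`. -/
theorem multiplierExtends_symbol {β : ℝ} {χ : 𝓢(EuclideanSpace ℝ (Fin d), ℂ)}
    (hχ : IsFrequencyPartition β χ) {p q : ℝ≥0∞} (hp : 0 < p) (hq : 0 < q) {s : ℝ} (hs : 0 ≤ s)
    {α : ℝ} (hα : 0 < α) (hα2 : α ≤ 2) (hr : (d : ℝ) < (d + α) * subadditiveExponent p) :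
    MultiplierExtends (symbol α) β χ p q s := by
  have hz : singularPart α (0 : EuclideanSpace ℝ (Fin d)) = 0 := by
    rw [singularPart, symbol_eq, phase_eq_zero α (by rw [norm_zero]; norm_num), norm_zero,
      Real.zero_rpow hα.ne']
    simp
  obtain ⟨K, hK0, hK⟩ := exists_norm_fourier_comp_smul_le (d := d) hα.le
    (continuous_singularPart hα)
    (HasCompactSupport.intro (isCompact_closedBall (0 : EuclideanSpace ℝ (Fin d)) 1)
      fun ξ hξ ↦ singularPart_eq_zero α (by
        have : 1 < ‖ξ‖ := by simpa using hξ
        linarith)) hz (fun z hz ↦ contDiffAt_singularPart α hz)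
    (exists_norm_iteratedFDeriv_singularPart_le hα) (t := 8) (by norm_num)
  have h := multiplierExtends_cexp_add hχ hp hq hs (hasTemperateGrowth_phase hα2)
    (fun j hj ↦ exists_norm_iteratedFDeriv_phase_le_const hα2 hj) (continuous_singularPart hα)
    (fun ξ hξ ↦ singularPart_eq_zero α (by linarith))
    (summable_norm_rpow_of_le (subadditiveExponent_pos hp) (by positivity) hr hK0
      fun n hn ↦ hK _ hn)
  have e : (fun ξ : EuclideanSpace ℝ (Fin d) ↦
      Complex.exp ((phase α ξ : ℂ) * Complex.I) + singularPart α ξ) = symbol α :=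
    funext fun ξ ↦ by rw [singularPart]; ring
  rwa [e] at h

/-- The condition `d < (d + α) r` fails at `α = 0`, but the symbol is then the constant `exp(i)`,
also at the origin since `0 ^ 0 = 1`, so a constant phase suffices. -/
theorem multiplierExtends_symbol_zero {β : ℝ} {χ : 𝓢(EuclideanSpace ℝ (Fin d), ℂ)}
    (hχ : IsFrequencyPartition β χ) {p q : ℝ≥0∞} (hp : 0 < p) (hq : 0 < q) {s : ℝ} (hs : 0 ≤ s) :
    MultiplierExtends (symbol 0) β χ p q s := by
  have h := multiplierExtends_cexp_add hχ hp hq hs (P := fun _ ↦ 1) (m := fun _ ↦ 0)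
    (Function.HasTemperateGrowth.const 1)
    (fun j hj ↦ ⟨0, fun ξ ↦ by rw [iteratedFDeriv_const_of_ne (by omega)]; simp⟩)
    continuous_const (fun _ _ ↦ rfl) (by
      have h0 : ∀ n : Fin d → ℤ, 𝓕 (fun _ : EuclideanSpace ℝ (Fin d) ↦ (0 : ℂ))
          (latticePoint n) = 0 := fun n ↦ by simp [fourier_eq_integral_character]
      simp only [h0, norm_zero, Real.zero_rpow (subadditiveExponent_pos hp).ne']
      exact summable_zero)
  have e : (fun _ : EuclideanSpace ℝ (Fin d) ↦
      Complex.exp (((1 : ℝ) : ℂ) * Complex.I) + 0) = symbol 0 :=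
    funext fun ξ ↦ by rw [symbol_eq, Real.rpow_zero, add_zero]
  rwa [e] at h

/-- As `d/(d+1)` is below both `1` and `p`, it is below their minimum `r`, so `d < (d + 1) r`: the
borderline case `α = 1`. -/
theorem lt_mul_subadditiveExponent {p : ℝ≥0∞} (hd : 1 ≤ d)
    (hp : ENNReal.ofReal ((d : ℝ) / (d + 1)) < p) {α : ℝ} (hα : 1 ≤ α) :
    (d : ℝ) < (d + α) * subadditiveExponent p := by
  have hd0 : (0 : ℝ) < d := by exact_mod_cast hd
  have h1 : (d : ℝ) / (d + 1) < subadditiveExponent p := by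
    rw [subadditiveExponent, ← ENNReal.ofReal_lt_iff_lt_toReal (by positivity)
      (ne_top_of_le_ne_top ENNReal.one_ne_top (min_le_left _ _)), lt_min_iff]
    refine ⟨?_, hp⟩
    rw [← ENNReal.ofReal_one, ENNReal.ofReal_lt_ofReal_iff one_pos, div_lt_one (by linarith)]
    linarith
  rw [div_lt_iff₀ (by linarith), mul_comm] at h1
  have h2 : 0 < subadditiveExponent p := subadditiveExponent_pos (zero_le.trans_lt hp)
  nlinarith

end ModulationSpace

end

theorem mainTheorem4 (d : ℕ) (hd : 1 ≤ d) (s : ℝ) (hs : 0 ≤ s) (q : ENNReal) (hq : 0 < q)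
    (β : ℝ) (χ : SchwartzMap (EuclideanSpace ℝ (Fin d)) ℂ)
    (hχ : ModulationSpace.IsFrequencyPartition β χ) :
    (∀ p : ENNReal, 1 ≤ p → ∀ α ∈ Set.Icc (0 : ℝ) 2,
      ModulationSpace.MultiplierExtends (ModulationSpace.symbol α) β χ p q s) ∧
    (∀ α : ℝ, α = 1 ∨ α = 2 → ∀ p : ENNReal, ENNReal.ofReal ((d : ℝ) / (d + 1)) < p →
      ModulationSpace.MultiplierExtends (ModulationSpace.symbol α) β χ p q s) := by
  refine ⟨fun p hp α hα ↦ ?_, fun α hα p hp ↦ ?_⟩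
  · have hp0 : 0 < p := one_pos.trans_le hp
    rcases hα.1.eq_or_lt with rfl | hα0
    · exact ModulationSpace.multiplierExtends_symbol_zero hχ hp0 hq hs
    · refine ModulationSpace.multiplierExtends_symbol hχ hp0 hq hs hα0 hα.2 ?_
      rw [ModulationSpace.subadditiveExponent, min_eq_left hp, ENNReal.toReal_one, mul_one]
      linarith
  · have hα1 : 1 ≤ α := by rcases hα with rfl | rfl <;> norm_num
    have hα2 : α ≤ 2 := by rcases hα with rfl | rfl <;> norm_num
    exact ModulationSpace.multiplierExtends_symbol hχ (zero_le.trans_lt hp) hq hs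
      (by linarith) hα2 (ModulationSpace.lt_mul_subadditiveExponent hd hp hα1)
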